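/- Let $\Omega$ consist of three colours $i\in\{1,2,3\}$, each with one binary operation $\lambda_i$ and two unary operations $\alpha_i^1,\alpha_i^2$ (all written on the right), and let $W$ be the $\Omega$-word algebra (the free $\Omega$-algebra without laws) on one generator $x_0$. Let $U$ be the quotient of $W$ by the congruence generated by the laws $(u\alpha_i^1,u\alpha_i^2)\lambda_i=u$, $(u,v)\lambda_i\alpha_i^1=u$, $(u,v)\lambda_i\alpha_i^2=v$ and $u\alpha_i^l\alpha_j^t=u\alpha_j^t\alpha_i^l$ for all colours $i\neq j$ and all $l,t\in\{1,2\}$ (the generalised Higman algebra on $s=3$ colours). A simple expansion of a subset $Y$ replaces some $y\in Y$ by $y\alpha_i^1,y\alpha_i^2$ for some colour $i$; a simple contraction replaces two distinct elements $a,b\in Y$ by $(a,b)\lambda_i$ for some colour $i$. A subset of $W$ is admissible if it is obtained from $\{x_0\}$ by finitely many simple expansions and contractions, and a subset of $U$ is admissible if it is the image of an admissible subset of $W$. Admissible subsets of $U$ are finite, and they are partially ordered by $A\le B$ if and only if $B$ is obtained from $A$ by finitely many simple expansions. For an admissible $Y\subseteq U$ let $K_Y$ be the poset of all admissible $Z<Y$,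 let $|K_Y|$ be its geometric realisation (the realisation of the simplicial complex of finite non-empty chains of $K_Y$), and let $|K_Y|^t$ be the $t$-skeleton of $|K_Y|$. Then there is a function $\alpha:\mathbb N\to\mathbb N$ (where $0\in\mathbb N$) such that for every $t\in\mathbb N$ and every admissible $Y\subseteq U$ with $|Y|\ge\alpha(t)$: 1. the inclusion $|K_Y|^t\to|K_Y|$ is null-homotopic, i.e. homotopic to a constant map; and 2. $|K_Y|$ is $t$-connected, i.e. non-empty and path-connected with $\pi_k(|K_Y|,x)$ trivial for all $1\le k\le t$ and all base points $x$. -/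

import Mathlib

namespace Brin

open Set Topology

/-! ### `Ω`-algebras with `s` colours, all of arity two -/

/-- An `Ω`-algebra on `s` colours of arity two: for each colour `i` a binary ascending operation
`lam i` (written `(u, v)λ_i`) and two unary descending operations `desc i 0`, `desc i 1`
(written `α_i^1`, `α_i^2`). -/
class OmegaAlgebra (s : ℕ) (A : Type*) where
  desc : Fin s → Fin 2 → A → A
  lam : Fin s → A → A → A

section Sets

variable {s : ℕ} {A : Type*} [OmegaAlgebra s A]

/-- `Z` is the simple expansion of colour `i` of `Y` at some element `y` of `Y`. -/
def IsSimpleExpansion (i : Fin s) (Y Z : Set A) : Prop :=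
  ∃ y ∈ Y, Z = (Y \ {y}) ∪ {OmegaAlgebra.desc i 0 y, OmegaAlgebra.desc i 1 y}

/-- `Z` is a simple contraction of colour `i` of `Y`: two distinct elements `a`, `b` of `Y` are
replaced by `(a, b)λ_i`. -/
def IsSimpleContraction (i : Fin s) (Y Z : Set A) : Prop :=
  ∃ a ∈ Y, ∃ b ∈ Y, a ≠ b ∧ Z = (Y \ {a, b}) ∪ {OmegaAlgebra.lam i a b}

variable (s) in
/-- `Z` is a descendant of `Y`: it is obtained by a finite number of simple expansions. -/
def IsDescendant (Y Z : Set A) : Prop :=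
  Relation.ReflTransGen (fun P Q : Set A => ∃ i : Fin s, IsSimpleExpansion i P Q) Y Z

end Sets

/-! ### The word algebra and the generalised Higman algebra on one generator -/

/-- The `Ω`-word algebra on one generator `x₀`. -/
inductive Word (s : ℕ) : Type
  | base : Word s
  | desc : Fin s → Fin 2 → Word s → Word s
  | lam : Fin s → Word s → Word s → Word s

instance (s : ℕ) : OmegaAlgebra s (Word s) := ⟨Word.desc, Word.lam⟩

/-- A subset of the word algebra is admissible if it is obtained from `{x₀}` by a finite number of
simple expansions and simple contractions. -/
def IsAdmissibleWordSet (s : ℕ) (Y : Set (Word s)) : Prop :=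
  Relation.ReflTransGen
    (fun P Q : Set (Word s) => ∃ i : Fin s, IsSimpleExpansion i P Q ∨ IsSimpleContraction i P Q)
    {Word.base} Y

/-- The congruence of the word algebra generated by all instances of the laws
`u α_i λ_i = u`, `(u, v) λ_i α_i = (u, v)` and `u α_i^l α_j^t = u α_j^t α_i^l` for `i ≠ j`. -/
inductive HigmanRel (s : ℕ) : Word s → Word s → Prop
  | lam_desc (i : Fin s) (u : Word s) : HigmanRel s (.lam i (.desc i 0 u) (.desc i 1 u)) u
  | desc_zero_lam (i : Fin s) (u v : Word s) : HigmanRel s (.desc i 0 (.lam i u v)) u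
  | desc_one_lam (i : Fin s) (u v : Word s) : HigmanRel s (.desc i 1 (.lam i u v)) v
  | desc_comm (i j : Fin s) (l t : Fin 2) (u : Word s) (h : i ≠ j) :
      HigmanRel s (.desc j t (.desc i l u)) (.desc i l (.desc j t u))
  | refl (u : Word s) : HigmanRel s u u
  | symm {u v : Word s} : HigmanRel s u v → HigmanRel s v u
  | trans {u v w : Word s} : HigmanRel s u v → HigmanRel s v w → HigmanRel s u w
  | desc_congr (i : Fin s) (l : Fin 2) {u v : Word s} :
      HigmanRel s u v → HigmanRel s (.desc i l u) (.desc i l v)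
  | lam_congr (i : Fin s) {u u' v v' : Word s} :
      HigmanRel s u u' → HigmanRel s v v' → HigmanRel s (.lam i u v) (.lam i u' v')

/-- The generated congruence as a setoid. -/
def higmanSetoid (s : ℕ) : Setoid (Word s) :=
  ⟨HigmanRel s, HigmanRel.refl, HigmanRel.symm, HigmanRel.trans⟩

/-- The generalised Higman algebra `U({x₀})` on `s` colours. -/
def HigmanAlgebra (s : ℕ) : Type := Quotient (higmanSetoid s)

/-- The canonical epimorphism from the word algebra. -/
def theta (s : ℕ) : Word s → HigmanAlgebra s := Quotient.mk (higmanSetoid s)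

instance (s : ℕ) : OmegaAlgebra s (HigmanAlgebra s) where
  desc i l := Quotient.map (Word.desc i l) fun _ _ h => HigmanRel.desc_congr i l h
  lam i := Quotient.map₂ (Word.lam i) fun _ _ h _ _ h' => HigmanRel.lam_congr i h h'

/-- A subset of the generalised Higman algebra is admissible if it is the image of an admissible
subset of the word algebra. -/
def IsAdmissible (s : ℕ) (Y : Set (HigmanAlgebra s)) : Prop :=
  ∃ Z : Set (Word s), IsAdmissibleWordSet s Z ∧ Y = theta s '' Z

/-! ### Antisymmetry of the descendant relation

The algebra acts on maps of the `s`-fold product of the Cantor set; this separates the elements of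
admissible sets and shows that simple expansions increase the cardinality by one. -/

section Antisymmetry

variable {s : ℕ}

/-- The `s`-fold product of the Cantor set. -/
abbrev Cantor (s : ℕ) : Type := Fin s → ℕ → Fin 2

/-- Prepend the digit `l` to the `i`-th coordinate. -/
def Cantor.cons (i : Fin s) (l : Fin 2) (c : Cantor s) : Cantor s :=
  Function.update c i fun n => Nat.casesOn n l (c i)

/-- Delete the first digit of the `i`-th coordinate. -/
def Cantor.tail (i : Fin s) (c : Cantor s) : Cantor s :=
  Function.update c i fun n => c i (n + 1)

lemma Cantor.cons_head (i : Fin s) (l : Fin 2) (c : Cantor s) : Cantor.cons i l c i 0 = l := by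
  simp [Cantor.cons]

lemma Cantor.tail_cons (i : Fin s) (l : Fin 2) (c : Cantor s) :
    Cantor.tail i (Cantor.cons i l c) = c := by
  simp [Cantor.tail, Cantor.cons]

lemma Cantor.cons_tail (i : Fin s) (c : Cantor s) :
    Cantor.cons i (c i 0) (Cantor.tail i c) = c := by
  funext j n
  by_cases h : j = i
  · subst h
    cases n <;> simp [Cantor.tail, Cantor.cons]
  · simp [Cantor.tail, Cantor.cons, h]

lemma Cantor.cons_comm {i j : Fin s} (h : i ≠ j) (l t : Fin 2) (c : Cantor s) :
    Cantor.cons i l (Cantor.cons j t c) = Cantor.cons j t (Cantor.cons i l c) := by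
  simp only [Cantor.cons, Function.update_of_ne h, Function.update_of_ne h.symm]
  exact Function.update_comm h.symm _ _ _

instance : OmegaAlgebra s (Cantor s → Cantor s) where
  desc i l u := fun c => u (Cantor.cons i l c)
  lam i u v := fun c => if c i 0 = 0 then u (Cantor.tail i c) else v (Cantor.tail i c)

/-- Evaluation of words as self-maps of the product of Cantor sets, `x₀` being the identity. -/
def Word.eval : Word s → Cantor s → Cantor s
  | .base => id
  | .desc i l u => OmegaAlgebra.desc i l u.eval
  | .lam i u v => OmegaAlgebra.lam i u.eval v.eval

lemma HigmanRel.eval_eq {u v : Word s} (h : HigmanRel s u v) : u.eval = v.eval := by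
  induction h with
  | lam_desc i u =>
    funext c
    change (if c i 0 = 0 then u.eval (Cantor.cons i 0 (Cantor.tail i c))
      else u.eval (Cantor.cons i 1 (Cantor.tail i c))) = _
    split_ifs with h
    · rw [← h, Cantor.cons_tail]
    · rw [show (1 : Fin 2) = c i 0 by omega, Cantor.cons_tail]
  | desc_zero_lam i u v =>
    funext c
    change (if Cantor.cons i 0 c i 0 = 0 then _ else _) = _
    simp [Cantor.cons_head, Cantor.tail_cons]
  | desc_one_lam i u v =>
    funext c
    change (if Cantor.cons i 1 c i 0 = 0 then _ else _) = _
    simp [Cantor.cons_head, Cantor.tail_cons]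
  | desc_comm i j l t u h =>
    funext c
    change u.eval _ = u.eval _
    rw [Cantor.cons_comm h]
  | refl => rfl
  | symm _ ih => exact ih.symm
  | trans _ _ ih ih' => exact ih.trans ih'
  | desc_congr i l _ ih => simp only [Word.eval, ih]
  | lam_congr i _ _ ih ih' => simp only [Word.eval, ih, ih']

/-- Evaluation on the generalised Higman algebra. -/
def HigmanAlgebra.eval : HigmanAlgebra s → Cantor s → Cantor s :=
  Quotient.lift Word.eval fun _ _ h => HigmanRel.eval_eq h

lemma HigmanAlgebra.eval_desc (i : Fin s) (l : Fin 2) (u : HigmanAlgebra s) (c : Cantor s) :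
    (OmegaAlgebra.desc i l u).eval c = u.eval (Cantor.cons i l c) := by
  induction u using Quotient.inductionOn
  rfl

/-- The elements of `Y` are realised by injective maps with pairwise disjoint images. -/
def Separated {A : Type*} (ev : A → Cantor s → Cantor s) (Y : Set A) : Prop :=
  ∀ u ∈ Y, ∀ v ∈ Y, ∀ c d : Cantor s, ev u c = ev v d → u = v ∧ c = d

lemma Separated.expansion {A : Type*} [OmegaAlgebra s A] {ev : A → Cantor s → Cantor s}
    (hev : ∀ (i : Fin s) (l : Fin 2) (u : A) (c : Cantor s),
      ev (OmegaAlgebra.desc i l u) c = ev u (Cantor.cons i l c))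
    {Y : Set A} (hY : Separated ev Y) {i : Fin s} {Z : Set A} (h : IsSimpleExpansion i Y Z) :
    Separated ev Z := by
  obtain ⟨y, hy, rfl⟩ := h
  have key : ∀ u ∈ (Y \ {y}) ∪ {OmegaAlgebra.desc i 0 y, OmegaAlgebra.desc i 1 y},
      (u ∈ Y ∧ u ≠ y) ∨ ∃ l, u = OmegaAlgebra.desc i l y := by
    rintro u (hu | hu | hu)
    · exact .inl hu
    · exact .inr ⟨0, hu⟩
    · exact .inr ⟨1, hu⟩
  intro u hu v hv c d e
  rcases key u hu with ⟨hu1, hu2⟩ | ⟨l, rfl⟩ <;> rcases key v hv with ⟨hv1, hv2⟩ | ⟨m, rfl⟩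
  · exact hY u hu1 v hv1 c d e
  · rw [hev] at e
    exact absurd (hY _ hu1 _ hy _ _ e).1 hu2
  · rw [hev] at e
    exact absurd (hY _ hy _ hv1 _ _ e).1.symm hv2
  · rw [hev, hev] at e
    have e' := (hY _ hy _ hy _ _ e).2
    have h1 := congrArg (fun c : Cantor s => c i 0) e'
    have h2 := congrArg (Cantor.tail i) e'
    simp only [Cantor.cons_head] at h1
    rw [Cantor.tail_cons, Cantor.tail_cons] at h2
    exact ⟨by rw [h1], h2⟩

lemma Separated.contraction {Y : Set (Word s)} (hY : Separated Word.eval Y) {i : Fin s}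
    {Z : Set (Word s)} (h : IsSimpleContraction i Y Z) : Separated Word.eval Z := by
  obtain ⟨a, ha, b, hb, hab, rfl⟩ := h
  have ev (c : Cantor s) : ∃ w ∈ Y, (w = a ∨ w = b) ∧ (w = a ↔ c i 0 = 0) ∧
      (OmegaAlgebra.lam i a b : Word s).eval c = w.eval (Cantor.tail i c) := by
    by_cases h : c i 0 = 0
    · exact ⟨a, ha, .inl rfl, by simp [h], if_pos h⟩
    · exact ⟨b, hb, .inr rfl, by simp [h, hab.symm], if_neg h⟩
  have ne : ∀ w, w ∈ Y \ {a, b} → w ∈ Y ∧ w ≠ a ∧ w ≠ b := by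
    intro w hw
    simpa using hw
  rintro u (hu | rfl) v (hv | rfl) c d e
  · exact hY u (ne u hu).1 v (ne v hv).1 c d e
  · obtain ⟨w, hw, hw', -, h⟩ := ev d
    rw [h] at e
    have := (hY _ (ne u hu).1 _ hw _ _ e).1
    have := ne u hu
    grind
  · obtain ⟨w, hw, hw', -, h⟩ := ev c
    rw [h] at e
    have := (hY _ hw _ (ne v hv).1 _ _ e).1
    have := ne v hv
    grind
  · obtain ⟨w, hw, hw', hc, h⟩ := ev c
    obtain ⟨w', hx, hx', hd, h'⟩ := ev d
    rw [h, h'] at e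
    obtain ⟨rfl, ht⟩ := hY _ hw _ hx _ _ e
    refine ⟨rfl, ?_⟩
    have h0 : c i 0 = d i 0 := by
      have : c i 0 = 0 ↔ d i 0 = 0 := hc.symm.trans hd
      omega
    rw [← Cantor.cons_tail i c, ← Cantor.cons_tail i d, h0, ht]

lemma IsAdmissibleWordSet.separated_finite {Y : Set (Word s)} (h : IsAdmissibleWordSet s Y) :
    Separated Word.eval Y ∧ Y.Finite := by
  induction h with
  | refl =>
    refine ⟨?_, Set.finite_singleton _⟩
    rintro u rfl v rfl c d e
    exact ⟨rfl, e⟩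
  | tail _ h ih =>
    obtain ⟨i, h | h⟩ := h
    · refine ⟨ih.1.expansion (fun _ _ _ _ => rfl) h, ?_⟩
      obtain ⟨y, -, rfl⟩ := h
      exact (ih.2.sdiff).union (Set.toFinite _)
    · refine ⟨ih.1.contraction h, ?_⟩
      obtain ⟨a, -, b, -, -, rfl⟩ := h
      exact (ih.2.sdiff).union (Set.toFinite _)

lemma IsAdmissible.separated_finite {Y : Set (HigmanAlgebra s)} (h : IsAdmissible s Y) :
    Separated HigmanAlgebra.eval Y ∧ Y.Finite := by
  obtain ⟨Z, hZ, rfl⟩ := h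
  obtain ⟨h1, h2⟩ := hZ.separated_finite
  refine ⟨?_, h2.image _⟩
  rintro _ ⟨u, hu, rfl⟩ _ ⟨v, hv, rfl⟩ c d e
  obtain ⟨rfl, e'⟩ := h1 u hu v hv c d e
  exact ⟨rfl, e'⟩

lemma IsSimpleExpansion.ncard_eq {Y Z : Set (HigmanAlgebra s)} {i : Fin s}
    (hY : Separated HigmanAlgebra.eval Y) (hf : Y.Finite) (h : IsSimpleExpansion i Y Z) :
    Z.ncard = Y.ncard + 1 := by
  obtain ⟨y, hy, rfl⟩ := h
  let c : Cantor s := fun _ _ => 0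
  have h01 : (OmegaAlgebra.desc i 0 y : HigmanAlgebra s) ≠ OmegaAlgebra.desc i 1 y := by
    intro h
    have h1 := congrArg (fun u : HigmanAlgebra s => u.eval c) h
    simp only [HigmanAlgebra.eval_desc] at h1
    have h2 := congrArg (fun c : Cantor s => c i 0) (hY _ hy _ hy _ _ h1).2
    simp [Cantor.cons_head] at h2
  have hne (l : Fin 2) : (OmegaAlgebra.desc i l y : HigmanAlgebra s) ∉ Y \ {y} := by
    rintro ⟨h1, h2⟩
    exact h2 (hY _ h1 _ hy c _ (HigmanAlgebra.eval_desc i l y c)).1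
  rw [Set.ncard_union_eq (by
    rw [Set.disjoint_right]
    rintro u (rfl | rfl)
    · exact hne 0
    · exact hne 1) hf.sdiff (Set.toFinite _), Set.ncard_pair h01,
    ← Set.ncard_sdiff_singleton_add_one hy hf]

lemma IsDescendant.ncard_lt_or_eq {Y Z : Set (HigmanAlgebra s)}
    (hY : Separated HigmanAlgebra.eval Y) (hf : Y.Finite) (h : IsDescendant s Y Z) :
    (Y = Z ∨ Y.ncard < Z.ncard) ∧ Separated HigmanAlgebra.eval Z ∧ Z.Finite := by
  induction h with
  | refl => exact ⟨.inl rfl, hY, hf⟩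
  | tail _ h ih =>
    obtain ⟨i, h⟩ := h
    obtain ⟨h1, h2, h3⟩ := ih
    have h4 := h.ncard_eq h2 h3
    refine ⟨.inr ?_, h2.expansion HigmanAlgebra.eval_desc h, ?_⟩
    · rcases h1 with rfl | h1 <;> omega
    · exact Set.finite_of_ncard_pos (by omega)

end Antisymmetry

/-! ### The poset of admissible sets -/

/-- The set of admissible subsets of the generalised Higman algebra on `s` colours. -/
@[ext]
structure AdmissibleSet (s : ℕ) where
  carrier : Set (HigmanAlgebra s)
  admissible : IsAdmissible s carrier

/-- Admissible sets are ordered by `A ≤ B` if and only if `B` is a descendant of `A`. -/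
instance (s : ℕ) : PartialOrder (AdmissibleSet s) where
  le A B := IsDescendant s A.carrier B.carrier
  le_refl _ := Relation.ReflTransGen.refl
  le_trans _ _ _ h h' := Relation.ReflTransGen.trans h h'
  le_antisymm A B h h' := by
    obtain ⟨h1, h2⟩ := A.admissible.separated_finite
    obtain ⟨h1', h2'⟩ := B.admissible.separated_finite
    have e := (IsDescendant.ncard_lt_or_eq h1 h2 h).1
    have e' := (IsDescendant.ncard_lt_or_eq h1' h2' h').1
    apply AdmissibleSet.ext
    rcases e with e | e
    · exact e
    · rcases e' with e' | e'
      · exact e'.symm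
      · omega

/-- The number `|Y|` of elements of an admissible set. -/
noncomputable def AdmissibleSet.card {s : ℕ} (Y : AdmissibleSet s) : ℕ := Y.carrier.ncard

/-- The poset `K_Y` of admissible sets `Z < Y`. -/
abbrev AdmissibleSet.K {s : ℕ} (Y : AdmissibleSet s) : Type := {Z : AdmissibleSet s // Z < Y}

/-! ### Geometric realisation, skeleta and connectivity -/

/-- The simplicial complex of finite non-empty chains of a poset. -/
def orderComplex (P : Type*) [PartialOrder P] : AbstractSimplicialComplex P where
  faces := {σ | σ.Nonempty ∧ IsChain (· ≤ ·) (σ : Set P)}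
  isRelLowerSet_faces := fun _ h =>
    ⟨h.1, fun _ hτ hne => ⟨hne, h.2.mono (Finset.coe_subset.2 hτ)⟩⟩
  singleton_mem v := ⟨Finset.singleton_nonempty v, by simp⟩

/-- The points of the geometric realisation of a simplicial complex, in barycentric coordinates. -/
def Realization {V : Type*} (K : AbstractSimplicialComplex V) : Type _ :=
  {x : V →₀ ℝ // (∀ v, 0 ≤ x v) ∧ (x.sum fun _ a => a) = 1 ∧ x.support ∈ K.faces}

/-- The closed simplex of the realisation spanned by the vertices in `σ`. -/
def Realization.closedSimplex {V : Type*} (K : AbstractSimplicialComplex V) (σ : Finset V) :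
    Set (Realization K) :=
  {x | x.1.support ⊆ σ}

/-- The weak topology: a subset of the realisation is open if and only if its intersection with
each closed simplex is open in the Euclidean topology of that simplex. -/
instance {V : Type*} (K : AbstractSimplicialComplex V) : TopologicalSpace (Realization K) :=
  ⨆ σ : K.faces, TopologicalSpace.coinduced
    (Subtype.val : Realization.closedSimplex K σ.1 → Realization K)
    (TopologicalSpace.induced (fun x (v : V) => x.1.1 v) Pi.topologicalSpace)

/-- The `t`-skeleton of the realisation: the union of the simplices of dimension at most `t`. -/
def Realization.skeleton {V : Type*} (K : AbstractSimplicialComplex V) (t : ℕ) :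
    Set (Realization K) :=
  {x | x.1.support.card ≤ t + 1}

/-- The inclusion of the `t`-skeleton. -/
def Realization.skeletonInclusion {V : Type*} (K : AbstractSimplicialComplex V) (t : ℕ) :
    C(Realization.skeleton K t, Realization K) :=
  ⟨Subtype.val, continuous_subtype_val⟩

/-- A space is `t`-connected if it is non-empty and path-connected and its homotopy groups
`π_k` vanish for `1 ≤ k ≤ t`. -/
def IsTConnected (t : ℕ) (X : Type*) [TopologicalSpace X] : Prop :=
  PathConnectedSpace X ∧ ∀ k : ℕ, 1 ≤ k → k ≤ t → ∀ x : X, Subsingleton (HomotopyGroup.Pi k X x)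

end Brin

namespace Brin
open Set Topology Metric

/-! ### Homotopies on subsets and fillings of spheres -/

section Filling

variable {A B X : Type*} [TopologicalSpace A] [TopologicalSpace B] [TopologicalSpace X]

/-! Call `W < Y` elementary if `Y ≤ W.full`, where `full` expands every element in all three
colours, into eight corners; each element of such a `W` then splits into at most 8 elements of `Y`.
Let `E` be the set of elementary members of `K_Y`. The proof works with `Fill d`: a map of the
sphere of dimension `d - 1` extends to the ball. For `d = 0` the sphere is empty and the ball is a
point.

Reduction to `E`. Bounded joins exist (`exists_isLUB`), so each `V ≥ Z` has a largest elementary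
expansion `core V` of `Z` below it (`exists_core`). If `Z` is not elementary, then `core Y < Y`, and
`V ≥ core V ≤ core Y` contracts the open interval between `Z` and `Y` conically
(`nullIn_of_notMem_elementary`). A fibre argument in the manner of Quillen, by descending induction
on `Z`, transfers fillings from `E` to `K_Y` (`fill_univ_of_upper`).

Fillings in `E`. Let `supp V` be the set of elements of `Y` missing from `V`. If `a, b` are elements
of `Y` outside a finite set `T`, contracting them is possible in every `V` with support in `T`, and
`V ≥ V/ab ≤ Y/ab` contracts the part of `E` supported in `T` inside the part supported in `T ∪ {a,
b}` (`exists_nullIn`). This needs only `|T| + 2 ≤ |Y|`, but the image of a sphere need not have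
small support. Locally it can be made small, without any condition on `|Y|`: above a fixed `W` in
`E`, either some element of `W` splits in `Y` into elements outside `T` and may be contracted to, or
`|supp W| ≤ 8|T|` and `W` itself serves as cone point (`exists_nullIn_above`).

Both statements are applied cell by cell on a fine cubical grid of the sphere, on each cell of which
the approximated map runs in a single chain (`exists_chain_approx`). The first pass bounds the
supports, the second contracts the map to a point (`fill_of_bounded_nullIn`). A label grows only
along faces, and a cell has at most `4 ^ d` of these, so the required size `fillBound d` does not
depend on the mesh. That independence yields `α`.

Finally, `Fill d` for `d ≤ t + 1` gives `t`-connectedness, and also a nullhomotopy of the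
`t`-skeleton built over cells of dimension at most `t`. -/

open Classical in
lemma continuousOn_piecewise_of_isClosed {K U V : Set A} {f g : A → X} (hU : IsClosed U)
    (hV : IsClosed V) (hK : K ⊆ U ∪ V) (hf : ContinuousOn f (K ∩ U)) (hg : ContinuousOn g (K ∩ V))
    (h : EqOn f g (K ∩ U ∩ V)) : ContinuousOn (U.piecewise f g) K := by
  have hKU : K = K ∩ U ∪ K ∩ V := by rw [← inter_union_distrib_left, inter_eq_left.2 hK]
  rw [hKU]
  intro x hx
  refine ContinuousWithinAt.union ?_ ?_
  · by_cases hxU : x ∈ U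
    · have hxK : x ∈ K := by rcases hx with h | h <;> exact h.1
      exact (hf x ⟨hxK, hxU⟩).congr (fun y hy => piecewise_eq_of_mem _ _ _ hy.2)
        (piecewise_eq_of_mem _ _ _ hxU)
    · exact continuousWithinAt_of_notMem_closure fun hc =>
        hxU (closure_minimal inter_subset_right hU hc)
  · by_cases hxV : x ∈ V
    · have hxK : x ∈ K := by rcases hx with h | h <;> exact h.1
      have key : ∀ y ∈ K ∩ V, U.piecewise f g y = g y := by
        intro y hy
        by_cases hyU : y ∈ U
        · rw [piecewise_eq_of_mem _ _ _ hyU]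
          exact h ⟨⟨hy.1, hyU⟩, hy.2⟩
        · exact piecewise_eq_of_notMem _ _ _ hyU
      exact (hg x ⟨hxK, hxV⟩).congr key (key x ⟨hxK, hxV⟩)
    · exact continuousWithinAt_of_notMem_closure fun hc =>
        hxV (closure_minimal inter_subset_right hV hc)

/-- `f` and `g` are homotopic on `K` through maps into `S`. -/
def HtpyOn (K : Set A) (S : Set X) (f g : A → X) : Prop :=
  ∃ H : ℝ × A → X, ContinuousOn H (Icc 0 1 ×ˢ K) ∧ (∀ x ∈ K, H (0, x) = f x) ∧
    (∀ x ∈ K, H (1, x) = g x) ∧ MapsTo H (Icc 0 1 ×ˢ K) S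

lemma HtpyOn.congr {K : Set A} {S : Set X} {f g f' g' : A → X} (h : HtpyOn K S f g)
    (hf : EqOn f f' K) (hg : EqOn g g' K) : HtpyOn K S f' g' := by
  obtain ⟨H, h1, h2, h3, h4⟩ := h
  exact ⟨H, h1, fun x hx => (h2 x hx).trans (hf hx), fun x hx => (h3 x hx).trans (hg hx), h4⟩

lemma HtpyOn.comp {K : Set A} {S : Set X} {f g : A → X} (h : HtpyOn K S f g) {L : Set B}
    {φ : B → A} (hφ : ContinuousOn φ L) (hL : MapsTo φ L K) :
    HtpyOn L S (f ∘ φ) (g ∘ φ) := by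
  obtain ⟨H, h1, h2, h3, h4⟩ := h
  have hm : MapsTo (fun p : ℝ × B => (p.1, φ p.2)) (Icc 0 1 ×ˢ L) (Icc 0 1 ×ˢ K) :=
    fun p hp => ⟨hp.1, hL hp.2⟩
  refine ⟨fun p => H (p.1, φ p.2), h1.comp ?_ hm, fun x hx => h2 _ (hL hx),
    fun x hx => h3 _ (hL hx), h4.comp hm⟩
  exact continuousOn_fst.prodMk (hφ.comp continuousOn_snd fun p hp => hp.2)

lemma HtpyOn.trans {K : Set A} {S : Set X} {f g h : A → X} (h₁ : HtpyOn K S f g)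
    (h₂ : HtpyOn K S g h) : HtpyOn K S f h := by
  classical
  obtain ⟨H, a1, a2, a3, a4⟩ := h₁
  obtain ⟨G, b1, b2, b3, b4⟩ := h₂
  let U : Set (ℝ × A) := {p | p.1 ≤ 1 / 2}
  let V : Set (ℝ × A) := {p | 1 / 2 ≤ p.1}
  have mU : MapsTo (fun p : ℝ × A => (2 * p.1, p.2)) (Icc 0 1 ×ˢ K ∩ U) (Icc 0 1 ×ˢ K) := by
    rintro p ⟨⟨hp, hp'⟩, hpU⟩
    refine ⟨⟨?_, ?_⟩, hp'⟩
    · have := hp.1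
      simp only
      linarith
    · have : p.1 ≤ 1 / 2 := hpU
      simp only
      linarith
  have mV : MapsTo (fun p : ℝ × A => (2 * p.1 - 1, p.2)) (Icc 0 1 ×ˢ K ∩ V) (Icc 0 1 ×ˢ K) := by
    rintro p ⟨⟨hp, hp'⟩, hpV⟩
    refine ⟨⟨?_, ?_⟩, hp'⟩
    · have : 1 / 2 ≤ p.1 := hpV
      simp only
      linarith
    · have := hp.2
      simp only
      linarith
  refine ⟨U.piecewise (fun p => H (2 * p.1, p.2)) (fun p => G (2 * p.1 - 1, p.2)), ?_, ?_, ?_, ?_⟩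
  · refine continuousOn_piecewise_of_isClosed (V := V) (isClosed_le (by fun_prop) (by fun_prop))
      (isClosed_le (by fun_prop) (by fun_prop)) (fun p _ => le_total p.1 (1 / 2)) ?_ ?_ ?_
    · exact a1.comp (by fun_prop) mU
    · exact b1.comp (by fun_prop) mV
    · rintro p ⟨⟨hp, hpU⟩, hpV⟩
      have : p.1 = 1 / 2 := le_antisymm hpU hpV
      simp only [this]
      norm_num
      rw [a3 _ hp.2, b2 _ hp.2]
  · intro x hx
    rw [piecewise_eq_of_mem _ _ _ (by change (0 : ℝ) ≤ 1 / 2; norm_num)]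
    simpa using a2 x hx
  · intro x hx
    rw [piecewise_eq_of_notMem _ _ _ (by change ¬ (1 : ℝ) ≤ 1 / 2; norm_num)]
    norm_num
    exact b3 x hx
  · intro p hp
    by_cases hpU : p ∈ U
    · rw [piecewise_eq_of_mem _ _ _ hpU]
      exact a4 (mU ⟨hp, hpU⟩)
    · rw [piecewise_eq_of_notMem _ _ _ hpU]
      have hpV : p ∈ V := (lt_of_not_ge hpU : 1 / 2 < p.1).le
      exact b4 (mV ⟨hp, hpV⟩)

/-- The homotopy runs along a collar of the ball, and a shrunken copy of `g` fills the inner ball of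
radius `1 / 2`. -/
lemma exists_extension_of_htpyOn {n : ℕ} {S : Set X} {f g : (Fin n → ℝ) → X}
    (h : HtpyOn (sphere 0 1) S f g) (hg : ContinuousOn g (closedBall 0 1))
    (hgS : MapsTo g (closedBall 0 1) S) :
    ∃ F : (Fin n → ℝ) → X, ContinuousOn F (closedBall 0 1) ∧ MapsTo F (closedBall 0 1) S ∧
      EqOn F f (sphere 0 1) := by
  classical
  obtain ⟨H, a1, a2, a3, a4⟩ := h
  let U : Set (Fin n → ℝ) := {x | ‖x‖ ≤ 1 / 2}
  let V : Set (Fin n → ℝ) := {x | 1 / 2 ≤ ‖x‖}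
  have mU : MapsTo (fun x : Fin n → ℝ => (2 : ℝ) • x) (closedBall 0 1 ∩ U) (closedBall 0 1) := by
    rintro x ⟨-, hx⟩
    have : ‖x‖ ≤ 1 / 2 := hx
    simp only [mem_closedBall_zero_iff, norm_smul]
    norm_num
    linarith
  have mV : MapsTo (fun x : Fin n → ℝ => (2 - 2 * ‖x‖, ‖x‖⁻¹ • x)) (closedBall 0 1 ∩ V)
      (Icc 0 1 ×ˢ sphere 0 1) := by
    rintro x ⟨hx', hx⟩
    have h1 : 1 / 2 ≤ ‖x‖ := hx
    rw [mem_closedBall_zero_iff] at hx'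
    refine ⟨⟨?_, ?_⟩, ?_⟩
    · simp only
      linarith
    · simp only
      linarith
    · simp only [mem_sphere_zero_iff_norm, norm_smul, norm_inv, norm_norm]
      exact inv_mul_cancel₀ (by linarith)
  refine ⟨U.piecewise (fun x => g ((2 : ℝ) • x)) (fun x => H (2 - 2 * ‖x‖, ‖x‖⁻¹ • x)), ?_, ?_, ?_⟩
  · refine continuousOn_piecewise_of_isClosed (V := V) (isClosed_le (by fun_prop) (by fun_prop))
      (isClosed_le (by fun_prop) (by fun_prop)) (fun p _ => le_total ‖p‖ (1 / 2)) ?_ ?_ ?_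
    · exact hg.comp (by fun_prop) mU
    · refine a1.comp ?_ mV
      refine ContinuousOn.prodMk (by fun_prop) (ContinuousOn.smul (f := fun x => ‖x‖⁻¹) (g := fun x => x) ?_
        continuousOn_id)
      refine ContinuousOn.inv₀ (by fun_prop) ?_
      rintro x ⟨-, hx⟩
      have : 1 / 2 ≤ ‖x‖ := hx
      linarith
    · rintro x ⟨hx, hxV⟩
      have hn : ‖x‖ = 1 / 2 := le_antisymm hx.2 hxV
      have hs : (2 : ℝ) • x ∈ sphere (0 : Fin n → ℝ) 1 := by
        simp [norm_smul, hn]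
      simp only [hn]
      norm_num
      exact (a3 _ hs).symm
  · intro x hx
    by_cases hxU : x ∈ U
    · rw [piecewise_eq_of_mem _ _ _ hxU]
      exact hgS (mU ⟨hx, hxU⟩)
    · rw [piecewise_eq_of_notMem _ _ _ hxU]
      have hxV : x ∈ V := (lt_of_not_ge hxU : 1 / 2 < ‖x‖).le
      exact a4 (mV ⟨hx, hxV⟩)
  · intro x hx
    have hn : ‖x‖ = 1 := by simpa using hx
    rw [piecewise_eq_of_notMem _ _ _ (by change ¬ ‖x‖ ≤ 1 / 2; rw [hn]; norm_num)]
    simp only [hn]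
    norm_num
    exact a2 x hx

/-- Every map of the sphere of dimension `d - 1` into `S` extends to a map of the ball into `S'`. -/
def Fill (d : ℕ) (S S' : Set X) : Prop :=
  ∀ f : (Fin d → ℝ) → X, ContinuousOn f (sphere 0 1) → MapsTo f (sphere 0 1) S →
    ∃ g : (Fin d → ℝ) → X, ContinuousOn g (closedBall 0 1) ∧ MapsTo g (closedBall 0 1) S' ∧
      EqOn g f (sphere 0 1)

/-- The inclusion of `S` into `S'` is homotopic to a constant map. -/
def NullIn (S S' : Set X) : Prop := ∃ p ∈ S', HtpyOn S S' id fun _ => p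

lemma NullIn.fill {S S' : Set X} (h : NullIn S S') (d : ℕ) : Fill d S S' := by
  obtain ⟨p, hp, h⟩ := h
  intro f hf hfS
  exact exists_extension_of_htpyOn (h.comp hf hfS) continuousOn_const fun _ _ => hp

end Filling
end Brin

namespace Brin
open Set Topology Metric

/-! ### Lattice cells and extension of maps cell by cell -/

/-- A closed cell of the cubical decomposition of `ι → ℝ` with integral vertices. -/
@[ext]
structure Cell (ι : Type*) where
  lo : ι → ℤ
  hi : ι → ℤ
  lo_le : ∀ i, lo i ≤ hi i
  hi_le : ∀ i, hi i ≤ lo i + 1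

namespace Cell

variable {ι X : Type*} [TopologicalSpace X]

instance : PartialOrder (Cell ι) where
  le c d := ∀ i, d.lo i ≤ c.lo i ∧ c.hi i ≤ d.hi i
  le_refl _ _ := ⟨le_rfl, le_rfl⟩
  le_trans _ _ _ h h' i := ⟨(h' i).1.trans (h i).1, (h i).2.trans (h' i).2⟩
  le_antisymm c d h h' := by
    ext i
    · exact le_antisymm (h' i).1 (h i).1
    · exact le_antisymm (h i).2 (h' i).2

/-- The points of a cell. -/
def body (c : Cell ι) : Set (ι → ℝ) := {x | ∀ i, (c.lo i : ℝ) ≤ x i ∧ x i ≤ c.hi i}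

/-- The relative boundary of a cell. -/
def bd (c : Cell ι) : Set (ι → ℝ) :=
  {x | x ∈ c.body ∧ ∃ i, c.lo i < c.hi i ∧ (x i = c.lo i ∨ x i = c.hi i)}

lemma body_mono {c d : Cell ι} (h : c ≤ d) : c.body ⊆ d.body := fun _ hx i =>
  ⟨(Int.cast_le.2 (h i).1).trans (hx i).1, (hx i).2.trans (Int.cast_le.2 (h i).2)⟩

lemma isClosed_body (c : Cell ι) : IsClosed c.body := by
  simp only [body, ofPred_forall, ofPred_and]
  exact isClosed_iInter fun i => (isClosed_le (by fun_prop) (by fun_prop)).inter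
    (isClosed_le (by fun_prop) (by fun_prop))

/-- Endpoints are integers, so a coordinate strictly inside a unit interval of `c` forces the
corresponding interval of `d` to contain that interval. Hence distinct cells meet only along faces.
-/
lemma le_of_mem_body {c d : Cell ι} {x : ι → ℝ} (hc : x ∈ c.body) (hd : x ∈ d.body)
    (hb : x ∉ c.bd) : c ≤ d := by
  intro i
  have h1 := hc i
  have h2 := hd i
  rcases (c.lo_le i).lt_or_eq with h | h
  · have h3 : ¬ (x i = c.lo i ∨ x i = c.hi i) := fun h' => hb ⟨hc, i, h, h'⟩
    push Not at h3
    have h4 : (c.lo i : ℝ) < x i := lt_of_le_of_ne h1.1 h3.1.symm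
    have h5 : x i < c.hi i := lt_of_le_of_ne h1.2 h3.2
    have h6 : c.lo i < d.hi i := by exact_mod_cast h4.trans_le h2.2
    have h7 : d.lo i < c.hi i := by exact_mod_cast h2.1.trans_lt h5
    have := c.hi_le i
    omega
  · have h3 : x i = c.lo i := le_antisymm (by rw [h]; exact h1.2) h1.1
    rw [h3] at h2
    have h4 : d.lo i ≤ c.lo i := by exact_mod_cast h2.1
    have h5 : c.lo i ≤ d.hi i := by exact_mod_cast h2.2
    omega

lemma exists_lt_of_mem_bd {c : Cell ι} {x : ι → ℝ} (hx : x ∈ c.bd) : ∃ d < c, x ∈ d.body := by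
  classical
  obtain ⟨hx, i, hi, h⟩ := hx
  obtain ⟨a, ha, hxa⟩ : ∃ a : ℤ, (a = c.lo i ∨ a = c.hi i) ∧ x i = a := by
    rcases h with h | h
    · exact ⟨_, .inl rfl, h⟩
    · exact ⟨_, .inr rfl, h⟩
  let d : Cell ι := ⟨Function.update c.lo i a, Function.update c.hi i a, fun j => by
    by_cases hj : j = i
    · subst hj
      simp
    · simpa [hj] using c.lo_le j, fun j => by
    by_cases hj : j = i
    · subst hj
      simp
    · simpa [hj] using c.hi_le j⟩
  have hdc : d ≤ c := by
    intro j
    by_cases hj : j = i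
    · subst hj
      simp only [d, Function.update_self]
      omega
    · simp [d, hj]
  refine ⟨d, lt_of_le_of_ne hdc ?_, ?_⟩
  · intro he
    have h1 : d.lo i = c.lo i := by rw [he]
    have h2 : d.hi i = c.hi i := by rw [he]
    simp only [d, Function.update_self] at h1 h2
    omega
  · intro j
    by_cases hj : j = i
    · subst hj
      simp [d, hxa]
    · simpa [d, hj] using hx j

variable [Fintype ι]

/-- The dimension of a cell. -/
def dim (c : Cell ι) : ℕ := (Finset.univ.filter fun i => c.lo i < c.hi i).card

lemma dim_lt_of_lt {c d : Cell ι} (h : c < d) : c.dim < d.dim := by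
  refine Finset.card_lt_card (Finset.ssubset_iff_of_subset ?_ |>.2 ?_)
  · intro i hi
    have := h.le i
    simp only [Finset.mem_filter, Finset.mem_univ, true_and] at hi ⊢
    omega
  · by_contra! hc
    refine h.ne (Cell.ext (funext fun i => ?_) (funext fun i => ?_)) <;>
    · have h1 := hc i
      have h2 := h.le i
      have h3 := c.lo_le i
      have h4 := d.hi_le i
      have h5 := d.lo_le i
      simp only [Finset.mem_filter, Finset.mem_univ, true_and] at h1
      by_cases h6 : d.lo i < d.hi i
      · have := h1 h6
        omega
      · omega

/-- The unit ball of the sup norm is a cube, so an affine change of the non-degenerate coordinates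
identifies the cell and its boundary with a ball and its sphere. `ψ` inverts `φ` by freezing the
degenerate coordinates. -/
lemma exists_extension (c : Cell ι) {S S' : Set X} (h : Fill c.dim S S') {f : (ι → ℝ) → X}
    (hf : ContinuousOn f c.bd) (hfS : MapsTo f c.bd S) :
    ∃ g : (ι → ℝ) → X, ContinuousOn g c.body ∧ MapsTo g c.body S' ∧ EqOn g f c.bd := by
  classical
  let D : Finset ι := Finset.univ.filter fun i => c.lo i < c.hi i
  have hD : ∀ i, i ∈ D ↔ c.lo i < c.hi i := fun i => by simp [D]
  have hhi : ∀ i ∈ D, (c.hi i : ℝ) = c.lo i + 1 := by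
    intro i hi
    have h1 := (hD i).1 hi
    have h2 := c.hi_le i
    have : c.hi i = c.lo i + 1 := by omega
    exact_mod_cast this
  let e : D ≃ Fin c.dim := D.equivFin
  let φ : (ι → ℝ) → (Fin c.dim → ℝ) := fun x j =>
    2 * (x (e.symm j) - c.lo (e.symm j)) - 1
  let ψ : (Fin c.dim → ℝ) → (ι → ℝ) := fun y i =>
    if hi : i ∈ D then c.lo i + (y (e ⟨i, hi⟩) + 1) / 2 else c.lo i
  have hφ : Continuous φ := by fun_prop
  have hψ : Continuous ψ := by
    refine continuous_pi fun i => ?_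
    by_cases hi : i ∈ D
    · simp only [ψ, hi, dif_pos]
      fun_prop
    · simp only [ψ, hi, dif_neg, not_false_eq_true]
      fun_prop
  have ball : ∀ y : Fin c.dim → ℝ, y ∈ closedBall (0 : Fin c.dim → ℝ) 1 ↔ ∀ j, |y j| ≤ 1 := by
    intro y
    simp [pi_norm_le_iff_of_nonneg]
  have φball : MapsTo φ c.body (closedBall 0 1) := by
    intro x hx
    rw [ball]
    intro j
    have h1 := hx (e.symm j)
    rw [hhi _ (e.symm j).2] at h1
    rw [abs_le]
    constructor <;> simp only [φ] <;> linarith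
  have φbd : MapsTo φ c.bd (sphere 0 1) := by
    rintro x ⟨hx, i, hi, h⟩
    have h1 : ‖φ x‖ ≤ 1 := by simpa using φball hx
    have hiD := (hD i).2 hi
    rw [mem_sphere_zero_iff_norm]
    refine le_antisymm h1 ?_
    have h2 := norm_le_pi_norm (φ x) (e ⟨i, hiD⟩)
    have h3 : ‖φ x (e ⟨i, hiD⟩)‖ = 1 := by
      simp only [φ, Equiv.symm_apply_apply]
      rcases h with h | h
      · rw [h]
        norm_num
      · rw [h, hhi i hiD]
        norm_num
    rwa [h3] at h2
  have ψbd : MapsTo ψ (sphere 0 1) c.bd := by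
    intro y hy
    have hy' : ∀ j, |y j| ≤ 1 := (ball y).1 (sphere_subset_closedBall hy)
    refine ⟨fun i => ?_, ?_⟩
    · by_cases hi : i ∈ D
      · have h1 := abs_le.1 (hy' (e ⟨i, hi⟩))
        simp only [ψ, hi, dif_pos, hhi i hi]
        constructor <;> linarith
      · simpa only [ψ, hi, dif_neg, not_false_eq_true, le_refl, true_and, Int.cast_le]
          using c.lo_le i
    · obtain ⟨j, hj⟩ : ∃ j, |y j| = 1 := by
        by_contra! hne
        have : ‖y‖ < 1 := (pi_norm_lt_iff zero_lt_one).2 fun j =>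
          lt_of_le_of_ne (hy' j) (hne j)
        rw [mem_sphere_zero_iff_norm] at hy
        linarith
      refine ⟨e.symm j, (hD _).1 (e.symm j).2, ?_⟩
      have hval : ψ y (e.symm j) = c.lo (e.symm j) + (y j + 1) / 2 := by
        simp [ψ]
      rw [hval, hhi _ (e.symm j).2]
      rcases eq_or_eq_neg_of_abs_eq hj with h | h
      · right
        rw [h]
        norm_num
      · left
        rw [h]
        norm_num
  have ψφ : ∀ x ∈ c.body, ψ (φ x) = x := by
    intro x hx
    funext i
    by_cases hi : i ∈ D
    · simp [ψ, φ, hi]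
    · simp only [ψ, hi, dif_neg, not_false_eq_true]
      have h1 := hx i
      have h2 : c.lo i = c.hi i := by
        have := c.lo_le i
        have := (hD i).not.1 hi
        omega
      rw [← h2] at h1
      exact le_antisymm h1.1 h1.2
  obtain ⟨g, hg, hgS, hgf⟩ := h (f ∘ ψ) (hf.comp hψ.continuousOn ψbd) (hfS.comp ψbd)
  refine ⟨g ∘ φ, hg.comp hφ.continuousOn φball, hgS.comp φball, fun x hx => ?_⟩
  change g (φ x) = f x
  rw [hgf (φbd hx)]
  change f (ψ (φ x)) = f x
  rw [ψφ x hx.1]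

/-- The union of a set of cells. -/
def bodies (L : Set (Cell ι)) : Set (ι → ℝ) := ⋃ c ∈ L, c.body

omit [Fintype ι] in
lemma mem_bodies {L : Set (Cell ι)} {x : ι → ℝ} : x ∈ bodies L ↔ ∃ c ∈ L, x ∈ c.body := by
  simp [bodies]

omit [Fintype ι] in
lemma isClosed_bodies {L : Set (Cell ι)} (hL : L.Finite) : IsClosed (bodies L) :=
  hL.isClosed_biUnion fun c _ => c.isClosed_body

/-- Obstruction-free extension: `Φ` prescribes where each cell must go, `Ψ c` holds everything
prescribed on the proper faces of `c`, and a filling from `Ψ c` to `Φ c` extends the map over `c`.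
The induction is on the number of cells not yet covered. -/
theorem exists_extension_of_fill {L A : Set (Cell ι)} (hL : L.Finite)
    (hLd : ∀ c ∈ L, ∀ d ≤ c, d ∈ L) (hAL : A ⊆ L) (hAd : ∀ c ∈ A, ∀ d ≤ c, d ∈ A)
    (Φ Ψ : Cell ι → Set X) (hΨ : ∀ c ∈ L, c ∉ A → ∀ d < c, Φ d ⊆ Ψ c)
    (hfill : ∀ c ∈ L, c ∉ A → Fill c.dim (Ψ c) (Φ c)) {f : (ι → ℝ) → X}
    (hf : ContinuousOn f (bodies A)) (hfΦ : ∀ c ∈ A, MapsTo f c.body (Φ c)) :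
    ∃ g : (ι → ℝ) → X, ContinuousOn g (bodies L) ∧ EqOn g f (bodies A) ∧
      ∀ c ∈ L, MapsTo g c.body (Φ c) := by
  classical
  induction hn : (L \ A).ncard generalizing A f with
  | zero =>
    have h0 : L \ A = ∅ := (ncard_eq_zero (hL.sdiff)).1 hn
    have hAe : A = L := hAL.antisymm (sdiff_eq_empty.1 h0)
    subst hAe
    exact ⟨f, hf, fun _ _ => rfl, hfΦ⟩
  | succ n ih =>
    have hne : (L \ A).Nonempty := by
      rw [nonempty_iff_ne_empty]
      intro h0
      rw [h0] at hn
      simp at hn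
    obtain ⟨c, hc, hmin⟩ := exists_min_image (L \ A) dim hL.sdiff hne
    have hfaces : ∀ d < c, d ∈ A := by
      intro d hd
      by_contra hdA
      have := hmin d ⟨hLd c hc.1 d hd.le, hdA⟩
      have := dim_lt_of_lt hd
      omega
    have hbd : c.bd ⊆ bodies A := by
      intro x hx
      obtain ⟨d, hd, hxd⟩ := exists_lt_of_mem_bd hx
      exact mem_bodies.2 ⟨d, hfaces d hd, hxd⟩
    have hbdΨ : MapsTo f c.bd (Ψ c) := by
      intro x hx
      obtain ⟨d, hd, hxd⟩ := exists_lt_of_mem_bd hx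
      exact hΨ c hc.1 hc.2 d hd (hfΦ d (hfaces d hd) hxd)
    obtain ⟨g, hg, hgΦ, hgf⟩ := c.exists_extension (hfill c hc.1 hc.2) (hf.mono hbd) hbdΨ
    -- Since `A` is closed under faces and `c ∉ A`, the new cell meets the old ones only in its
    -- boundary, where `f` and `g` agree.
    have hinter : bodies A ∩ c.body ⊆ c.bd := by
      rintro x ⟨hx, hxc⟩
      by_contra hxb
      obtain ⟨d, hd, hxd⟩ := mem_bodies.1 hx
      exact hc.2 (hAd d hd c (le_of_mem_body hxc hxd hxb))
    let f' := (bodies A).piecewise f g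
    have hAL' : insert c A ⊆ L := insert_subset hc.1 hAL
    have hAfin : A.Finite := hL.subset hAL
    have hbodies : bodies (insert c A) = bodies A ∪ c.body := by
      simp [bodies, union_comm]
    have hf' : EqOn f' f (bodies A) := fun x hx => piecewise_eq_of_mem _ _ _ hx
    have hg' : EqOn f' g c.body := by
      intro x hx
      by_cases hxA : x ∈ bodies A
      · rw [hf' hxA]
        exact (hgf (hinter ⟨hxA, hx⟩)).symm
      · exact piecewise_eq_of_notMem _ _ _ hxA
    have hAd' : ∀ d ∈ insert c A, ∀ d' ≤ d, d' ∈ insert c A := by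
      rintro d (rfl | hd) d' hd'
      · rcases hd'.eq_or_lt with rfl | h
        · exact mem_insert _ _
        · exact mem_insert_of_mem _ (hfaces _ h)
      · exact mem_insert_of_mem _ (hAd d hd d' hd')
    have hcont : ContinuousOn f' (bodies (insert c A)) := by
      refine continuousOn_piecewise_of_isClosed (isClosed_bodies hAfin) c.isClosed_body
        hbodies.le (hf.mono inter_subset_right) (hg.mono inter_subset_right) ?_
      rintro x ⟨⟨-, hx⟩, hxc⟩
      exact (hgf (hinter ⟨hx, hxc⟩)).symm
    have hmaps : ∀ d ∈ insert c A, MapsTo f' d.body (Φ d) := by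
      rintro d (rfl | hd) x hx
      · rw [hg' hx]
        exact hgΦ hx
      · rw [hf' (mem_bodies.2 ⟨d, hd, hx⟩)]
        exact hfΦ d hd hx
    have hcard : (L \ insert c A).ncard = n := by
      have h1 : L \ A = insert c (L \ insert c A) := by
        ext d
        by_cases hd : d = c
        · subst hd
          simpa using hc
        · simp [hd]
      rw [h1, ncard_insert_of_notMem (by simp) hL.sdiff] at hn
      omega
    obtain ⟨k, hk1, hk2, hk3⟩ := ih hAL' hAd'
      (fun d hd hdA => hΨ d hd fun h => hdA (mem_insert_of_mem _ h))
      (fun d hd hdA => hfill d hd fun h => hdA (mem_insert_of_mem _ h)) hcont hmaps hcard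
    refine ⟨k, hk1, fun x hx => ?_, hk3⟩
    rw [hk2 (by rw [hbodies]; exact .inl hx), hf' hx]

/-- The product of a cell with an interval. -/
def prod (c : Cell ι) (a b : ℤ) (hab : a ≤ b) (hba : b ≤ a + 1) : Cell (Option ι) where
  lo o := o.elim a c.lo
  hi o := o.elim b c.hi
  lo_le o := by cases o <;> simp [hab, c.lo_le]
  hi_le o := by cases o <;> simp [hba, c.hi_le]

/-- The projection of a cell of a product. -/
def base (c : Cell (Option ι)) : Cell ι where
  lo i := c.lo (some i)
  hi i := c.hi (some i)
  lo_le _ := c.lo_le _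
  hi_le _ := c.hi_le _

lemma dim_option (c : Cell (Option ι)) :
    c.dim = c.base.dim + if c.lo none < c.hi none then 1 else 0 := by
  have h : c.base.dim = ∑ i, if c.lo (some i) < c.hi (some i) then 1 else 0 :=
    Finset.card_filter _ _
  rw [dim, Finset.card_filter, Fintype.sum_option, h, add_comm]

omit [Fintype ι] in
lemma mem_body_option {c : Cell (Option ι)} {x : Option ι → ℝ} :
    x ∈ c.body ↔ (c.lo none ≤ x none ∧ x none ≤ c.hi none) ∧ (fun i => x (some i)) ∈ c.base.body := by
  constructor
  · exact fun h => ⟨h none, fun i => h (some i)⟩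
  · rintro ⟨h1, h2⟩ (_ | i)
    · exact h1
    · exact h2 i

/-- Cellwise extension over `L × [0, 1]`, starting from `f` on the bottom. `Θ₀`, `Θ₁` and `Θ`
constrain the bottom, the top and the cylinders; `Ψ₁` and `Ψ` constrain the boundaries of top cells
and of cylinders. The final map `g` is constructed along with the homotopy. -/
theorem exists_htpyOn_of_fill {L : Set (Cell ι)} (hL : L.Finite)
    (hLd : ∀ c ∈ L, ∀ d ≤ c, d ∈ L) (Θ₀ Θ₁ Θ Ψ₁ Ψ : Cell ι → Set X) {S : Set X}
    (hΨ₁ : ∀ c ∈ L, ∀ d < c, Θ₁ d ⊆ Ψ₁ c) (hΨ : ∀ c ∈ L, ∀ d < c, Θ d ⊆ Ψ c)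
    (h₀ : ∀ c ∈ L, ∀ d ≤ c, Θ₀ d ⊆ Ψ c) (h₁ : ∀ c ∈ L, ∀ d ≤ c, Θ₁ d ⊆ Ψ c)
    (hfill₁ : ∀ c ∈ L, Fill c.dim (Ψ₁ c) (Θ₁ c)) (hfill : ∀ c ∈ L, Fill (c.dim + 1) (Ψ c) (Θ c))
    (hS : ∀ c ∈ L, Θ c ⊆ S) {f : (ι → ℝ) → X} (hf : ContinuousOn f (bodies L))
    (hfΘ : ∀ c ∈ L, MapsTo f c.body (Θ₀ c)) :
    ∃ g : (ι → ℝ) → X, ContinuousOn g (bodies L) ∧ (∀ c ∈ L, MapsTo g c.body (Θ₁ c)) ∧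
      HtpyOn (bodies L) S f g := by
  classical
  let L' : Set (Cell (Option ι)) := {c | c.base ∈ L ∧ 0 ≤ c.lo none ∧ c.hi none ≤ 1}
  let A : Set (Cell (Option ι)) := {c | c.base ∈ L ∧ c.lo none = 0 ∧ c.hi none = 0}
  have hbase : ∀ {c d : Cell (Option ι)}, d ≤ c → d.base ≤ c.base := fun h i => h (some i)
  have hL'fin : L'.Finite := by
    have : L' ⊆ (fun p : Cell ι × (ℤ × ℤ) =>
        if h : p.2.1 ≤ p.2.2 ∧ p.2.2 ≤ p.2.1 + 1 then p.1.prod p.2.1 p.2.2 h.1 h.2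
        else p.1.prod 0 0 le_rfl (by norm_num)) '' (L ×ˢ (Icc 0 1 ×ˢ Icc 0 1)) := by
      rintro c ⟨hc, h0, h1⟩
      refine ⟨(c.base, (c.lo none, c.hi none)), ⟨hc, ?_⟩, ?_⟩
      · have := c.lo_le none
        simp only [mem_prod, mem_Icc]
        omega
      · simp only [c.lo_le none, c.hi_le none, and_self, dif_pos]
        ext o <;> cases o <;> rfl
    exact ((hL.prod ((finite_Icc 0 1).prod (finite_Icc 0 1))).image _).subset this
  obtain ⟨G, hG, hGf, hGΦ⟩ := exists_extension_of_fill (X := X) (L := L') (A := A) hL'fin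
    (fun c hc d hd => ⟨hLd _ hc.1 _ (hbase hd), hc.2.1.trans (hd none).1,
      (hd none).2.trans hc.2.2⟩)
    (fun c hc => ⟨hc.1, hc.2.1.ge, by rw [hc.2.2]; norm_num⟩)
    (fun c hc d hd => by
      have h1 := hd none
      have h2 := d.lo_le none
      have h3 := hc.2
      exact ⟨hLd _ hc.1 _ (hbase hd), by omega, by omega⟩)
    -- The extra coordinate `none` is time: the intervals `[0, 0]`, `[1, 1]` and `[0, 1]` mark
    -- bottom cells, top cells and cylinders.
    (fun c => if c.hi none = 0 then Θ₀ c.base else if c.lo none = 1 then Θ₁ c.base else Θ c.base)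
    (fun c => if c.lo none = 1 then Ψ₁ c.base else Ψ c.base)
    (by
      intro c hc hcA d hd
      have h1 := hd.le none
      have h2 := c.lo_le none
      have h3 := c.hi_le none
      have h4 := d.lo_le none
      have h5 := d.hi_le none
      have h6 := hc.2
      have h7 : ¬ (c.lo none = 0 ∧ c.hi none = 0) := fun h => hcA ⟨hc.1, h⟩
      have hlt : d.lo none = c.lo none → d.hi none = c.hi none → d.base < c.base := by
        intro e1 e2
        refine lt_of_le_of_ne (hbase hd.le) fun e => hd.ne ?_
        have e3 : d.base.lo = c.base.lo := by rw [e]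
        have e4 : d.base.hi = c.base.hi := by rw [e]
        ext o
        · cases o with
          | none => exact e1
          | some i => exact congrFun e3 i
        · cases o with
          | none => exact e2
          | some i => exact congrFun e4 i
      by_cases hc1 : c.lo none = 1
      · simp only [hc1, if_true]
        rw [if_neg (by omega), if_pos (by omega)]
        exact hΨ₁ _ hc.1 _ (hlt (by omega) (by omega))
      · simp only [hc1, if_false]
        split_ifs with g1 g2
        · exact h₀ _ hc.1 _ (hbase hd.le)
        · exact h₁ _ hc.1 _ (hbase hd.le)
        · exact hΨ _ hc.1 _ (hlt (by omega) (by omega)))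
    (by
      intro c hc hcA
      have h2 := c.lo_le none
      have h3 := c.hi_le none
      have h6 := hc.2
      have h7 : ¬ (c.lo none = 0 ∧ c.hi none = 0) := fun h => hcA ⟨hc.1, h⟩
      by_cases hc1 : c.lo none = 1
      · simp only [hc1, if_true]
        rw [if_neg (by omega), dim_option, if_neg (by omega)]
        exact hfill₁ _ hc.1
      · simp only [hc1, if_false]
        rw [if_neg (by omega), dim_option, if_pos (by omega)]
        exact hfill _ hc.1)
    (f := fun x => f fun i => x (some i))
    (by
      refine hf.comp (by fun_prop) ?_
      intro x hx
      obtain ⟨c, hc, hxc⟩ := mem_bodies.1 hx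
      exact mem_bodies.2 ⟨c.base, hc.1, (mem_body_option.1 hxc).2⟩)
    (by
      intro c hc x hx
      simp only [hc.2.2, if_true]
      exact hfΘ _ hc.1 (mem_body_option.1 hx).2)
  let j : ℝ × (ι → ℝ) → Option ι → ℝ := fun p o => o.elim p.1 p.2
  have hj : Continuous j := by
    refine continuous_pi fun o => ?_
    cases o with
    | none => exact continuous_fst
    | some i => exact (continuous_apply i).comp continuous_snd
  have hjL : ∀ (a b : ℤ) (hab : a ≤ b) (hba : b ≤ a + 1) (c : Cell ι) (s : ℝ) (x : ι → ℝ),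
      x ∈ c.body → a ≤ s → s ≤ b → j (s, x) ∈ (c.prod a b hab hba).body := by
    intro a b hab hba c s x hx h1 h2
    exact mem_body_option.2 ⟨⟨h1, h2⟩, hx⟩
  have hprod : ∀ c ∈ L, c.prod 0 1 (by norm_num) (by norm_num) ∈ L' := fun c hc =>
    ⟨hc, le_rfl, le_rfl⟩
  have hjm : MapsTo j (Icc 0 1 ×ˢ bodies L) (bodies L') := by
    rintro ⟨s, x⟩ ⟨hs, hx⟩
    obtain ⟨c, hc, hxc⟩ := mem_bodies.1 hx
    exact mem_bodies.2 ⟨_, hprod c hc, hjL _ _ _ _ c s x hxc (by simpa using hs.1)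
      (by simpa using hs.2)⟩
  refine ⟨fun x => G (j (1, x)), ?_, ?_, fun p => G (j p), ?_, ?_, ?_, ?_⟩
  · exact hG.comp (hj.comp (by fun_prop)).continuousOn fun x hx =>
      hjm ⟨right_mem_Icc.2 zero_le_one, hx⟩
  · intro c hc x hx
    have := hGΦ (c.prod 1 1 le_rfl (by norm_num)) ⟨hc, by simp [prod], le_rfl⟩
      (hjL 1 1 _ _ c 1 x hx (by simp) (by simp))
    simpa [prod, base] using this
  · exact hG.comp hj.continuousOn hjm
  · intro x hx
    obtain ⟨c, hc, hxc⟩ := mem_bodies.1 hx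
    exact hGf (mem_bodies.2 ⟨c.prod 0 0 le_rfl (by norm_num), ⟨hc, rfl, rfl⟩,
      hjL 0 0 _ _ c 0 x hxc (by simp) (by simp)⟩)
  · exact fun x hx => rfl
  · rintro ⟨s, x⟩ ⟨hs, hx⟩
    obtain ⟨c, hc, hxc⟩ := mem_bodies.1 hx
    have := hGΦ _ (hprod c hc) (hjL 0 1 _ _ c s x hxc (by simpa using hs.1) (by simpa using hs.2))
    exact hS c hc (by simpa [prod, base] using this)

end Cell
end Brin

namespace Brin
open Set Topology Metric

/-! ### Order complexes of finite posets in barycentric coordinates -/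

section Geom

variable {P : Type*} [PartialOrder P] [Fintype P]

/-- The geometric realisation of the order complex of a subset `S` of a finite poset, as a subset
of the space of barycentric coordinates. -/
def Geom (S : Set P) : Set (P → ℝ) :=
  {x | (∀ V, 0 ≤ x V) ∧ ∑ V, x V = 1 ∧ IsChain (· ≤ ·) {V | x V ≠ 0} ∧ ∀ V, x V ≠ 0 → V ∈ S}

lemma Geom.mono {S S' : Set P} (h : S ⊆ S') : Geom S ⊆ Geom S' :=
  fun _ hx => ⟨hx.1, hx.2.1, hx.2.2.1, fun V hV => h (hx.2.2.2 V hV)⟩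

lemma Geom.exists_ne_zero {S : Set P} {x : P → ℝ} (hx : x ∈ Geom S) : ∃ V, x V ≠ 0 := by
  by_contra! h
  have := hx.2.1
  simp [h] at this

lemma single_mem_Geom [DecidableEq P] {S : Set P} {p : P} (hp : p ∈ S) :
    (Pi.single p 1 : P → ℝ) ∈ Geom S := by
  have key : ∀ V, (Pi.single p 1 : P → ℝ) V ≠ 0 → V = p := by
    intro V hV
    by_contra h
    exact hV (by simp [h])
  refine ⟨fun V => ?_, by simp, ?_, fun V hV => key V hV ▸ hp⟩
  · by_cases h : V = p
    · subst h
      simp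
    · simp [h]
  · intro a ha b hb hab
    exact absurd ((key a ha).trans (key b hb).symm) hab

/-- The straight-line homotopy stays in the complex because at each point both supports lie in one
simplex. -/
lemma htpyOn_of_isChain {A : Type*} [TopologicalSpace A] {K : Set A} {S : Set P}
    {f g : A → P → ℝ} (hf : ContinuousOn f K) (hg : ContinuousOn g K) (hfS : MapsTo f K (Geom S))
    (hgS : MapsTo g K (Geom S))
    (h : ∀ x ∈ K, IsChain (· ≤ ·) {V | f x V ≠ 0 ∨ g x V ≠ 0}) : HtpyOn K (Geom S) f g := by
  refine ⟨fun p => (1 - p.1) • f p.2 + p.1 • g p.2, ?_, by simp, by simp, ?_⟩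
  · have h1 : ContinuousOn (fun p : ℝ × A => f p.2) (Icc 0 1 ×ˢ K) :=
      hf.comp continuousOn_snd fun p hp => hp.2
    have h2 : ContinuousOn (fun p : ℝ × A => g p.2) (Icc 0 1 ×ˢ K) :=
      hg.comp continuousOn_snd fun p hp => hp.2
    exact ((by fun_prop : ContinuousOn (fun p : ℝ × A => 1 - p.1) _).smul h1).add
      (continuousOn_fst.smul h2)
  · rintro ⟨s, x⟩ ⟨⟨hs0, hs1⟩, hx⟩
    have hf' := hfS hx
    have hg' := hgS hx
    have hs1' : s ≤ 1 := hs1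
    have hs0' : 0 ≤ s := hs0
    have supp : ∀ V, ((1 - s) • f x + s • g x) V ≠ 0 → f x V ≠ 0 ∨ g x V ≠ 0 := by
      intro V hV
      by_contra! hc
      exact hV (by simp [hc.1, hc.2])
    refine ⟨fun V => ?_, ?_, (h x hx).mono supp, fun V hV => ?_⟩
    · have := hf'.1 V
      have := hg'.1 V
      simp only [Pi.add_apply, Pi.smul_apply, smul_eq_mul]
      exact add_nonneg (mul_nonneg (by linarith) (by assumption)) (by positivity)
    · simp only [Pi.add_apply, Pi.smul_apply, smul_eq_mul, Finset.sum_add_distrib,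
        ← Finset.mul_sum, hf'.2.1, hg'.2.1]
      ring
    · rcases supp V hV with h' | h'
      · exact hf'.2.2.2 V h'
      · exact hg'.2.2.2 V h'

open Classical in
/-- The affine extension of a self-map of the vertices. -/
noncomputable def pushforward (h : P → P) (x : P → ℝ) : P → ℝ :=
  fun W => ∑ V, if h V = W then x V else 0

omit [PartialOrder P] in
lemma continuous_pushforward (h : P → P) : Continuous (pushforward h) := by
  refine continuous_pi fun W => continuous_finsetSum _ fun V _ => ?_
  split_ifs <;> fun_prop

omit [PartialOrder P] in
lemma sum_pushforward (h : P → P) (x : P → ℝ) : ∑ W, pushforward h x W = ∑ V, x V := by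
  classical
  simp only [pushforward]
  rw [Finset.sum_comm]
  simp

omit [PartialOrder P] in
lemma pushforward_nonneg (h : P → P) {x : P → ℝ} (hx : ∀ V, 0 ≤ x V) (W : P) :
    0 ≤ pushforward h x W :=
  Finset.sum_nonneg fun V _ => by
    split_ifs
    · exact hx V
    · exact le_rfl

omit [PartialOrder P] in
lemma exists_of_pushforward_ne_zero {h : P → P} {x : P → ℝ} {W : P}
    (hW : pushforward h x W ≠ 0) : ∃ V, h V = W ∧ x V ≠ 0 := by
  classical
  obtain ⟨V, -, hV⟩ := Finset.exists_ne_zero_of_sum_ne_zero hW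
  by_cases e : h V = W
  · exact ⟨V, e, by simpa [e] using hV⟩
  · simp [e] at hV

open Classical in
/-- The mass moved up to time `s` if the mass at the lower elements of a chain is moved first. -/
noncomputable def movedMass (s : ℝ) (x : P → ℝ) (V : P) : ℝ :=
  min (x V) (max 0 (s - ∑ U, if U < V then x U else 0))

/-- Comparable monotone maps are homotopic. A straight line does not suffice, since `h V'` need not
be comparable with `V` for `V < V'`. Moving the mass from the bottom of the chain upwards keeps
every intermediate support a chain. -/
lemma htpyOn_pushforward {S S' : Set P} {h : P → P} (hS : S ⊆ S') (hm : MonotoneOn h S)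
    (hle : ∀ V ∈ S, h V ≤ V) (hS' : MapsTo h S S') :
    HtpyOn (Geom S) (Geom S') id (pushforward h) := by
  classical
  have hmn : ∀ (s : ℝ) {x : P → ℝ}, (∀ V, 0 ≤ x V) → ∀ V, 0 ≤ movedMass s x V :=
    fun s x hx V => le_min (hx V) (le_max_left _ _)
  have hml : ∀ (s : ℝ) (x : P → ℝ) V, movedMass s x V ≤ x V := fun s x V => min_le_left _ _
  refine ⟨fun p => fun W => (p.2 W - movedMass p.1 p.2 W) + pushforward h (movedMass p.1 p.2) W,
    ?_, ?_, ?_, ?_⟩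
  · refine Continuous.continuousOn ?_
    have hc : Continuous fun p : ℝ × (P → ℝ) => movedMass p.1 p.2 := by
      refine continuous_pi fun V => ?_
      refine Continuous.min (by fun_prop) (Continuous.max continuous_const ?_)
      refine continuous_fst.sub (continuous_finsetSum _ fun U _ => ?_)
      split_ifs <;> fun_prop
    have hc' : Continuous fun p : ℝ × (P → ℝ) => pushforward h (movedMass p.1 p.2) :=
      (continuous_pushforward h).comp hc
    exact continuous_pi fun W => (((continuous_apply W).comp continuous_snd).sub
      ((continuous_apply W).comp hc)).add ((continuous_apply W).comp hc')
  · intro x hx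
    have h0 : movedMass 0 x = fun _ => 0 := by
      funext V
      have : 0 ≤ ∑ U, if U < V then x U else 0 := Finset.sum_nonneg fun U _ => by
        split_ifs
        · exact hx.1 U
        · exact le_rfl
      rw [movedMass, max_eq_left (by linarith), min_eq_right (hx.1 V)]
    funext W
    simp [h0, pushforward]
  · intro x hx
    have h1 : movedMass 1 x = x := by
      funext V
      refine min_eq_left (le_max_of_le_right ?_)
      have : (∑ U, if U < V then x U else 0) + x V ≤ ∑ U, x U := by
        have e : x V = ∑ U, if U = V then x U else 0 := by simp
        rw [e, ← Finset.sum_add_distrib]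
        refine Finset.sum_le_sum fun U _ => ?_
        have := hx.1 U
        by_cases h1 : U = V
        · subst h1
          simp
        · by_cases h2 : U < V <;> simp [h1, h2, this]
      rw [hx.2.1] at this
      linarith
    funext W
    simp [h1]
  · rintro ⟨s, x⟩ ⟨-, hx⟩
    set m := movedMass s x with hmdef
    have hx0 := hx.1
    have hm0 : ∀ V, 0 ≤ m V := hmn s hx0
    have hmx : ∀ V, m V ≤ x V := hml s x
    have supp : ∀ W, (x W - m W) + pushforward h m W ≠ 0 →
        m W < x W ∨ ∃ V, h V = W ∧ 0 < m V := by
      intro W hW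
      by_contra! hc
      have e1 : x W = m W := le_antisymm hc.1 (hmx W)
      have e2 : pushforward h m W = 0 := by
        by_contra hne
        obtain ⟨V, hV, hV'⟩ := exists_of_pushforward_ne_zero hne
        exact hV' (le_antisymm (hc.2 V hV) (hm0 V))
      exact hW (by rw [e1, e2]; ring)
    have xpos : ∀ V, 0 < m V → x V ≠ 0 := fun V hV => (hV.trans_le (hmx V)).ne'
    have xpos' : ∀ V, m V < x V → x V ≠ 0 := fun V hV => ((hm0 V).trans_lt hV).ne'
    have comp : ∀ U V, x U ≠ 0 → x V ≠ 0 → U ≤ V ∨ V ≤ U := fun U V hU hV =>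
      hx.2.2.1.total hU hV
    -- If `V` has begun to move while `U` still retains mass, then `V ≤ U`, because mass below `V`
    -- is exhausted before `V` starts. Hence `h V ≤ V ≤ U`.
    have mixed : ∀ U V, m U < x U → 0 < m V → h V ≤ U := by
      intro U V hU hV
      have hle' : V ≤ U := by
        rcases comp U V (xpos' U hU) (xpos V hV) with hc | hc
        · rcases hc.eq_or_lt with rfl | hlt
          · exact le_rfl
          · exfalso
            have h1 : 0 < s - ∑ U, if U < V then x U else 0 := by
              by_contra! hc
              have : m V ≤ max 0 _ := min_le_right _ _
              rw [max_eq_left hc] at this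
              linarith
            have h2 : (∑ U', if U' < U then x U' else 0) + x U ≤
                ∑ U', if U' < V then x U' else 0 := by
              have e : x U = ∑ U', if U' = U then x U' else 0 := by simp
              rw [e, ← Finset.sum_add_distrib]
              refine Finset.sum_le_sum fun U' _ => ?_
              have := hx0 U'
              by_cases h1 : U' = U
              · subst h1
                simp [hlt]
              · by_cases h2 : U' < U
                · simp [h1, h2, h2.trans hlt]
                · simp only [h2, if_false, h1, add_zero]
                  split_ifs <;> linarith
            have h3 : m U = x U := min_eq_left (le_max_of_le_right (by linarith))
            linarith
        · exact hc
      exact (hle V (hx.2.2.2 V (xpos V hV))).trans hle'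
    refine ⟨fun W => ?_, ?_, ?_, ?_⟩
    · exact add_nonneg (sub_nonneg.2 (hmx W)) (pushforward_nonneg h hm0 W)
    · change ∑ W, ((x W - m W) + pushforward h m W) = 1
      rw [Finset.sum_add_distrib, sum_pushforward, Finset.sum_sub_distrib, hx.2.1]
      ring
    · intro W hW W' hW' _
      rcases supp W hW with hW | ⟨V, rfl, hV⟩ <;> rcases supp W' hW' with hW' | ⟨V', rfl, hV'⟩
      · exact comp _ _ (xpos' _ hW) (xpos' _ hW')
      · exact .inr (mixed _ _ hW hV')
      · exact .inl (mixed _ _ hW' hV)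
      · have hVS := hx.2.2.2 V (xpos _ hV)
        have hVS' := hx.2.2.2 V' (xpos _ hV')
        rcases comp _ _ (xpos _ hV) (xpos _ hV') with hc | hc
        · exact .inl (hm hVS hVS' hc)
        · exact .inr (hm hVS' hVS hc)
    · intro W hW
      rcases supp W hW with hW | ⟨V, rfl, hV⟩
      · exact hS (hx.2.2.2 W (xpos' _ hW))
      · exact hS' (hx.2.2.2 V (xpos _ hV))

/-- Quillen's conical contraction `V ≥ h V ≤ m`: push along `h`, then join linearly to the vertex
`m`. -/
lemma nullIn_of_conical {S S' : Set P} {h : P → P} (hS : S ⊆ S') (hm : MonotoneOn h S)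
    (hle : ∀ V ∈ S, h V ≤ V) (hS' : MapsTo h S S') {m : P} (hmS : m ∈ S')
    (hhm : ∀ V ∈ S, h V ≤ m) : NullIn (Geom S) (Geom S') := by
  classical
  have h1 := htpyOn_pushforward hS hm hle hS'
  have hmaps : MapsTo (pushforward h) (Geom S) (Geom S') := by
    obtain ⟨H, -, -, h3, h4⟩ := h1
    intro x hx
    rw [← h3 x hx]
    exact h4 ⟨right_mem_Icc.2 zero_le_one, hx⟩
  refine ⟨Pi.single m 1, single_mem_Geom hmS, h1.trans ?_⟩
  refine htpyOn_of_isChain (continuous_pushforward h).continuousOn continuousOn_const hmaps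
    (fun _ _ => single_mem_Geom hmS) fun x hx => ?_
  have hch := (hmaps hx).2.2.1
  have key : ∀ W, pushforward h x W ≠ 0 → W ≤ m := by
    intro W hW
    obtain ⟨V, rfl, hV⟩ := exists_of_pushforward_ne_zero hW
    exact hhm V (hx.2.2.2 V hV)
  have key' : ∀ W, (Pi.single m 1 : P → ℝ) W ≠ 0 → W = m := by
    intro W hW
    by_contra hc
    exact hW (by simp [hc])
  rintro a (ha | ha) b (hb | hb) hab
  · exact hch ha hb hab
  · exact .inl ((key a ha).trans (key' b hb).ge)
  · exact .inr ((key b hb).trans (key' a ha).ge)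
  · exact absurd ((key' a ha).trans (key' b hb).symm) hab

lemma nullIn_of_isLeast {S S' : Set P} {m : P} (hS : S ⊆ S') (hm : m ∈ S')
    (h : ∀ V ∈ S, m ≤ V) : NullIn (Geom S) (Geom S') :=
  nullIn_of_conical (h := fun _ => m) hS (fun _ _ _ _ _ => le_rfl) h (fun _ _ => hm) hm
    fun _ _ => le_rfl

end Geom

end Brin

namespace Brin
open Set Topology Metric

/-! ### Maps carried by chains on the cells of a fine grid -/

section Approx

variable {ι P : Type*} [Fintype ι] [PartialOrder P] [Fintype P]

/-- Coordinates not exceeding `ε` are dropped, and the others are rescaled. -/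
noncomputable def truncate (ε : ℝ) (x : P → ℝ) : P → ℝ :=
  fun V => max 0 (x V - ε) / ∑ U, max 0 (x U - ε)

omit [Fintype ι] in
lemma exists_truncate (P : Type*) [PartialOrder P] [Fintype P] : ∃ ε : ℝ, 0 < ε ∧
    ContinuousOn (truncate ε) (Geom (univ : Set P)) ∧
    (∀ S : Set P, MapsTo (truncate ε) (Geom S) (Geom S)) ∧
    ∀ x V, truncate ε x V ≠ 0 → ε < (x : P → ℝ) V := by
  classical
  -- Barycentric coordinates sum to 1, so at least one of them exceeds `1 / (|P| + 1)` and the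
  -- normalising denominator is positive.
  let ε : ℝ := (Fintype.card P + 1 : ℝ)⁻¹
  have hε : 0 < ε := by positivity
  have hpos : ∀ x ∈ Geom (univ : Set P), 0 < ∑ U, max 0 (x U - ε) := by
    intro x hx
    by_contra! hc
    have h1 : ∀ U, x U ≤ ε := by
      intro U
      have h2 : max 0 (x U - ε) ≤ 0 := (Finset.single_le_sum (f := fun U => max 0 (x U - ε))
        (fun U _ => le_max_left _ _) (Finset.mem_univ U)).trans hc
      linarith [(le_max_right 0 (x U - ε)).trans h2]
    have h3 : (1 : ℝ) ≤ Fintype.card P * ε := by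
      rw [← hx.2.1]
      refine (Finset.sum_le_sum fun U _ => h1 U).trans ?_
      simp
    have h4 : (Fintype.card P + 1 : ℝ) * ε = 1 := mul_inv_cancel₀ (by positivity)
    linarith
  have hsupp : ∀ x V, truncate ε x V ≠ 0 → ε < (x : P → ℝ) V := by
    intro x V hV
    by_contra! hc
    exact hV (by simp [truncate, max_eq_left (sub_nonpos.2 hc)])
  refine ⟨ε, hε, ?_, ?_, hsupp⟩
  · refine continuousOn_pi.2 fun V => ContinuousOn.div ?_ ?_ fun x hx => (hpos x hx).ne'
    · exact Continuous.continuousOn (Continuous.max continuous_const (by fun_prop))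
    · refine Continuous.continuousOn (continuous_finsetSum _ fun U _ => ?_)
      exact Continuous.max continuous_const (by fun_prop)
  · intro S x hx
    have hp := hpos x (Geom.mono (subset_univ _) hx)
    have hne : ∀ V, truncate ε x V ≠ 0 → x V ≠ 0 := fun V hV => (hε.trans (hsupp x V hV)).ne'
    refine ⟨fun V => div_nonneg (le_max_left _ _) hp.le, ?_, hx.2.2.1.mono hne,
      fun V hV => hx.2.2.2 V (hne V hV)⟩
    simp only [truncate, ← Finset.sum_div]
    exact div_self hp.ne'

/-- The cells of the lattice scaled by `M⁻¹` that are contained in `K`. -/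
def grid (M : ℕ) (K : Set (ι → ℝ)) : Set (Cell ι) :=
  {c | ∀ x ∈ c.body, (M : ℝ)⁻¹ • x ∈ K}

omit [Fintype ι] in
lemma grid_of_le {M : ℕ} {K : Set (ι → ℝ)} : ∀ c ∈ grid M K, ∀ d ≤ c, d ∈ grid M K :=
  fun _ hc _ hd x hx => hc x (Cell.body_mono hd hx)

omit [Fintype ι] in
lemma grid_mono {M : ℕ} {K K' : Set (ι → ℝ)} (h : K ⊆ K') : grid M K ⊆ grid M K' :=
  fun _ hc x hx => h (hc x hx)

omit [Fintype ι] in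
lemma Cell.lo_mem_body (c : Cell ι) : (fun i => (c.lo i : ℝ)) ∈ c.body :=
  fun i => ⟨le_rfl, Int.cast_le.2 (c.lo_le i)⟩

omit [Fintype ι] in
lemma Cell.hi_mem_body (c : Cell ι) : (fun i => (c.hi i : ℝ)) ∈ c.body :=
  fun i => ⟨Int.cast_le.2 (c.lo_le i), le_rfl⟩

lemma norm_le_of_inv_smul {M : ℕ} (hM : 0 < M) {x : ι → ℝ}
    (hx : (M : ℝ)⁻¹ • x ∈ closedBall (0 : ι → ℝ) 1) : ‖x‖ ≤ M := by
  have hM' : (0 : ℝ) < M := by exact_mod_cast hM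
  rw [mem_closedBall_zero_iff, norm_smul, norm_inv, RCLike.norm_natCast,
    inv_mul_le_one₀ hM'] at hx
  exact hx

lemma finite_grid {M : ℕ} (hM : 0 < M) {K : Set (ι → ℝ)} (hK : K ⊆ closedBall 0 1) :
    (grid M K).Finite := by
  have hinj : InjOn (fun c : Cell ι => (c.lo, c.hi)) (grid M K) := by
    intro c _ d _ h
    simp only [Prod.mk.injEq] at h
    exact Cell.ext h.1 h.2
  have hfin : (Set.univ.pi fun _ : ι => Icc (-(M : ℤ)) M).Finite :=
    Set.Finite.pi fun _ => finite_Icc _ _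
  refine Set.Finite.of_finite_image ((hfin.prod hfin).subset ?_) hinj
  rintro _ ⟨c, hc, rfl⟩
  have key : ∀ z : ι → ℤ, (fun i => (z i : ℝ)) ∈ c.body → ∀ i, z i ∈ Icc (-(M : ℤ)) M := by
    intro z hz i
    have h1 := norm_le_of_inv_smul hM (hK (hc _ hz))
    have h2 := (norm_le_pi_norm (fun i => (z i : ℝ)) i).trans h1
    rw [Real.norm_eq_abs, abs_le] at h2
    exact ⟨by exact_mod_cast h2.1, by exact_mod_cast h2.2⟩
  exact ⟨fun i _ => key _ c.lo_mem_body i, fun i _ => key _ c.hi_mem_body i⟩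

/-- The smallest cell containing a point. -/
noncomputable def Cell.around (x : ι → ℝ) : Cell ι where
  lo i := ⌊x i⌋
  hi i := ⌈x i⌉
  lo_le _ := Int.floor_le_ceil _
  hi_le _ := Int.ceil_le_floor_add_one _

omit [Fintype ι] in
lemma Cell.mem_around (x : ι → ℝ) : x ∈ (Cell.around x).body :=
  fun _ => ⟨Int.floor_le _, Int.le_ceil _⟩

lemma around_mem_grid_closedBall {M : ℕ} (hM : 0 < M) {x : ι → ℝ} (hx : ‖x‖ ≤ M) :
    Cell.around x ∈ grid M (closedBall 0 1) := by
  intro y hy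
  have hM' : (0 : ℝ) < M := by exact_mod_cast hM
  rw [mem_closedBall_zero_iff, norm_smul, norm_inv, RCLike.norm_natCast, inv_mul_le_one₀ hM']
  refine (pi_norm_le_iff_of_nonneg hM'.le).2 fun i => ?_
  have h1 := (norm_le_pi_norm x i).trans hx
  rw [Real.norm_eq_abs, abs_le] at h1 ⊢
  have h2 : -(M : ℤ) ≤ ⌊x i⌋ := Int.le_floor.2 (by push_cast; exact h1.1)
  have h3 : ⌈x i⌉ ≤ (M : ℤ) := Int.ceil_le.2 (by push_cast; exact h1.2)
  have h2' : -(M : ℝ) ≤ ⌊x i⌋ := by exact_mod_cast h2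
  have h3' : (⌈x i⌉ : ℝ) ≤ M := by exact_mod_cast h3
  exact ⟨h2'.trans (hy i).1, (hy i).2.trans h3'⟩

/-- A coordinate of absolute value `M` is an integer, so floor and ceiling coincide and it is
constant on the surrounding cell, which therefore stays in the sphere. -/
lemma around_mem_grid_sphere {M : ℕ} (hM : 0 < M) {x : ι → ℝ} (hx : ‖x‖ = M) :
    Cell.around x ∈ grid M (sphere 0 1) := by
  intro y hy
  have hM' : (0 : ℝ) < M := by exact_mod_cast hM
  have h1 := around_mem_grid_closedBall hM hx.le y hy
  have h2 := norm_le_of_inv_smul hM h1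
  obtain ⟨i, hi⟩ : ∃ i, ‖x i‖ = M := by
    by_contra! hne
    have : ‖x‖ < M := (pi_norm_lt_iff hM').2 fun i =>
      lt_of_le_of_ne ((norm_le_pi_norm x i).trans hx.le) (hne i)
    linarith
  have hyi : y i = x i := by
    obtain ⟨z, hz⟩ : ∃ z : ℤ, x i = z := by
      rw [Real.norm_eq_abs] at hi
      rcases eq_or_eq_neg_of_abs_eq hi with h | h
      · exact ⟨M, by simpa using h⟩
      · exact ⟨-M, by simpa using h⟩
    have := hy i
    simp only [Cell.around, hz, Int.floor_intCast, Int.ceil_intCast] at this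
    rw [hz]
    exact le_antisymm this.2 this.1
  have h3 : (M : ℝ) ≤ ‖y‖ := by
    rw [← hi, ← hyi]
    exact norm_le_pi_norm y i
  rw [mem_sphere_zero_iff_norm, norm_smul, norm_inv, RCLike.norm_natCast, le_antisymm h2 h3]
  exact inv_mul_cancel₀ hM'.ne'

lemma smul_mem_bodies_closedBall {M : ℕ} (hM : 0 < M) {x : ι → ℝ}
    (hx : x ∈ closedBall (0 : ι → ℝ) 1) :
    (M : ℝ) • x ∈ Cell.bodies (grid M (closedBall (0 : ι → ℝ) 1)) := by
  refine Cell.mem_bodies.2 ⟨_, around_mem_grid_closedBall hM ?_, Cell.mem_around _⟩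
  rw [norm_smul, RCLike.norm_natCast]
  exact mul_le_of_le_one_right (by positivity) (mem_closedBall_zero_iff.1 hx)

lemma smul_mem_bodies_sphere {M : ℕ} (hM : 0 < M) {x : ι → ℝ} (hx : x ∈ sphere (0 : ι → ℝ) 1) :
    (M : ℝ) • x ∈ Cell.bodies (grid M (sphere (0 : ι → ℝ) 1)) := by
  refine Cell.mem_bodies.2 ⟨_, around_mem_grid_sphere hM ?_, Cell.mem_around _⟩
  rw [norm_smul, RCLike.norm_natCast, mem_sphere_zero_iff_norm.1 hx, mul_one]

/-- On a fine grid, the vertices used by the truncated map on one cell form a chain with minimum `W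
c`, so the map goes into the cone above `W c`; passing to a face can only raise this minimum. The
homotopy and carrier clauses hold for every `S'` at once, so that a part of `K` mapped into a
smaller subposet stays there. -/
theorem exists_chain_approx [Nonempty P] {K : Set (ι → ℝ)} (hK : IsCompact K) {S : Set P}
    {f : (ι → ℝ) → P → ℝ} (hf : ContinuousOn f K) (hfS : MapsTo f K (Geom S)) :
    ∃ M : ℕ, 0 < M ∧ ∃ f' : (ι → ℝ) → P → ℝ, ∃ W : Cell ι → P,
      ContinuousOn f' (Cell.bodies (grid M K)) ∧
      (∀ T ⊆ K, (∀ x ∈ T, (M : ℝ) • x ∈ Cell.bodies (grid M K)) → ∀ S' : Set P,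
        MapsTo f T (Geom S') → HtpyOn T (Geom S') f fun x => f' ((M : ℝ) • x)) ∧
      (∀ c ∈ grid M K, W c ∈ S) ∧ (∀ c ∈ grid M K, ∀ d ≤ c, W c ≤ W d) ∧
      (∀ c ∈ grid M K, ∀ x ∈ c.body, ∀ S' : Set P, f ((M : ℝ)⁻¹ • x) ∈ Geom S' →
        f' x ∈ Geom (S' ∩ {V | W c ≤ V})) := by
  classical
  obtain ⟨ε, hε, hρc, hρS, hρ⟩ := exists_truncate P
  obtain ⟨δ, hδ, hunif⟩ := Metric.uniformContinuousOn_iff.1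
    (hK.uniformContinuousOn_of_continuous hf) ε hε
  obtain ⟨n, hn⟩ := exists_nat_one_div_lt hδ
  let M := n + 1
  have hM : 0 < M := Nat.succ_pos n
  have hM' : (0 : ℝ) < M := by exact_mod_cast hM
  have hMδ : (M : ℝ)⁻¹ < δ := by
    have : (M : ℝ)⁻¹ = 1 / (n + 1 : ℝ) := by simp [M]
    rwa [this]
  let f' : (ι → ℝ) → P → ℝ := fun x => truncate ε (f ((M : ℝ)⁻¹ • x))
  have hbK : MapsTo (fun x : ι → ℝ => (M : ℝ)⁻¹ • x) (Cell.bodies (grid M K)) K := by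
    intro x hx
    obtain ⟨c, hc, hxc⟩ := Cell.mem_bodies.1 hx
    exact hc x hxc
  -- A vertex that survives truncation has weight above `ε`, and `f` varies by less than `ε` over a
  -- cell. Hence the vertex has positive weight at every point of the cell.
  have hsame : ∀ c ∈ grid M K, ∀ x ∈ c.body, ∀ y ∈ c.body, ∀ V, f' x V ≠ 0 →
      f ((M : ℝ)⁻¹ • y) V ≠ 0 := by
    intro c hc x hx y hy V hV
    have h1 := hρ _ _ hV
    have h2 : dist ((M : ℝ)⁻¹ • x) ((M : ℝ)⁻¹ • y) < δ := by
      rw [dist_eq_norm, ← smul_sub, norm_smul, norm_inv, RCLike.norm_natCast]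
      refine lt_of_le_of_lt ?_ hMδ
      refine mul_le_of_le_one_right (by positivity) ?_
      refine (pi_norm_le_iff_of_nonneg zero_le_one).2 fun i => ?_
      have h3 := hx i
      have h4 := hy i
      have h5 : (c.hi i : ℝ) ≤ c.lo i + 1 := by exact_mod_cast c.hi_le i
      rw [Pi.sub_apply, Real.norm_eq_abs, abs_le]
      constructor <;> linarith
    have h3 := (dist_le_pi_dist _ _ V).trans_lt (hunif _ (hc x hx) _ (hc y hy) h2)
    rw [Real.dist_eq] at h3
    have h4 := (abs_lt.1 h3).2
    intro h0
    linarith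
  have hf'S : ∀ x, ∀ S' : Set P, f ((M : ℝ)⁻¹ • x) ∈ Geom S' → f' x ∈ Geom S' :=
    fun x S' h => hρS S' h
  have hW : ∀ c ∈ grid M K, ∃ W ∈ S, (∃ x ∈ c.body, f' x W ≠ 0) ∧
      ∀ x ∈ c.body, ∀ V, f' x V ≠ 0 → W ≤ V := by
    intro c hc
    let C : Set P := {V | ∃ x ∈ c.body, f' x V ≠ 0}
    have hCS : ∀ V ∈ C, f ((M : ℝ)⁻¹ • fun i => (c.lo i : ℝ)) V ≠ 0 := by
      rintro V ⟨x, hx, hV⟩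
      exact hsame c hc x hx _ c.lo_mem_body V hV
    have hlo := hfS (hc _ c.lo_mem_body)
    -- All surviving vertices occur together in the support of `f` at the lowest corner, which is a
    -- chain.
    have hchain : IsChain (· ≤ ·) C := hlo.2.2.1.mono hCS
    have hne : C.Nonempty := by
      obtain ⟨V, hV⟩ := Geom.exists_ne_zero (hf'S _ _ hlo)
      exact ⟨V, _, c.lo_mem_body, hV⟩
    obtain ⟨W, hWC, hWm⟩ := (toFinite C).exists_minimal hne
    refine ⟨W, hlo.2.2.2 W (hCS W hWC), hWC, fun x hx V hV => ?_⟩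
    rcases hchain.total hWC ⟨x, hx, hV⟩ with h | h
    · exact h
    · exact hWm ⟨x, hx, hV⟩ h
  choose! W hWS hWx hWle using hW
  refine ⟨M, hM, f', W, ?_, ?_, hWS, ?_, ?_⟩
  · exact hρc.comp (hf.comp (by fun_prop) hbK) fun x hx =>
      Geom.mono (subset_univ S) (hfS (hbK hx))
  · intro T hTK hT S' hfT
    have hs : ∀ x : ι → ℝ, (M : ℝ)⁻¹ • (M : ℝ) • x = x := fun x => inv_smul_smul₀ hM'.ne' x
    have e : ∀ x, f' ((M : ℝ) • x) = truncate ε (f x) := fun x => by simp only [f', hs]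
    simp only [e]
    refine htpyOn_of_isChain (hf.mono hTK) ?_ hfT (fun x hx => hρS S' (hfT hx)) fun x hx => ?_
    · exact hρc.comp (hf.mono hTK) fun x hx => Geom.mono (subset_univ S') (hfT hx)
    · refine (hfT hx).2.2.1.mono ?_
      rintro V (hV | hV)
      · exact hV
      · exact (hε.trans (hρ _ _ hV)).ne'
  · intro c hc d hd
    obtain ⟨x, hx, hxW⟩ := hWx d (grid_of_le c hc d hd)
    exact hWle c hc x (Cell.body_mono hd hx) _ hxW
  · intro c hc x hx S' hxS
    have h1 := hf'S x S' hxS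
    exact ⟨h1.1, h1.2.1, h1.2.2.1, fun V hV => ⟨h1.2.2.2 V hV, hWle c hc x hx V hV⟩⟩

/-! ### Quillen's fibre lemma for fillings -/

omit [Fintype ι] in
lemma continuousOn_smul_bodies {X : Type*} [TopologicalSpace X] {M : ℕ} {L : Set (Cell ι)}
    {g : (ι → ℝ) → X} (hg : ContinuousOn g (Cell.bodies L)) {T : Set (ι → ℝ)}
    (hT : ∀ x ∈ T, (M : ℝ) • x ∈ Cell.bodies L) : ContinuousOn (fun x => g ((M : ℝ) • x)) T :=
  hg.comp (by fun_prop) hT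

/-- Over each cell the approximated sphere lies above `W c`. The set `S ∩ {V | W c ≤ V}` is a cone
with apex `W c`, and its trace on `E` admits fillings, so the sphere deforms cell by cell into `E`
and is filled there. -/
theorem fill_of_fill_fibers [Nonempty P] {E S : Set P} (hES : E ⊆ S)
    (hfib : ∀ Z ∈ S, ∀ d, Fill d (Geom (E ∩ {V | Z ≤ V})) (Geom (E ∩ {V | Z ≤ V}))) {d : ℕ}
    (h : Fill d (Geom E) (Geom E)) : Fill d (Geom S) (Geom S) := by
  intro f hf hfS
  obtain ⟨M, hM, f', W, hc, hh, hWS, hWm, hcar⟩ := exists_chain_approx (isCompact_sphere 0 1) hf hfS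
  have hbig : ∀ x ∈ sphere (0 : Fin d → ℝ) 1,
      (M : ℝ) • x ∈ Cell.bodies (grid M (sphere (0 : Fin d → ℝ) 1)) :=
    fun x hx => smul_mem_bodies_sphere hM hx
  have hge : ∀ (T : Set P), ∀ c ∈ grid M (sphere (0 : Fin d → ℝ) 1), ∀ e ≤ c,
      Geom (T ∩ {V | W e ≤ V}) ⊆ Geom (T ∩ {V | W c ≤ V}) := fun T c hc e he =>
    Geom.mono fun V hV => ⟨hV.1, (hWm c hc e he).trans hV.2⟩
  have hES' : ∀ c, Geom (E ∩ {V | W c ≤ V}) ⊆ Geom (S ∩ {V | W c ≤ V}) := fun c =>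
    Geom.mono fun V hV => ⟨hES hV.1, hV.2⟩
  obtain ⟨g, hg, hgE, hfg⟩ := Cell.exists_htpyOn_of_fill
    (finite_grid hM sphere_subset_closedBall) grid_of_le
    (fun c => Geom (S ∩ {V | W c ≤ V})) (fun c => Geom (E ∩ {V | W c ≤ V}))
    (fun c => Geom (S ∩ {V | W c ≤ V})) (fun c => Geom (E ∩ {V | W c ≤ V}))
    (fun c => Geom (S ∩ {V | W c ≤ V})) (S := Geom S)
    (fun c hc e he => hge E c hc e he.le) (fun c hc e he => hge S c hc e he.le)
    (hge S) (fun c hc e he => (hES' e).trans (hge S c hc e he))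
    (fun c hc => hfib _ (hWS c hc) _)
    (fun c hc => (nullIn_of_isLeast (S := S ∩ {V | W c ≤ V}) (m := W c) Subset.rfl
      ⟨hWS c hc, le_rfl⟩ fun V hV => hV.2).fill _)
    (fun c hc => Geom.mono inter_subset_left) hc
    (fun c hc x hx => hcar c hc x hx S (hfS (hc x hx)))
  obtain ⟨k, hk, hkE, hkg⟩ := h (fun x => g ((M : ℝ) • x)) (continuousOn_smul_bodies hg hbig)
    fun x hx => by
      obtain ⟨c, hc, hxc⟩ := Cell.mem_bodies.1 (hbig x hx)
      exact Geom.mono inter_subset_left (hgE c hc hxc)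
  have h1 : HtpyOn (sphere 0 1) (Geom S) f k :=
    ((hh _ Subset.rfl hbig S hfS).trans
      (hfg.comp (φ := fun x => (M : ℝ) • x) (by fun_prop) hbig)).congr (fun _ _ => rfl) hkg.symm
  exact exists_extension_of_htpyOn h1 hk (hkE.mono_right (Geom.mono hES))

/-- The converse transfer: fill the sphere in `S`, approximate the ball, keep the map on the
boundary cells, where it already lies in `E`, and rebuild it over the other cells inside the fibres
`E ∩ {V | W c ≤ V}`. -/
theorem fill_subset_of_fill_fibers [Nonempty P] {E S : Set P} (hES : E ⊆ S)
    (hfib : ∀ Z ∈ S, ∀ d, Fill d (Geom (E ∩ {V | Z ≤ V})) (Geom (E ∩ {V | Z ≤ V}))) {d : ℕ}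
    (h : Fill d (Geom S) (Geom S)) : Fill d (Geom E) (Geom E) := by
  intro f hf hfE
  obtain ⟨k, hk, hkS, hkf⟩ := h f hf (hfE.mono_right (Geom.mono hES))
  obtain ⟨M, hM, f', W, hc, hh, hWS, hWm, hcar⟩ :=
    exists_chain_approx (isCompact_closedBall 0 1) hk hkS
  have hbig : ∀ x ∈ closedBall (0 : Fin d → ℝ) 1,
      (M : ℝ) • x ∈ Cell.bodies (grid M (closedBall (0 : Fin d → ℝ) 1)) :=
    fun x hx => smul_mem_bodies_closedBall hM hx
  have hsub : grid M (sphere (0 : Fin d → ℝ) 1) ⊆ grid M (closedBall (0 : Fin d → ℝ) 1) :=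
    grid_mono sphere_subset_closedBall
  have hbsub : Cell.bodies (grid M (sphere (0 : Fin d → ℝ) 1)) ⊆
      Cell.bodies (grid M (closedBall (0 : Fin d → ℝ) 1)) := by
    intro x hx
    obtain ⟨c, hc, hxc⟩ := Cell.mem_bodies.1 hx
    exact Cell.mem_bodies.2 ⟨c, hsub hc, hxc⟩
  have hkE : MapsTo k (sphere 0 1) (Geom E) := fun x hx => by
    rw [hkf hx]
    exact hfE hx
  obtain ⟨g, hg, hgf, hgE⟩ := Cell.exists_extension_of_fill
    (finite_grid hM Subset.rfl) grid_of_le hsub grid_of_le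
    (fun c => Geom (E ∩ {V | W c ≤ V})) (fun c => Geom (E ∩ {V | W c ≤ V}))
    (fun c hc _ e he => Geom.mono fun V hV => ⟨hV.1, (hWm c hc e he.le).trans hV.2⟩)
    (fun c hc _ => hfib _ (hWS c hc) _) (hc.mono hbsub)
    (fun c hc x hx => hcar c (hsub hc) x hx E (hkE (hc x hx)))
  have h1 : HtpyOn (sphere 0 1) (Geom E) f (fun x => g ((M : ℝ) • x)) := by
    refine (hh _ sphere_subset_closedBall (fun x hx => hbig x (sphere_subset_closedBall hx)) E
      hkE).congr hkf fun x hx => ?_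
    exact (hgf (smul_mem_bodies_sphere hM hx)).symm
  refine exists_extension_of_htpyOn h1 (continuousOn_smul_bodies hg hbig) fun x hx => ?_
  obtain ⟨c, hc, hxc⟩ := Cell.mem_bodies.1 (hbig x hx)
  exact Geom.mono inter_subset_left (hgE c hc hxc)

end Approx
end Brin

namespace Brin
open Set Topology Metric

/-! ### Fillings with bounded supports -/

section Bounded

/-- A bound for the cardinality of labels that are chosen inductively on the cells of dimension at
most `n` of `ι → ℝ`, with `k` the cardinality of `ι`. -/
def labelBound (k b : ℕ) : ℕ → ℕ
  | 0 => 9 * b + 8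
  | n + 1 => 9 * (b + 4 ^ k * labelBound k b n) + 8

lemma labelBound_mono (k b : ℕ) : Monotone (labelBound k b) := by
  refine monotone_nat_of_le_succ fun n => ?_
  induction n with
  | zero =>
    simp only [labelBound]
    exact Nat.add_le_add_right (Nat.mul_le_mul_left _ (Nat.le_add_right _ _)) _
  | succ n ih =>
    simp only [labelBound] at ih ⊢
    gcongr

variable {ι α : Type*} [Fintype ι]

/-- A face is determined by whether its lower and its upper end agree with those of `c` in each
coordinate: two bits per coordinate. -/
lemma Cell.finite_Iic (c : Cell ι) : (Iic c).Finite ∧ (Iic c).ncard ≤ 4 ^ Fintype.card ι := by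
  classical
  let e : Iic c → (ι → Bool) × (ι → Bool) := fun d =>
    (fun i => decide (d.1.lo i = c.lo i), fun i => decide (d.1.hi i = c.hi i))
  have he : Function.Injective e := by
    rintro ⟨d, hd⟩ ⟨d', hd'⟩ h
    simp only [e, Prod.mk.injEq, funext_iff, decide_eq_decide] at h
    refine Subtype.ext (Cell.ext (funext fun i => ?_) (funext fun i => ?_)) <;>
    · have h1 := h.1 i
      have h2 := h.2 i
      have h3 := hd i
      have h4 := hd' i
      have := c.hi_le i
      have := d.lo_le i
      have := d'.lo_le i
      simp only
      omega
  have hfin : Finite (Iic c) := Finite.of_injective e he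
  refine ⟨toFinite _, ?_⟩
  have := Nat.card_le_card_of_injective e he
  rw [Nat.card_coe_set_eq] at this
  refine this.trans ?_
  simp only [Nat.card_eq_fintype_card, Fintype.card_prod, Fintype.card_fun, Fintype.card_bool]
  rw [← mul_pow]
  norm_num

lemma Cell.dim_le (c : Cell ι) : c.dim ≤ Fintype.card ι := Finset.card_le_univ _

variable [DecidableEq α]

/-- The label `σ c` must contain the enlarged labels `τ d` of all proper faces, with a bound free of
the number of cells in `L`. Dimension bounds the number of rounds, and the number of faces bounds
the growth in each round. -/
lemma exists_labels {L : Set (Cell ι)} (hLd : ∀ c ∈ L, ∀ d ≤ c, d ∈ L)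
    (enl : Cell ι → Finset α → Finset α) (init : Cell ι → Finset α) {b N : ℕ}
    (hN : b + 4 ^ Fintype.card ι * labelBound (Fintype.card ι) b (Fintype.card ι) ≤ N)
    (henl : ∀ c ∈ L, ∀ T, T.card ≤ N → T ⊆ enl c T ∧ (enl c T).card ≤ 9 * T.card + 8)
    (hinit : ∀ c ∈ L, (init c).card ≤ b) :
    ∃ τ σ : Cell ι → Finset α, (∀ c ∈ L, (σ c).card ≤ N ∧ τ c = enl c (σ c) ∧ init c ⊆ σ c ∧
      (τ c).card ≤ labelBound (Fintype.card ι) b (Fintype.card ι)) ∧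
      ∀ c ∈ L, ∀ d < c, τ d ⊆ σ c := by
  set k := Fintype.card ι with hk
  let faces : Cell ι → Finset (Cell ι) := fun c => (Cell.finite_Iic c).1.toFinset
  have hfaces : ∀ c d, d ∈ faces c ↔ d ≤ c := fun c d => by simp [faces]
  have hfcard : ∀ c, (faces c).card ≤ 4 ^ k := fun c => by
    have := (Cell.finite_Iic c).2
    rwa [ncard_eq_toFinset_card _ (Cell.finite_Iic c).1] at this
  -- Each round adds the enlarged labels of all faces, including `c` itself. The latter makes the
  -- enlarged labels grow with the round although `enl` is not assumed monotone.
  let σ' : ℕ → Cell ι → Finset α := fun n => Nat.rec init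
    (fun _ s c => init c ∪ (faces c).biUnion fun d => enl d (s d)) n
  have σ'_succ : ∀ n c, σ' (n + 1) c = init c ∪ (faces c).biUnion fun d => enl d (σ' n d) :=
    fun _ _ => rfl
  have hinitσ : ∀ n c, init c ⊆ σ' n c := by
    intro n c
    cases n with
    | zero => exact subset_rfl
    | succ n =>
      rw [σ'_succ]
      exact Finset.subset_union_left
  have hcard : ∀ n ≤ k, ∀ c ∈ L, (σ' n c).card ≤ N ∧
      (enl c (σ' n c)).card ≤ labelBound k b n := by
    intro n
    induction n with
    | zero =>
      intro _ c hc
      have h1 : (init c).card ≤ N := (hinit c hc).trans ((Nat.le_add_right _ _).trans hN)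
      refine ⟨h1, ((henl c hc _ h1).2).trans ?_⟩
      have := hinit c hc
      simp only [labelBound]
      omega
    | succ n ih =>
      intro hn c hc
      have h1 : (σ' (n + 1) c).card ≤ b + 4 ^ k * labelBound k b n := by
        rw [σ'_succ]
        refine (Finset.card_union_le _ _).trans (add_le_add (hinit c hc) ?_)
        refine (Finset.card_biUnion_le_card_mul _ _ (labelBound k b n) fun d hd => ?_).trans
          (Nat.mul_le_mul_right _ (hfcard c))
        exact (ih (by omega) d (hLd c hc d ((hfaces c d).1 hd))).2
      have h2 : (σ' (n + 1) c).card ≤ N := by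
        refine h1.trans (le_trans ?_ hN)
        have := labelBound_mono k b (by omega : n ≤ k)
        gcongr
      refine ⟨h2, ((henl c hc _ h2).2).trans ?_⟩
      simp only [labelBound]
      omega
  have hmono : ∀ c ∈ L, ∀ n m, n ≤ m → m ≤ k → enl c (σ' n c) ⊆ enl c (σ' m c) := by
    intro c hc n m hnm
    induction m, hnm using Nat.le_induction with
    | base => exact fun _ => subset_rfl
    | succ m _ ih =>
      intro hm
      refine (ih (by omega)).trans (Finset.Subset.trans ?_ (henl c hc _ (hcard (m + 1) hm c hc).1).1)
      rw [σ'_succ]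
      exact (Finset.subset_biUnion_of_mem (fun d => enl d (σ' m d)) ((hfaces c c).2 le_rfl)).trans
        Finset.subset_union_right
  refine ⟨fun c => enl c (σ' c.dim c), fun c => σ' c.dim c, fun c hc => ⟨?_, rfl, hinitσ _ c, ?_⟩, ?_⟩
  · exact (hcard _ c.dim_le c hc).1
  · exact (hcard _ c.dim_le c hc).2.trans (labelBound_mono k b c.dim_le)
  · intro c hc d hd
    have h1 := Cell.dim_lt_of_lt hd
    have h2 := c.dim_le
    obtain ⟨n, hn⟩ : ∃ n, c.dim = n + 1 := ⟨c.dim - 1, by omega⟩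
    simp only [hn]
    rw [σ'_succ]
    refine (hmono d (hLd c hc d hd.le) d.dim n (by omega) (by omega)).trans ?_
    exact (Finset.subset_biUnion_of_mem (fun d => enl d (σ' n d)) ((hfaces c d).2 hd.le)).trans
      Finset.subset_union_right

/-- A lower bound for the number of labels needed to fill spheres of dimension `d - 1`. -/
def fillBound (d : ℕ) : ℕ :=
  (labelBound d 0 d + 8) + 4 ^ d * labelBound d (labelBound d 0 d + 8) d

variable {P : Type*} [PartialOrder P] [Fintype P]

/-- Two cellwise homotopies. The first uses `hloc` to move the approximated sphere into elements
whose supports have size bounded in terms of `d` alone. The second uses `hglob`, which is available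
only for small `T`, to contract the result to a point. -/
theorem fill_of_bounded_nullIn [Nonempty P] {E : Set P} (supp : P → Finset α) {d N : ℕ}
    (hN : fillBound d ≤ N)
    (hloc : ∀ W ∈ E, ∀ T : Finset α, ∃ T', T ⊆ T' ∧ T'.card ≤ 9 * T.card + 8 ∧
      NullIn (Geom {V | V ∈ E ∧ supp V ⊆ T ∧ W ≤ V}) (Geom {V | V ∈ E ∧ supp V ⊆ T' ∧ W ≤ V}))
    (hglob : ∀ T : Finset α, T.card ≤ N → ∃ T', T ⊆ T' ∧ T'.card ≤ 9 * T.card + 8 ∧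
      NullIn (Geom {V | V ∈ E ∧ supp V ⊆ T}) (Geom {V | V ∈ E ∧ supp V ⊆ T'})) :
    Fill d (Geom E) (Geom E) := by
  classical
  intro f hf hfE
  obtain ⟨M, hM, f', W, hc, hh, hWE, hWm, hcar⟩ := exists_chain_approx (isCompact_sphere 0 1) hf hfE
  have hbig : ∀ x ∈ sphere (0 : Fin d → ℝ) 1,
      (M : ℝ) • x ∈ Cell.bodies (grid M (sphere (0 : Fin d → ℝ) 1)) :=
    fun x hx => smul_mem_bodies_sphere hM hx
  set L := grid M (sphere (0 : Fin d → ℝ) 1)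
  have hLfin : L.Finite := finite_grid hM sphere_subset_closedBall
  have hLd : ∀ c ∈ L, ∀ e ≤ c, e ∈ L := grid_of_le
  choose! enl henl1 henl2 henl3 using hloc
  choose! enl' henl1' henl2' henl3' using hglob
  -- The local enlargement has no size restriction, so the size limit is chosen to make the
  -- requirement an equality; the initial labels are empty.
  obtain ⟨τ, σ, hτ, hτσ⟩ := exists_labels hLd (fun c => enl (W c)) (fun _ => ∅) (b := 0)
    (N := 0 + 4 ^ Fintype.card (Fin d) * labelBound (Fintype.card (Fin d)) 0 (Fintype.card (Fin d)))
    le_rfl (fun c hc T _ => ⟨henl1 _ (hWE c hc) T, henl2 _ (hWE c hc) T⟩) (fun _ _ => by simp)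
  rw [Fintype.card_fin] at hτ
  obtain ⟨g, hg, hgE, hfg⟩ := Cell.exists_htpyOn_of_fill hLfin hLd
    (fun c => Geom (E ∩ {V | W c ≤ V})) (fun c => Geom {V | V ∈ E ∧ supp V ⊆ τ c ∧ W c ≤ V})
    (fun c => Geom (E ∩ {V | W c ≤ V})) (fun c => Geom {V | V ∈ E ∧ supp V ⊆ σ c ∧ W c ≤ V})
    (fun c => Geom (E ∩ {V | W c ≤ V})) (S := Geom E)
    (fun c hc e he => Geom.mono fun V (hV : V ∈ E ∧ supp V ⊆ τ e ∧ W e ≤ V) =>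
      ⟨hV.1, hV.2.1.trans (hτσ c hc e he), (hWm c hc e he.le).trans hV.2.2⟩)
    (fun c hc e he => Geom.mono fun V (hV : V ∈ E ∧ W e ≤ V) =>
      ⟨hV.1, (hWm c hc e he.le).trans hV.2⟩)
    (fun c hc e he => Geom.mono fun V (hV : V ∈ E ∧ W e ≤ V) =>
      ⟨hV.1, (hWm c hc e he).trans hV.2⟩)
    (fun c hc e he => Geom.mono fun V (hV : V ∈ E ∧ supp V ⊆ τ e ∧ W e ≤ V) =>
      ⟨hV.1, (hWm c hc e he).trans hV.2.2⟩)
    (fun c hc => by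
      simp only [(hτ c hc).2.1]
      exact (henl3 _ (hWE c hc) (σ c)).fill _)
    (fun c hc => (nullIn_of_isLeast (S := E ∩ {V | W c ≤ V}) (m := W c) Subset.rfl
      ⟨hWE c hc, le_rfl⟩ fun V hV => hV.2).fill _)
    (fun c hc => Geom.mono inter_subset_left) hc
    (fun c hc x hx => hcar c hc x hx E (hfE (hc x hx)))
  have hT₀ := henl2' ∅ (by simp)
  -- The target point comes from the global contraction for `T = ∅`. Its support label `T₀` has at
  -- most 8 elements and is added to every label of the second pass.
  obtain ⟨p, hp, -⟩ := henl3' ∅ (by simp)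
  set T₀ := enl' ∅
  have hτcard : ∀ c ∈ L, (τ c ∪ T₀).card ≤ labelBound d 0 d + 8 := fun c hc =>
    (Finset.card_union_le _ _).trans (add_le_add (hτ c hc).2.2.2 (by simpa using hT₀))
  obtain ⟨τ', σ', hτ', hτσ'⟩ := exists_labels hLd (fun _ => enl') (fun c => τ c ∪ T₀)
    (N := N) (by simpa only [Fintype.card_fin, fillBound] using hN)
    (fun c hc T hT => ⟨henl1' T hT, henl2' T hT⟩) hτcard
  have hσ' : ∀ c ∈ L, ∀ e ≤ c, τ e ⊆ σ' c := by
    intro c hc e he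
    rcases he.eq_or_lt with rfl | h
    · exact Finset.subset_union_left.trans (hτ' e hc).2.2.1
    · have h1 := hτ' e (hLd c hc e he)
      refine (Finset.subset_union_left.trans h1.2.2.1).trans
        (Finset.Subset.trans ?_ (hτσ' c hc e h))
      rw [h1.2.1]
      exact henl1' _ h1.1
  -- The top of the cylinder is prescribed to be constantly `p`; only the cylinders themselves need
  -- the global contraction.
  obtain ⟨k, hk, hkp, hgk⟩ := Cell.exists_htpyOn_of_fill hLfin hLd
    (fun c => Geom {V | V ∈ E ∧ supp V ⊆ τ c}) (fun _ => {p})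
    (fun c => Geom {V | V ∈ E ∧ supp V ⊆ τ' c}) (fun _ => {p})
    (fun c => Geom {V | V ∈ E ∧ supp V ⊆ σ' c}) (S := Geom E)
    (fun c hc e he => Subset.rfl)
    (fun c hc e he => Geom.mono fun V (hV : V ∈ E ∧ supp V ⊆ τ' e) =>
      ⟨hV.1, hV.2.trans (hτσ' c hc e he)⟩)
    (fun c hc e he => Geom.mono fun V (hV : V ∈ E ∧ supp V ⊆ τ e) =>
      ⟨hV.1, hV.2.trans (hσ' c hc e he)⟩)
    (fun c hc e he => singleton_subset_iff.2 (Geom.mono (S' := {V | V ∈ E ∧ supp V ⊆ σ' c})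
      (fun V (hV : V ∈ E ∧ supp V ⊆ T₀) =>
        ⟨hV.1, hV.2.trans (Finset.subset_union_right.trans (hτ' c hc).2.2.1)⟩) hp))
    (fun c hc f _ hf => ⟨fun _ => p, continuousOn_const, fun _ _ => rfl, fun x hx => (hf hx).symm⟩)
    (fun c hc => by
      simp only [(hτ' c hc).2.1]
      exact (henl3' _ (hτ' c hc).1).fill _)
    (fun c hc => Geom.mono fun V (hV : V ∈ E ∧ supp V ⊆ τ' c) => hV.1) hg
    (fun c hc x hx => Geom.mono (S' := {V | V ∈ E ∧ supp V ⊆ τ c})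
      (fun V (hV : V ∈ E ∧ supp V ⊆ τ c ∧ W c ≤ V) =>
      ⟨hV.1, hV.2.1⟩) (hgE c hc hx))
  have h1 : HtpyOn (sphere 0 1) (Geom E) f (fun _ => p) := by
    refine ((hh _ Subset.rfl hbig E hfE).trans
      ((hfg.trans hgk).comp (φ := fun x => (M : ℝ) • x) (by fun_prop) hbig)).congr
      (fun _ _ => rfl) fun x hx => ?_
    obtain ⟨c, hc, hxc⟩ := Cell.mem_bodies.1 (hbig x hx)
    exact hkp c hc hxc
  exact exists_extension_of_htpyOn h1 continuousOn_const
    fun _ _ => Geom.mono (fun V (hV : V ∈ E ∧ supp V ⊆ T₀) => hV.1) hp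

end Bounded
end Brin

namespace Brin
open Set Topology Metric

/-! ### Reduction to a subposet with contractible upper intervals outside it -/

section Upper

variable {P : Type*} [PartialOrder P] [Fintype P]

/-- If the elements above any `Z ∉ E` form a contractible poset, then `E` carries the homotopy type
of the whole poset. -/
theorem fill_univ_of_upper [Nonempty P] {E : Set P} (hcone : ∀ Z ∉ E, NullIn (Geom {V | Z < V}) (Geom {V | Z < V})) {d : ℕ}
    (h : Fill d (Geom E) (Geom E)) : Fill d (Geom (univ : Set P)) (Geom (univ : Set P)) := by
  -- Descending induction on `Z`. For `Z ∈ E` the fibre is a cone; otherwise it is a subset of the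
  -- contractible `{V | Z < V}`, and its own fibres lie over larger elements.
  have key : ∀ (Z : P) (d : ℕ), Fill d (Geom (E ∩ {V | Z ≤ V})) (Geom (E ∩ {V | Z ≤ V})) := by
    intro Z
    induction Z using (wellFounded_gt (α := P)).induction with
    | _ Z ih =>
      intro d
      by_cases hZ : Z ∈ E
      · exact (nullIn_of_isLeast (S := E ∩ {V | Z ≤ V}) Subset.rfl ⟨hZ, le_rfl⟩
          fun V hV => hV.2).fill d
      · refine fill_subset_of_fill_fibers (S := {V | Z < V}) ?_ ?_ ((hcone Z hZ).fill d)
        · rintro V ⟨hV, hZV⟩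
          exact lt_of_le_of_ne hZV fun h => hZ (h ▸ hV)
        · intro Z' hZ' d
          have e : E ∩ {V | Z ≤ V} ∩ {V | Z' ≤ V} = E ∩ {V | Z' ≤ V} := by
            ext V
            exact ⟨fun hV => ⟨hV.1.1, hV.2⟩, fun hV => ⟨⟨hV.1, hZ'.le.trans hV.2⟩, hV.2⟩⟩
          rw [e]
          exact ih Z' hZ' d
  exact fill_of_fill_fibers (subset_univ E) (fun Z _ => key Z) h

end Upper
end Brin

namespace Brin
open Set Topology OmegaAlgebra

/-! ### Descendants of a single element -/

section Descendants

variable {s : ℕ}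

namespace HigmanAlgebra

/-- The part of the product of Cantor sets that belongs to an element. -/
def im (u : HigmanAlgebra s) : Set (Cantor s) := range u.eval

lemma im_nonempty (u : HigmanAlgebra s) : u.im.Nonempty := ⟨_, ⟨fun _ _ => 0, rfl⟩⟩

lemma im_desc_subset (i : Fin s) (l : Fin 2) (u : HigmanAlgebra s) :
    (desc i l u).im ⊆ u.im := by
  rintro _ ⟨c, rfl⟩
  exact ⟨_, (eval_desc i l u c).symm⟩

lemma exists_mem_im_desc (i : Fin s) {u : HigmanAlgebra s} {p : Cantor s} (hp : p ∈ u.im) :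
    ∃ l, p ∈ (desc i l u).im := by
  obtain ⟨c, rfl⟩ := hp
  exact ⟨c i 0, Cantor.tail i c, by rw [eval_desc, Cantor.cons_tail]⟩

lemma desc_comm {i j : Fin s} (h : i ≠ j) (l t : Fin 2) (u : HigmanAlgebra s) :
    desc j t (desc i l u) = desc i l (desc j t u) := by
  induction u using Quotient.inductionOn with
  | _ w => exact Quotient.sound (HigmanRel.desc_comm i j l t w h)

lemma lam_desc (i : Fin s) (u : HigmanAlgebra s) : lam i (desc i 0 u) (desc i 1 u) = u := by
  induction u using Quotient.inductionOn with
  | _ w => exact Quotient.sound (HigmanRel.lam_desc i w)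

lemma desc_zero_lam (i : Fin s) (u v : HigmanAlgebra s) : desc i 0 (lam i u v) = u := by
  induction u using Quotient.inductionOn with
  | _ w =>
    induction v using Quotient.inductionOn with
    | _ w' => exact Quotient.sound (HigmanRel.desc_zero_lam i w w')

lemma desc_one_lam (i : Fin s) (u v : HigmanAlgebra s) : desc i 1 (lam i u v) = v := by
  induction u using Quotient.inductionOn with
  | _ w =>
    induction v using Quotient.inductionOn with
    | _ w' => exact Quotient.sound (HigmanRel.desc_one_lam i w w')

/-- The evaluation of `u` is injective. -/
def Inj (u : HigmanAlgebra s) : Prop := Function.Injective u.eval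

lemma Inj.desc {u : HigmanAlgebra s} (h : u.Inj) (i : Fin s) (l : Fin 2) :
    (desc i l u : HigmanAlgebra s).Inj := by
  intro c d e
  rw [eval_desc, eval_desc] at e
  rw [← Cantor.tail_cons i l c, h e, Cantor.tail_cons]

lemma Inj.disjoint_im_desc {u : HigmanAlgebra s} (h : u.Inj) (i : Fin s) {l m : Fin 2}
    (hlm : l ≠ m) : Disjoint (OmegaAlgebra.desc i l u).im (OmegaAlgebra.desc i m u).im := by
  rw [Set.disjoint_left]
  rintro _ ⟨c, rfl⟩ ⟨d, hd⟩
  rw [eval_desc, eval_desc] at hd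
  have := congrArg (fun c : Cantor s => c i 0) (h hd)
  simp only [Cantor.cons_head] at this
  exact hlm this.symm

lemma Inj.inter_im_desc {u : HigmanAlgebra s} (h : u.Inj) {i j : Fin s} (hij : i ≠ j)
    (l t : Fin 2) : (OmegaAlgebra.desc i l u).im ∩ (OmegaAlgebra.desc j t u).im ⊆
      (OmegaAlgebra.desc j t (OmegaAlgebra.desc i l u)).im := by
  rintro _ ⟨⟨c, rfl⟩, ⟨d, hd⟩⟩
  rw [eval_desc, eval_desc] at hd
  have e := h hd
  have hc : c j 0 = t := by
    have := congrArg (fun c : Cantor s => c j 0) e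
    simp only [Cantor.cons_head] at this
    rw [this]
    simp [Cantor.cons, Function.update_of_ne hij.symm]
  refine ⟨Cantor.tail j c, ?_⟩
  rw [eval_desc, ← hc, Cantor.cons_tail]

/-- Needed for a newly contracted element, whose two halves are disjoint elements of an admissible
set. -/
lemma inj_of_separated {i : Fin s} {u : HigmanAlgebra s}
    (h : Separated eval {desc i 0 u, desc i 1 u}) (hne : desc i 0 u ≠ desc i 1 u) : u.Inj := by
  have key : ∀ l : Fin 2, (desc i l u : HigmanAlgebra s) ∈
      ({desc i 0 u, desc i 1 u} : Set (HigmanAlgebra s)) := by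
    intro l
    fin_cases l
    · exact .inl rfl
    · exact .inr rfl
  intro c d e
  rw [← Cantor.cons_tail i c, ← Cantor.cons_tail i d, ← eval_desc, ← eval_desc] at e
  obtain ⟨e1, e2⟩ := h _ (key _) _ (key _) _ _ e
  have e3 : c i 0 = d i 0 := by
    generalize c i 0 = l at e1
    generalize d i 0 = m at e1
    fin_cases l <;> fin_cases m
    · rfl
    · exact absurd e1 hne
    · exact absurd e1.symm hne
    · rfl
  rw [← Cantor.cons_tail i c, ← Cantor.cons_tail i d, e2, e3]

end HigmanAlgebra

open HigmanAlgebra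

lemma Separated.inj {Y : Set (HigmanAlgebra s)} (hY : Separated HigmanAlgebra.eval Y)
    {u : HigmanAlgebra s} (hu : u ∈ Y) : u.Inj := fun c d e => (hY u hu u hu c d e).2

lemma Separated.eq {Y : Set (HigmanAlgebra s)} (hY : Separated HigmanAlgebra.eval Y)
    {u v : HigmanAlgebra s} (hu : u ∈ Y) (hv : v ∈ Y) {p : Cantor s} (hpu : p ∈ u.im)
    (hpv : p ∈ v.im) : u = v := by
  obtain ⟨c, rfl⟩ := hpu
  obtain ⟨d, hd⟩ := hpv
  exact (hY u hu v hv c d hd.symm).1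

lemma Separated.mono {Y Z : Set (HigmanAlgebra s)} (hY : Separated HigmanAlgebra.eval Y)
    (h : Z ⊆ Y) : Separated HigmanAlgebra.eval Z := fun u hu v hv => hY u (h hu) v (h hv)

/-- `F` is obtained from `{u}` by a finite number of simple expansions, described from the root. -/
inductive Desc : HigmanAlgebra s → Set (HigmanAlgebra s) → Prop
  | refl (u : HigmanAlgebra s) : Desc u {u}
  | node (i : Fin s) {u : HigmanAlgebra s} {F G : Set (HigmanAlgebra s)} :
      Desc (desc i 0 u) F → Desc (desc i 1 u) G → Desc u (F ∪ G)

/-- The elements of `B` below `a`. -/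
def under (B : Set (HigmanAlgebra s)) (a : HigmanAlgebra s) : Set (HigmanAlgebra s) :=
  {x | x ∈ B ∧ x.im ⊆ a.im}

namespace Desc

lemma im_subset {u : HigmanAlgebra s} {F : Set (HigmanAlgebra s)} (h : Desc u F) :
    ∀ x ∈ F, x.im ⊆ u.im := by
  induction h with
  | refl u => rintro x rfl; exact Subset.rfl
  | node i _ _ ih ih' =>
    rintro x (hx | hx)
    · exact (ih x hx).trans (im_desc_subset _ _ _)
    · exact (ih' x hx).trans (im_desc_subset _ _ _)

lemma exists_mem_im {u : HigmanAlgebra s} {F : Set (HigmanAlgebra s)} (h : Desc u F) :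
    ∀ p ∈ u.im, ∃ x ∈ F, p ∈ x.im := by
  induction h with
  | refl u => exact fun p hp => ⟨u, rfl, hp⟩
  | node i _ _ ih ih' =>
    intro p hp
    obtain ⟨l, hl⟩ := exists_mem_im_desc i hp
    fin_cases l
    · obtain ⟨x, hx, hxp⟩ := ih p hl
      exact ⟨x, .inl hx, hxp⟩
    · obtain ⟨x, hx, hxp⟩ := ih' p hl
      exact ⟨x, .inr hx, hxp⟩

lemma nonempty {u : HigmanAlgebra s} {F : Set (HigmanAlgebra s)} (h : Desc u F) : F.Nonempty := by
  obtain ⟨p, hp⟩ := u.im_nonempty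
  obtain ⟨x, hx, -⟩ := h.exists_mem_im p hp
  exact ⟨x, hx⟩

lemma trans {u : HigmanAlgebra s} {F : Set (HigmanAlgebra s)} (h : Desc u F)
    {G : HigmanAlgebra s → Set (HigmanAlgebra s)} (hG : ∀ x ∈ F, Desc x (G x)) :
    Desc u (⋃ x ∈ F, G x) := by
  induction h with
  | refl u => simpa using hG u rfl
  | node i _ _ ih ih' =>
    rw [biUnion_union]
    exact .node i (ih fun x hx => hG x (.inl hx)) (ih' fun x hx => hG x (.inr hx))

lemma expansion (i : Fin s) (u : HigmanAlgebra s) : Desc u {desc i 0 u, desc i 1 u} :=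
  .node i (.refl _) (.refl _)

/-- The restriction of an expansion to the two halves of colour `i`. -/
lemma restrict {u : HigmanAlgebra s} {F : Set (HigmanAlgebra s)} (h : Desc u F) (hu : u.Inj)
    (i : Fin s) (hF : ∀ x ∈ F, ∃ l, x.im ⊆ (desc i l u).im) (l : Fin 2) :
    Desc (desc i l u) (under F (desc i l u)) := by
  induction h generalizing l with
  | refl u =>
    exfalso
    obtain ⟨m, hm⟩ := hF u rfl
    obtain ⟨k, hk⟩ : ∃ k : Fin 2, k ≠ m := exists_ne m
    obtain ⟨p, hp⟩ := (desc i k u).im_nonempty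
    exact Set.disjoint_left.1 (hu.disjoint_im_desc i hk) hp (hm (im_desc_subset _ _ _ hp))
  | @node j u F G hF0 hG0 ih ih' =>
    by_cases hij : i = j
    · subst hij
      have hd : ∀ {k m : Fin 2} {x : HigmanAlgebra s}, k ≠ m → x.im ⊆ (desc i k u).im →
          ¬ x.im ⊆ (desc i m u).im := by
        intro k m x hkm h1 h2
        obtain ⟨p, hp⟩ := x.im_nonempty
        exact Set.disjoint_left.1 (hu.disjoint_im_desc i hkm) (h1 hp) (h2 hp)
      fin_cases l
      · have e : under (F ∪ G) (desc i 0 u) = F := by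
          ext x
          refine ⟨fun hx => ?_, fun hx => ⟨.inl hx, hF0.im_subset x hx⟩⟩
          rcases hx.1 with h | h
          · exact h
          · exact absurd hx.2 (hd (by simp) (hG0.im_subset x h))
        change Desc (desc i 0 u) (under (F ∪ G) (desc i 0 u))
        rw [e]
        exact hF0
      · have e : under (F ∪ G) (desc i 1 u) = G := by
          ext x
          refine ⟨fun hx => ?_, fun hx => ⟨.inr hx, hG0.im_subset x hx⟩⟩
          rcases hx.1 with h | h
          · exact absurd hx.2 (hd (by simp) (hF0.im_subset x h))
          · exact h
        change Desc (desc i 1 u) (under (F ∪ G) (desc i 1 u))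
        rw [e]
        exact hG0
    -- When the root colour `j` differs from `i`, both subtrees are restricted to the half of colour
    -- `i` and rejoined by a node of colour `j`, using that the two colours commute.
    · have cut : ∀ k : Fin 2, ∀ H : Set (HigmanAlgebra s), H ⊆ F ∪ G →
          (∀ x ∈ H, x.im ⊆ (desc j k u).im) →
          ∀ x ∈ H, ∃ m, x.im ⊆ (desc i m (desc j k u)).im := by
        intro k H hH hHk x hx
        obtain ⟨m, hm⟩ := hF x (hH hx)
        refine ⟨m, fun p hp => ?_⟩
        exact hu.inter_im_desc (Ne.symm hij) _ _ ⟨hHk x hx hp, hm hp⟩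
      have h0 := ih (hu.desc j 0) (cut 0 F subset_union_left hF0.im_subset) l
      have h1 := ih' (hu.desc j 1) (cut 1 G subset_union_right hG0.im_subset) l
      have sub : ∀ k : Fin 2, ∀ H : Set (HigmanAlgebra s), (∀ x ∈ H, x.im ⊆ (desc j k u).im) →
          under H (desc i l (desc j k u)) = under H (desc i l u) := by
        intro k H hH
        ext x
        refine ⟨fun hx => ⟨hx.1, hx.2.trans ?_⟩, fun hx => ⟨hx.1, fun p hp => ?_⟩⟩
        · rw [← desc_comm hij]
          exact im_desc_subset _ _ _
        · exact hu.inter_im_desc (Ne.symm hij) _ _ ⟨hH x hx.1 hp, hx.2 hp⟩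
      rw [sub 0 F hF0.im_subset, ← desc_comm hij] at h0
      rw [sub 1 G hG0.im_subset, ← desc_comm hij] at h1
      have e : under (F ∪ G) (desc i l u) = under F (desc i l u) ∪ under G (desc i l u) := by
        ext x
        simp only [under, mem_ofPred_eq, mem_union]
        tauto
      rw [e]
      exact .node j h0 h1

/-- Expanding any descendant in colour `i` refines the division of `u` in colour `i`: either `i` was
already cut at the root, or it commutes past the root cut. This supplies the hypothesis of
`restrict`. -/
lemma exists_im_desc_subset {u : HigmanAlgebra s} {F : Set (HigmanAlgebra s)} (h : Desc u F)
    (i : Fin s) : ∀ x ∈ F, ∀ m, ∃ l, (desc i m x).im ⊆ (desc i l u).im := by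
  induction h with
  | refl u => rintro x rfl m; exact ⟨m, Subset.rfl⟩
  | @node j u F G hF hG ih ih' =>
    have step : ∀ (k : Fin 2) (H : Set (HigmanAlgebra s)), (∀ x ∈ H, x.im ⊆ (desc j k u).im) →
        (∀ x ∈ H, ∀ m, ∃ l, (desc i m x).im ⊆ (desc i l (desc j k u)).im) →
        ∀ x ∈ H, ∀ m, ∃ l, (desc i m x).im ⊆ (desc i l u).im := by
      intro k H hH hH' x hx m
      by_cases hij : i = j
      · subst hij
        exact ⟨k, (im_desc_subset _ _ _).trans (hH x hx)⟩
      · obtain ⟨l, hl⟩ := hH' x hx m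
        refine ⟨l, hl.trans ?_⟩
        rw [← desc_comm hij]
        exact im_desc_subset _ _ _
    rintro x (hx | hx) m
    · exact step 0 F hF.im_subset ih x hx m
    · exact step 1 G hG.im_subset ih' x hx m

/-- The passive remainder `R` is carried along so that the two subtrees can be expanded one after
the other, each treating the other as part of the remainder. -/
lemma isDescendant {u : HigmanAlgebra s} {F : Set (HigmanAlgebra s)} (h : Desc u F) (hu : u.Inj)
    {R : Set (HigmanAlgebra s)} (hR : ∀ r ∈ R, Disjoint r.im u.im) :
    IsDescendant s ({u} ∪ R) (F ∪ R) := by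
  induction h generalizing R with
  | refl u => exact Relation.ReflTransGen.refl
  | @node i u F G hF hG ih ih' =>
    have huR : u ∉ R := fun h => by
      obtain ⟨p, hp⟩ := u.im_nonempty
      exact Set.disjoint_left.1 (hR u h) hp hp
    have h1 : IsDescendant s ({u} ∪ R) ({desc i 0 u} ∪ ({desc i 1 u} ∪ R)) := by
      refine Relation.ReflTransGen.single ⟨i, u, .inl rfl, ?_⟩
      ext x
      simp only [mem_union, mem_singleton_iff, mem_sdiff, mem_insert_iff]
      by_cases hx : x = u
      · subst hx
        simp only [huR]
        tauto
      · tauto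
    have hRi : ∀ l, ∀ r ∈ R, Disjoint r.im (desc i l u).im := fun l r hr =>
      (hR r hr).mono_right (im_desc_subset _ _ _)
    have h2 := ih (hu.desc i 0) (R := {desc i 1 u} ∪ R) (by
      rintro r (rfl | hr)
      · exact hu.disjoint_im_desc i (by simp)
      · exact hRi 0 r hr)
    have h3 := ih' (hu.desc i 1) (R := F ∪ R) (by
      rintro r (hr | hr)
      · exact (hu.disjoint_im_desc i (by simp)).mono_left (hF.im_subset r hr)
      · exact hRi 1 r hr)
    have e1 : F ∪ ({desc i 1 u} ∪ R) = {desc i 1 u} ∪ (F ∪ R) := by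
      ext x
      simp only [mem_union]
      tauto
    have e2 : G ∪ (F ∪ R) = F ∪ G ∪ R := by
      ext x
      simp only [mem_union]
      tauto
    rw [e1] at h2
    rw [e2] at h3
    exact (h1.trans h2).trans h3

end Desc

lemma isDescendant_biUnion {A : Set (HigmanAlgebra s)} (hA : Separated HigmanAlgebra.eval A)
    (hfin : A.Finite) {F : HigmanAlgebra s → Set (HigmanAlgebra s)}
    (hF : ∀ a ∈ A, Desc a (F a)) : IsDescendant s A (⋃ a ∈ A, F a) := by
  have key : ∀ A' : Set (HigmanAlgebra s), A'.Finite → A' ⊆ A →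
      IsDescendant s A ((A \ A') ∪ ⋃ a ∈ A', F a) := by
    intro A' hA'
    induction A', hA' using Set.Finite.induction_on with
    | empty =>
      intro _
      simp only [mem_empty_iff_false, iUnion_false, iUnion_empty, sdiff_empty, union_empty]
      exact Relation.ReflTransGen.refl
    | @insert a A' ha _ ih =>
      intro hsub
      have haA : a ∈ A := hsub (mem_insert _ _)
      have h1 := ih ((subset_insert _ _).trans hsub)
      have h2 := (hF a haA).isDescendant (hA.inj haA)
        (R := (A \ insert a A') ∪ ⋃ b ∈ A', F b) (by
          rintro r (hr | hr)
          · rw [Set.disjoint_left]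
            intro p hp hp'
            exact hr.2 (hA.eq hr.1 haA hp hp' ▸ mem_insert _ _)
          · obtain ⟨b, hb, hrb⟩ := mem_iUnion₂.1 hr
            have hbA : b ∈ A := hsub (mem_insert_of_mem _ hb)
            rw [Set.disjoint_left]
            intro p hp hp'
            have := hA.eq hbA haA ((hF b hbA).im_subset r hrb hp) hp'
            exact ha (this ▸ hb))
      have e1 : A \ A' ∪ ⋃ b ∈ A', F b = {a} ∪ (A \ insert a A' ∪ ⋃ b ∈ A', F b) := by
        rw [← union_assoc]
        congr 1
        ext x
        simp only [mem_sdiff, mem_union, mem_singleton_iff, mem_insert_iff]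
        by_cases hx : x = a
        · subst hx
          simp [haA, ha]
        · simp [hx]
      have e2 : F a ∪ (A \ insert a A' ∪ ⋃ b ∈ A', F b) =
          A \ insert a A' ∪ ⋃ b ∈ insert a A', F b := by
        rw [biUnion_insert]
        ext x
        simp only [mem_union]
        tauto
      rw [e1] at h1
      rw [e2] at h2
      exact h1.trans h2
  have := key A hfin Subset.rfl
  simpa using this

lemma under_eq_singleton {A : Set (HigmanAlgebra s)} (hA : Separated HigmanAlgebra.eval A)
    {a : HigmanAlgebra s} (ha : a ∈ A) : under A a = {a} := by
  ext x
  refine ⟨fun hx => ?_, ?_⟩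
  · obtain ⟨p, hp⟩ := x.im_nonempty
    exact hA.eq hx.1 ha hp (hx.2 hp)
  · rintro rfl
    exact ⟨ha, Subset.rfl⟩

/-- Expansions at different elements do not interact: a step at `y` grafts one node onto the tree of
the unique `a` whose image contains that of `y`, and leaves the other trees unchanged. -/
lemma IsDescendant.desc_under {A B : Set (HigmanAlgebra s)}
    (hA : Separated HigmanAlgebra.eval A) (h : IsDescendant s A B) :
    (∀ a ∈ A, Desc a (under B a)) ∧ ∀ b ∈ B, ∃ a ∈ A, b.im ⊆ a.im := by
  induction h with
  | refl =>
    refine ⟨fun a ha => ?_, fun b hb => ⟨b, hb, Subset.rfl⟩⟩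
    rw [under_eq_singleton hA ha]
    exact .refl a
  | @tail B C _ hBC ih =>
    obtain ⟨ih1, ih2⟩ := ih
    obtain ⟨i, y, hy, rfl⟩ := hBC
    constructor
    · intro a ha
      by_cases hya : y.im ⊆ a.im
      · classical
        have h1 := (ih1 a ha).trans
          (G := fun x => if x = y then {desc i 0 y, desc i 1 y} else {x}) fun x _ => by
            split_ifs with hx
            · subst hx
              exact .expansion i x
            · exact .refl x
        convert h1 using 1
        ext x
        simp only [mem_iUnion, exists_prop]
        constructor
        · rintro ⟨⟨hx, hxy⟩ | hx, hxa⟩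
          · exact ⟨x, ⟨hx, hxa⟩, by rw [if_neg (show ¬ x = y from hxy)]; rfl⟩
          · exact ⟨y, ⟨hy, hya⟩, by rw [if_pos rfl]; exact hx⟩
        · rintro ⟨z, ⟨hz, hza⟩, hx⟩
          split_ifs at hx with hzy
          · refine ⟨.inr hx, ?_⟩
            rcases hx with rfl | rfl
            · exact (im_desc_subset _ _ _).trans hya
            · exact (im_desc_subset _ _ _).trans hya
          · obtain rfl : x = z := hx
            exact ⟨.inl ⟨hz, hzy⟩, hza⟩
      · have hdis : ∀ l, ¬ (desc i l y).im ⊆ a.im := by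
          intro l hl
          obtain ⟨a', ha', hya'⟩ := ih2 y hy
          obtain ⟨p, hp⟩ := (desc i l y).im_nonempty
          have := hA.eq ha' ha (hya' (im_desc_subset _ _ _ hp)) (hl hp)
          exact hya (this ▸ hya')
        have e : under (B \ {y} ∪ {desc i 0 y, desc i 1 y}) a = under B a := by
          ext x
          constructor
          · rintro ⟨⟨hx, -⟩ | rfl | rfl, hxa⟩
            · exact ⟨hx, hxa⟩
            · exact absurd hxa (hdis 0)
            · exact absurd hxa (hdis 1)
          · rintro ⟨hx, hxa⟩
            exact ⟨.inl ⟨hx, fun h => hya (h ▸ hxa)⟩, hxa⟩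
        rw [e]
        exact ih1 a ha
    · obtain ⟨a, ha, hya⟩ := ih2 y hy
      rintro b (hb | rfl | rfl)
      · exact ih2 b hb.1
      · exact ⟨a, ha, (im_desc_subset _ _ _).trans hya⟩
      · exact ⟨a, ha, (im_desc_subset _ _ _).trans hya⟩

end Descendants
end Brin

namespace Brin
open Set Topology OmegaAlgebra

/-! ### The order on admissible sets -/

section Order

variable {s : ℕ}

open HigmanAlgebra

lemma IsAdmissibleWordSet.exists_mem_range {Z : Set (Word s)} (h : IsAdmissibleWordSet s Z) :
    ∀ c, ∃ w ∈ Z, c ∈ range w.eval := by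
  induction h with
  | refl => exact fun c => ⟨_, rfl, c, rfl⟩
  | tail _ h ih =>
    intro c
    obtain ⟨w, hw, d, rfl⟩ := ih c
    obtain ⟨i, ⟨y, hy, rfl⟩ | ⟨a, ha, b, hb, hab, rfl⟩⟩ := h
    · by_cases hwy : w = y
      · subst hwy
        have key : ∀ l, d i 0 = l → w.eval d ∈ range (desc i l w : Word s).eval := by
          rintro l rfl
          exact ⟨Cantor.tail i d, by
            change w.eval (Cantor.cons i (d i 0) (Cantor.tail i d)) = _
            rw [Cantor.cons_tail]⟩
        rcases (show d i 0 = 0 ∨ d i 0 = 1 by omega) with h | h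
        · exact ⟨_, .inr (.inl rfl), key 0 h⟩
        · exact ⟨_, .inr (.inr rfl), key 1 h⟩
      · exact ⟨w, .inl ⟨hw, hwy⟩, d, rfl⟩
    · by_cases hwa : w = a
      · subst hwa
        refine ⟨_, .inr rfl, Cantor.cons i 0 d, ?_⟩
        change (if Cantor.cons i 0 d i 0 = 0 then _ else _) = _
        simp [Cantor.cons_head, Cantor.tail_cons]
      · by_cases hwb : w = b
        · subst hwb
          refine ⟨_, .inr rfl, Cantor.cons i 1 d, ?_⟩
          change (if Cantor.cons i 1 d i 0 = 0 then _ else _) = _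
          simp [Cantor.cons_head, Cantor.tail_cons]
        · refine ⟨w, .inl ⟨hw, ?_⟩, d, rfl⟩
          rintro (h | h)
          · exact hwa h
          · exact hwb h

lemma IsAdmissible.exists_mem_im {Y : Set (HigmanAlgebra s)} (h : IsAdmissible s Y) (c : Cantor s) :
    ∃ a ∈ Y, c ∈ a.im := by
  obtain ⟨Z, hZ, rfl⟩ := h
  obtain ⟨w, hw, hc⟩ := hZ.exists_mem_range c
  exact ⟨_, mem_image_of_mem _ hw, hc⟩

lemma IsAdmissibleWordSet.injOn_theta {Z : Set (Word s)} (h : IsAdmissibleWordSet s Z) :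
    InjOn (theta s) Z := by
  intro u hu v hv e
  have := HigmanRel.eval_eq (Quotient.exact e : HigmanRel s u v)
  exact (h.separated_finite.1 u hu v hv (fun _ _ => 0) (fun _ _ => 0) (by rw [this])).1

lemma IsAdmissible.expansion {Y Z : Set (HigmanAlgebra s)} (hY : IsAdmissible s Y) {i : Fin s}
    (h : IsSimpleExpansion i Y Z) : IsAdmissible s Z := by
  obtain ⟨W, hW, rfl⟩ := hY
  obtain ⟨_, ⟨w, hw, rfl⟩, rfl⟩ := h
  refine ⟨(W \ {w}) ∪ {desc i 0 w, desc i 1 w}, hW.tail ⟨i, .inl ⟨w, hw, rfl⟩⟩, ?_⟩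
  rw [image_union, image_pair, hW.injOn_theta.image_sdiff_subset (singleton_subset_iff.2 hw),
    image_singleton]
  rfl

lemma IsAdmissible.contraction {Y Z : Set (HigmanAlgebra s)} (hY : IsAdmissible s Y) {i : Fin s}
    (h : IsSimpleContraction i Y Z) : IsAdmissible s Z := by
  obtain ⟨W, hW, rfl⟩ := hY
  obtain ⟨_, ⟨a, ha, rfl⟩, _, ⟨b, hb, rfl⟩, hab, rfl⟩ := h
  refine ⟨(W \ {a, b}) ∪ {lam i a b},
    hW.tail ⟨i, .inr ⟨a, ha, b, hb, fun h => hab (h ▸ rfl), rfl⟩⟩, ?_⟩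
  rw [image_union, image_singleton, hW.injOn_theta.image_sdiff_subset
    (insert_subset ha (singleton_subset_iff.2 hb)), image_pair]
  rfl

lemma IsAdmissible.descendant {Y Z : Set (HigmanAlgebra s)} (hY : IsAdmissible s Y)
    (h : IsDescendant s Y Z) : IsAdmissible s Z := by
  induction h with
  | refl => exact hY
  | tail _ h ih =>
    obtain ⟨i, h⟩ := h
    exact ih.expansion h

/-- The tree from `w` to `F` is undone from its leaves: the two subtrees are contracted to the
halves of `w`, and one simple contraction then joins them by `lam_desc`. -/
lemma IsAdmissible.contract {Y F : Set (HigmanAlgebra s)} {w : HigmanAlgebra s} (h : Desc w F)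
    (hw : w.Inj) (hY : IsAdmissible s Y) (hF : F ⊆ Y) : IsAdmissible s (Y \ F ∪ {w}) := by
  induction h generalizing Y with
  | refl w =>
    rw [sdiff_union_of_subset hF]
    exact hY
  | @node i w F G hF0 hG0 ih ih' =>
    have hsep := hY.separated_finite.1
    have hdis : ∀ x ∈ F, ∀ y ∈ G, x ≠ y := by
      rintro x hx _ hy rfl
      obtain ⟨p, hp⟩ := x.im_nonempty
      exact Set.disjoint_left.1 (hw.disjoint_im_desc i (by simp : (0 : Fin 2) ≠ 1))
        (hF0.im_subset x hx hp) (hG0.im_subset x hy hp)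
    have hd01 : (desc i 0 w : HigmanAlgebra s) ≠ desc i 1 w := by
      intro h
      obtain ⟨p, hp⟩ := (desc i 0 w : HigmanAlgebra s).im_nonempty
      exact Set.disjoint_left.1 (hw.disjoint_im_desc i (by simp : (0 : Fin 2) ≠ 1)) hp (h ▸ hp)
    have hnot : ∀ {u : HigmanAlgebra s} {H : Set (HigmanAlgebra s)}, Desc u H → H ⊆ Y →
        u ∈ Y → u ∈ H := by
      intro u H hH hHY hu
      obtain ⟨x, hx⟩ := hH.nonempty
      obtain ⟨p, hp⟩ := x.im_nonempty
      exact hsep.eq (hHY hx) hu hp (hH.im_subset x hx hp) ▸ hx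
    have h0G : (desc i 0 w : HigmanAlgebra s) ∉ G := fun h => by
      obtain ⟨p, hp⟩ := (desc i 0 w : HigmanAlgebra s).im_nonempty
      exact Set.disjoint_left.1 (hw.disjoint_im_desc i (by simp : (0 : Fin 2) ≠ 1)) hp
        (hG0.im_subset _ h hp)
    have h1 := ih (hw.desc i 0) hY (subset_union_left.trans hF)
    have h2 := ih' (hw.desc i 1) h1 (fun y hy =>
      .inl ⟨hF (.inr hy), fun h => hdis y h y hy rfl⟩)
    have e0 := hnot hF0 (subset_union_left.trans hF)
    have e1 := hnot hG0 (subset_union_right.trans hF)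
    have h3 := h2.contraction (i := i) ⟨desc i 0 w, .inl ⟨.inr rfl, h0G⟩, desc i 1 w, .inr rfl,
      hd01, rfl⟩
    rw [HigmanAlgebra.lam_desc] at h3
    convert h3 using 2
    ext x
    simp only [mem_sdiff, mem_union, mem_singleton_iff, mem_insert_iff]
    constructor
    · rintro ⟨hx, hxF⟩
      have hx0 : x ≠ desc i 0 w := by
        rintro rfl
        exact hxF (.inl (e0 hx))
      have hx1 : x ≠ desc i 1 w := by
        rintro rfl
        exact hxF (.inr (e1 hx))
      tauto
    · tauto

namespace AdmissibleSet

lemma separated (Z : AdmissibleSet s) : Separated HigmanAlgebra.eval Z.carrier :=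
  Z.admissible.separated_finite.1

lemma finite (Z : AdmissibleSet s) : Z.carrier.Finite := Z.admissible.separated_finite.2

lemma inj (Z : AdmissibleSet s) {z : HigmanAlgebra s} (hz : z ∈ Z.carrier) : z.Inj :=
  Z.separated.inj hz

lemma under_eq (Z : AdmissibleSet s) {z : HigmanAlgebra s} (hz : z ∈ Z.carrier) :
    under Z.carrier z = {z} := under_eq_singleton Z.separated hz

/-- Two elements of an admissible set with comparable or meeting parts coincide. -/
lemma eq_of_im_subset (Z : AdmissibleSet s) {z z' x : HigmanAlgebra s} (hz : z ∈ Z.carrier)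
    (hz' : z' ∈ Z.carrier) (h : x.im ⊆ z.im) (h' : x.im ⊆ z'.im) : z = z' := by
  obtain ⟨p, hp⟩ := x.im_nonempty
  exact Z.separated.eq hz hz' (h hp) (h' hp)

/-- The order becomes a local condition at each element of `A`. Admissible sets tile the whole
product of Cantor sets, so the pieces `under B.carrier a` together exhaust `B`. -/
lemma le_iff {A B : AdmissibleSet s} :
    A ≤ B ↔ ∀ a ∈ A.carrier, Desc a (under B.carrier a) := by
  refine ⟨fun h => (IsDescendant.desc_under A.separated h).1, fun h => ?_⟩
  have h1 := isDescendant_biUnion A.separated A.finite h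
  have e : ⋃ a ∈ A.carrier, under B.carrier a = B.carrier := by
    ext x
    simp only [mem_iUnion, exists_prop]
    constructor
    · rintro ⟨a, -, hx⟩
      exact hx.1
    · intro hx
      obtain ⟨p, hp⟩ := x.im_nonempty
      obtain ⟨a, ha, hpa⟩ := A.admissible.exists_mem_im p
      obtain ⟨y, hy, hpy⟩ := (h a ha).exists_mem_im p hpa
      exact ⟨a, ha, B.separated.eq hx hy.1 hp hpy ▸ hy⟩
  rw [e] at h1
  exact h1

lemma exists_im_subset {A B : AdmissibleSet s} (h : A ≤ B) {b : HigmanAlgebra s}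
    (hb : b ∈ B.carrier) : ∃ a ∈ A.carrier, b.im ⊆ a.im :=
  (IsDescendant.desc_under A.separated h).2 b hb

lemma card_lt_card {A B : AdmissibleSet s} (h : A < B) : A.card < B.card := by
  rcases (IsDescendant.ncard_lt_or_eq A.separated A.finite h.le).1 with e | e
  · exact absurd (AdmissibleSet.ext e) h.ne
  · exact e

lemma card_le_card {A B : AdmissibleSet s} (h : A ≤ B) : A.card ≤ B.card := by
  rcases h.eq_or_lt with rfl | h
  · exact le_rfl
  · exact (card_lt_card h).le

/-- The simple expansion of colour `i` at `z`. -/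
def expand (Z : AdmissibleSet s) {z : HigmanAlgebra s} (hz : z ∈ Z.carrier) (i : Fin s) :
    AdmissibleSet s :=
  ⟨Z.carrier \ {z} ∪ {desc i 0 z, desc i 1 z}, Z.admissible.expansion ⟨z, hz, rfl⟩⟩

lemma le_expand (Z : AdmissibleSet s) {z : HigmanAlgebra s} (hz : z ∈ Z.carrier) (i : Fin s) :
    Z ≤ Z.expand hz i := Relation.ReflTransGen.single ⟨i, z, hz, rfl⟩

lemma lt_expand (Z : AdmissibleSet s) {z : HigmanAlgebra s} (hz : z ∈ Z.carrier) (i : Fin s) :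
    Z < Z.expand hz i := by
  refine lt_of_le_of_ne (Z.le_expand hz i) fun h => ?_
  have := IsSimpleExpansion.ncard_eq Z.separated Z.finite (i := i) ⟨z, hz, rfl⟩
  have e : Z.card = (Z.expand hz i).card := by rw [← h]
  simp only [card, expand] at e
  omega

lemma desc_mem_expand (Z : AdmissibleSet s) {z : HigmanAlgebra s} (hz : z ∈ Z.carrier) (i : Fin s)
    (l : Fin 2) : desc i l z ∈ (Z.expand hz i).carrier := by
  rcases (show l = 0 ∨ l = 1 by omega) with rfl | rfl
  · exact .inr (.inl rfl)
  · exact .inr (.inr rfl)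

lemma exists_expand_le {Z X : AdmissibleSet s} (h : Z < X) :
    ∃ (z : HigmanAlgebra s) (hz : z ∈ Z.carrier) (i : Fin s), Z.expand hz i ≤ X := by
  rcases Relation.ReflTransGen.cases_head (show IsDescendant s Z.carrier X.carrier from h.le) with
    e | ⟨C, ⟨i, z, hz, rfl⟩, hC⟩
  · exact absurd (AdmissibleSet.ext e) h.ne
  · exact ⟨z, hz, i, hC⟩

lemma expand_le {Z X : AdmissibleSet s} (h : Z ≤ X) {z : HigmanAlgebra s} (hz : z ∈ Z.carrier)
    {i : Fin s} (hX : ∀ l, Desc (desc i l z) (under X.carrier (desc i l z))) :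
    Z.expand hz i ≤ X := by
  refine le_iff.2 ?_
  rintro a (ha | rfl | rfl)
  · exact le_iff.1 h a ha.1
  · exact hX 0
  · exact hX 1

lemma desc_under_of_expand_le {Z X : AdmissibleSet s} {z : HigmanAlgebra s} {hz : z ∈ Z.carrier}
    {i : Fin s} (h : Z.expand hz i ≤ X) (l : Fin 2) :
    Desc (desc i l z) (under X.carrier (desc i l z)) :=
  le_iff.1 h _ (Z.desc_mem_expand hz i l)

lemma exists_im_desc_of_expand_le {Z X : AdmissibleSet s} {z : HigmanAlgebra s}
    {hz : z ∈ Z.carrier} {i : Fin s} (h : Z.expand hz i ≤ X) {x : HigmanAlgebra s}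
    (hx : x ∈ X.carrier) (hxz : x.im ⊆ z.im) : ∃ l, x.im ⊆ (desc i l z).im := by
  obtain ⟨e, he | rfl | rfl, hxe⟩ := exists_im_subset h hx
  · exact absurd (Z.eq_of_im_subset he.1 hz hxe hxz) he.2
  · exact ⟨0, hxe⟩
  · exact ⟨1, hxe⟩

lemma desc_notMem (Z : AdmissibleSet s) {z z' : HigmanAlgebra s} (hz : z ∈ Z.carrier)
    (hz' : z' ∈ Z.carrier) (hne : z ≠ z') (i : Fin s) (l : Fin 2) : z' ≠ desc i l z := by
  rintro rfl
  exact hne (Z.eq_of_im_subset hz hz' (im_desc_subset i l z) Subset.rfl)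

/-- Two simple expansions have a least upper bound. -/
lemma exists_isLUB_expand (Z : AdmissibleSet s) {z z' : HigmanAlgebra s} (hz : z ∈ Z.carrier)
    (hz' : z' ∈ Z.carrier) (i j : Fin s) :
    ∃ D, IsLUB {Z.expand hz i, Z.expand hz' j} D := by
  have mk : ∀ {A B D : AdmissibleSet s}, A ≤ D → B ≤ D → (∀ X, A ≤ X → B ≤ X → D ≤ X) →
      IsLUB {A, B} D := by
    intro A B D h1 h2 h3
    refine ⟨?_, fun X hX => h3 X (hX (mem_insert _ _)) (hX (mem_insert_of_mem _ rfl))⟩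
    rintro _ (rfl | rfl)
    · exact h1
    · exact h2
  by_cases hzz : z = z'
  · subst hzz
    by_cases hij : i = j
    · subst hij
      exact ⟨_, mk le_rfl le_rfl fun X h _ => h⟩
    · have hinj := Z.inj hz
      have hne : ∀ k : Fin s, (desc k 0 z : HigmanAlgebra s) ≠ desc k 1 z := fun k h => by
        obtain ⟨p, hp⟩ := (desc k 0 z : HigmanAlgebra s).im_nonempty
        exact Set.disjoint_left.1 (hinj.disjoint_im_desc k (by simp : (0 : Fin 2) ≠ 1)) hp (h ▸ hp)
      have hsecond : ∀ k m : Fin s, (desc k 1 z : HigmanAlgebra s) ∈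
          ((Z.expand hz k).expand (Z.desc_mem_expand hz k 0) m).carrier := fun k m =>
        .inl ⟨Z.desc_mem_expand hz k 1, (hne k).symm⟩
      -- For two colours at the same element the join is the division into four, reached in either
      -- order.
      let D : ∀ k m : Fin s, AdmissibleSet s := fun k m =>
        ((Z.expand hz k).expand (Z.desc_mem_expand hz k 0) m).expand (hsecond k m) m
      have hD : ∀ k m : Fin s, (D k m).carrier = Z.carrier \ {z} ∪
          {desc m 0 (desc k 0 z), desc m 1 (desc k 0 z), desc m 0 (desc k 1 z),
            desc m 1 (desc k 1 z)} := by
        intro k m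
        have a0 : ∀ l l', (desc m l (desc k l' z) : HigmanAlgebra s) ≠ desc k 1 z ∨ l' = 1 := by
          intro l l'
          rcases (show l' = 0 ∨ l' = 1 by omega) with rfl | rfl
          · left
            intro h
            obtain ⟨p, hp⟩ := (desc m l (desc k 0 z) : HigmanAlgebra s).im_nonempty
            exact Set.disjoint_left.1 (hinj.disjoint_im_desc k (by simp : (0 : Fin 2) ≠ 1))
              (im_desc_subset _ _ _ hp) (h ▸ hp)
          · exact .inr rfl
        have b0 := (a0 0 0).resolve_right (by simp)
        have b1 := (a0 1 0).resolve_right (by simp)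
        have c0 : ∀ l, (desc k l z : HigmanAlgebra s) ∉ Z.carrier \ {z} := fun l h =>
          Z.desc_notMem hz h.1 (fun e => h.2 e.symm) k l rfl
        ext x
        simp only [D, expand, mem_union, mem_sdiff, mem_singleton_iff, mem_insert_iff]
        constructor
        · rintro (⟨(⟨⟨h1, h2⟩ | rfl | rfl, h3⟩ | rfl | rfl), h4⟩ | rfl | rfl)
          all_goals tauto
        · rintro (⟨h1, h2⟩ | rfl | rfl | rfl | rfl)
          · have d0 : x ≠ desc k 0 z := fun h => c0 0 (h ▸ ⟨h1, h2⟩)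
            have d1 : x ≠ desc k 1 z := fun h => c0 1 (h ▸ ⟨h1, h2⟩)
            tauto
          all_goals tauto
      have hle : ∀ k m, Z.expand hz k ≤ D k m := fun k m => (le_expand _ _ _).trans (le_expand _ _ _)
      have hsymm : D i j = D j i := by
        apply AdmissibleSet.ext
        rw [hD, hD, HigmanAlgebra.desc_comm hij, HigmanAlgebra.desc_comm hij,
          HigmanAlgebra.desc_comm hij, HigmanAlgebra.desc_comm hij]
        ext x
        simp only [mem_union, mem_insert_iff, mem_singleton_iff]
        tauto
      refine ⟨D i j, mk (hle i j) (hsymm ▸ hle j i) fun X hi hj => ?_⟩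
      -- An element of `X` lies in one half of colour `i` and in one of colour `j`, hence in one of
      -- the four pieces, so `restrict` applies.
      have key : ∀ l m, Desc (desc j m (desc i l z))
          (under X.carrier (desc j m (desc i l z))) := by
        intro l m
        have h1 := (desc_under_of_expand_le hi l).restrict (hinj.desc i l) j (by
          intro x hx
          obtain ⟨m, hm⟩ := exists_im_desc_of_expand_le hj hx.1 (hx.2.trans (im_desc_subset _ _ _))
          exact ⟨m, fun p hp => hinj.inter_im_desc hij l m ⟨hx.2 hp, hm hp⟩⟩) m
        convert h1 using 1
        ext x
        exact ⟨fun hx => ⟨⟨hx.1, hx.2.trans (im_desc_subset _ _ _)⟩, hx.2⟩,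
          fun hx => ⟨hx.1.1, hx.2⟩⟩
      exact expand_le (expand_le hi _ (key 0)) _ (key 1)
  · have h1 : z' ∈ (Z.expand hz i).carrier := .inl ⟨hz', fun h => hzz h.symm⟩
    have h2 : z ∈ (Z.expand hz' j).carrier := .inl ⟨hz, hzz⟩
    have e : (Z.expand hz i).expand h1 j = (Z.expand hz' j).expand h2 i := by
      apply AdmissibleSet.ext
      have a0 := Z.desc_notMem hz hz' hzz i 0
      have a1 := Z.desc_notMem hz hz' hzz i 1
      have b0 := Z.desc_notMem hz' hz (Ne.symm hzz) j 0
      have b1 := Z.desc_notMem hz' hz (Ne.symm hzz) j 1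
      ext x
      simp only [expand, mem_union, mem_sdiff, mem_singleton_iff, mem_insert_iff]
      constructor
      · rintro (⟨⟨h1, h2⟩ | rfl | rfl, h3⟩ | rfl | rfl)
        all_goals tauto
      · rintro (⟨⟨h1, h2⟩ | rfl | rfl, h3⟩ | rfl | rfl)
        all_goals tauto
    refine ⟨(Z.expand hz i).expand h1 j, mk (le_expand _ _ _) (e ▸ le_expand _ _ _) ?_⟩
    exact fun X hi hj => expand_le hi _ (desc_under_of_expand_le hj)

/-- Two sets above `Z` with a common upper bound have a least upper bound. -/
theorem exists_isLUB {Z A B C : AdmissibleSet s} (hZA : Z ≤ A) (hZB : Z ≤ B) (hAC : A ≤ C)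
    (hBC : B ≤ C) : ∃ D, IsLUB {A, B} D := by
  have triv : ∀ {A B : AdmissibleSet s}, A ≤ B → IsLUB {A, B} B := by
    intro A B h
    refine ⟨?_, fun X hX => hX (mem_insert_of_mem _ rfl)⟩
    rintro _ (rfl | rfl)
    · exact h
    · exact le_rfl
  induction hn : C.card - Z.card using Nat.strong_induction_on generalizing Z A B with
  | _ n ih =>
    subst hn
    rcases hZA.eq_or_lt with rfl | hZA'
    · exact ⟨B, triv hZB⟩
    rcases hZB.eq_or_lt with rfl | hZB'
    · rw [Set.pair_comm]
      exact ⟨A, triv hZA⟩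
    obtain ⟨z, hz, i, hA⟩ := exists_expand_le hZA'
    obtain ⟨z', hz', j, hB⟩ := exists_expand_le hZB'
    obtain ⟨D, hD⟩ := Z.exists_isLUB_expand hz hz' i j
    have lt : ∀ {W : AdmissibleSet s}, Z < W → W ≤ C → C.card - W.card < C.card - Z.card := by
      intro W h1 h2
      have := card_lt_card h1
      have := card_le_card h2
      omega
    have h1 : Z.expand hz i ≤ D := hD.1 (mem_insert _ _)
    have h2 : Z.expand hz' j ≤ D := hD.1 (mem_insert_of_mem _ rfl)
    have least : ∀ X, Z.expand hz i ≤ X → Z.expand hz' j ≤ X → D ≤ X := by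
      intro X hX1 hX2
      refine hD.2 ?_
      rintro _ (rfl | rfl)
      · exact hX1
      · exact hX2
    have h3 : D ≤ C := least C (hA.trans hAC) (hB.trans hBC)
    have lubC : ∀ {P Q R : AdmissibleSet s}, IsLUB {P, Q} R → P ≤ C → Q ≤ C → R ≤ C := by
      intro P Q R hR hP hQ
      refine hR.2 ?_
      rintro _ (rfl | rfl)
      · exact hP
      · exact hQ
    have l1 := Z.lt_expand hz i
    have l2 := Z.lt_expand hz' j
    -- Diamond argument: with `D` the join of the two first steps, form the joins of `A` with `D`
    -- and of `B` with `D`, then join these above `D`. Each call starts from a base strictly closer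
    -- to `C`.
    obtain ⟨A', hA'⟩ := ih _ (lt l1 (hA.trans hAC)) hA h1 hAC h3 rfl
    obtain ⟨B', hB'⟩ := ih _ (lt l2 (hB.trans hBC)) hB h2 hBC h3 rfl
    obtain ⟨R, hR⟩ := ih _ (lt (l1.trans_le h1) h3) (hA'.1 (mem_insert_of_mem _ rfl))
      (hB'.1 (mem_insert_of_mem _ rfl)) (lubC hA' hAC h3) (lubC hB' hBC h3) rfl
    refine ⟨R, ?_, ?_⟩
    · rintro _ (rfl | rfl)
      · exact (hA'.1 (mem_insert _ _)).trans (hR.1 (mem_insert _ _))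
      · exact (hB'.1 (mem_insert _ _)).trans (hR.1 (mem_insert_of_mem _ rfl))
    · intro X hX
      have x1 : A ≤ X := hX (mem_insert _ _)
      have x2 : B ≤ X := hX (mem_insert_of_mem _ rfl)
      have x3 : D ≤ X := least X (hA.trans x1) (hB.trans x2)
      refine hR.2 ?_
      rintro _ (rfl | rfl)
      · refine hA'.2 ?_
        rintro _ (rfl | rfl)
        · exact x1
        · exact x3
      · refine hB'.2 ?_
        rintro _ (rfl | rfl)
        · exact x2
        · exact x3

/-- Anything strictly below `Y` lies below some `W` that expands to `Y` in one step, and such a `W`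
is determined by a colour and a pair of elements of `Y`. -/
theorem finite_Iic (Y : AdmissibleSet s) : (Iic Y).Finite := by
  induction hn : Y.card using Nat.strong_induction_on generalizing Y with
  | _ n ih =>
    subst hn
    let C : Set (AdmissibleSet s) := {W | W < Y ∧ ∃ (i : Fin s), ∃ a ∈ Y.carrier, ∃ b ∈ Y.carrier,
      W.carrier = Y.carrier \ {a, b} ∪ {lam i a b}}
    have hC : C.Finite := by
      have hinj : InjOn AdmissibleSet.carrier C := fun A _ B _ h => AdmissibleSet.ext h
      refine Set.Finite.of_finite_image (Set.Finite.subset (((finite_univ (α := Fin s)).prod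
        (Y.finite.prod Y.finite)).image fun p : Fin s × _ × _ =>
          Y.carrier \ {p.2.1, p.2.2} ∪ {lam p.1 p.2.1 p.2.2}) ?_) hinj
      rintro _ ⟨W, ⟨-, i, a, ha, b, hb, e⟩, rfl⟩
      exact ⟨(i, a, b), ⟨mem_univ _, ha, hb⟩, e.symm⟩
    refine ((finite_singleton Y).union (hC.biUnion fun W hW =>
      ih _ (card_lt_card hW.1) W rfl)).subset ?_
    intro U hU
    rcases Relation.ReflTransGen.cases_tail
      (show IsDescendant s U.carrier Y.carrier from hU) with e | ⟨V, hUV, i, w, hw, e⟩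
    · exact .inl (AdmissibleSet.ext e.symm)
    · right
      let W : AdmissibleSet s := ⟨V, U.admissible.descendant hUV⟩
      have hWY : Y = W.expand hw i := AdmissibleSet.ext e
      refine mem_iUnion₂.2 ⟨W, ⟨?_, i, desc i 0 w, ?_, desc i 1 w, ?_, ?_⟩, hUV⟩
      · rw [hWY]
        exact W.lt_expand hw i
      · rw [hWY]
        exact W.desc_mem_expand hw i 0
      · rw [hWY]
        exact W.desc_mem_expand hw i 1
      · rw [HigmanAlgebra.lam_desc, e]
        have c0 : ∀ l x, x ∈ V \ {w} → x ≠ desc i l w := fun l x h =>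
          W.desc_notMem hw h.1 (fun e => h.2 e.symm) i l
        ext x
        by_cases hxw : x = w
        · simp [hxw, W, hw]
        · have := c0 0 x
          have := c0 1 x
          simp only [W, mem_union, mem_sdiff, mem_singleton_iff, mem_insert_iff] at *
          tauto

end AdmissibleSet

end Order
end Brin

namespace Brin
open Set Topology OmegaAlgebra

section Elementary

variable {s : ℕ}

open HigmanAlgebra

namespace AdmissibleSet

/-! ### Expanding all elements -/

lemma desc_pair (i : Fin s) (l : Fin 2) (z : HigmanAlgebra s) :
    (desc i l z : HigmanAlgebra s) ∈ ({desc i 0 z, desc i 1 z} : Set (HigmanAlgebra s)) := by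
  rcases (show l = 0 ∨ l = 1 by omega) with rfl | rfl
  · exact .inl rfl
  · exact .inr rfl

/-- The expansion of colour `i` of all elements. -/
def expandAll (Z : AdmissibleSet s) (i : Fin s) : AdmissibleSet s :=
  ⟨⋃ z ∈ Z.carrier, {desc i 0 z, desc i 1 z}, Z.admissible.descendant
    (isDescendant_biUnion Z.separated Z.finite fun z _ => .expansion i z)⟩

lemma mem_expandAll {Z : AdmissibleSet s} {i : Fin s} {x : HigmanAlgebra s} :
    x ∈ (Z.expandAll i).carrier ↔ ∃ z ∈ Z.carrier, ∃ l, x = desc i l z := by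
  simp only [expandAll, mem_iUnion, exists_prop]
  refine exists_congr fun z => and_congr_right fun _ => ⟨?_, ?_⟩
  · rintro (h | h)
    · exact ⟨0, h⟩
    · exact ⟨1, h⟩
  · rintro ⟨l, rfl⟩
    exact desc_pair i l z

lemma le_expandAll (Z : AdmissibleSet s) (i : Fin s) : Z ≤ Z.expandAll i :=
  isDescendant_biUnion Z.separated Z.finite fun z _ => .expansion i z

/-- After expansion in colour `i`, the tree below `z` refines the division of `z` in colour `i`, so
it restricts to trees below the two halves. -/
lemma expandAll_mono {Z Z' : AdmissibleSet s} (h : Z ≤ Z') (i : Fin s) :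
    Z.expandAll i ≤ Z'.expandAll i := by
  refine le_iff.2 fun a ha => ?_
  obtain ⟨z, hz, l, rfl⟩ := mem_expandAll.1 ha
  have h1 := le_iff.1 h z hz
  have h2 := (h1.trans (G := fun x => {desc i 0 x, desc i 1 x})
    fun x _ => .expansion i x).restrict (Z.inj hz) i (by
      intro y hy
      obtain ⟨x, hx, hyx⟩ := mem_iUnion₂.1 hy
      rcases hyx with rfl | rfl
      · exact h1.exists_im_desc_subset i x hx 0
      · exact h1.exists_im_desc_subset i x hx 1) l
  convert h2 using 1
  ext y
  constructor
  · rintro ⟨hy, hyz⟩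
    obtain ⟨x, hx, m, rfl⟩ := mem_expandAll.1 hy
    obtain ⟨z', hz', hxz'⟩ := exists_im_subset h hx
    have e := Z.eq_of_im_subset hz' hz ((im_desc_subset i m x).trans hxz')
      (hyz.trans (im_desc_subset _ _ _))
    exact ⟨mem_iUnion₂.2 ⟨x, ⟨hx, e ▸ hxz'⟩, desc_pair i m x⟩, hyz⟩
  · rintro ⟨hy, hyz⟩
    obtain ⟨x, hx, hyx⟩ := mem_iUnion₂.1 hy
    refine ⟨mem_expandAll.2 ⟨x, hx.1, ?_⟩, hyz⟩
    rcases hyx with rfl | rfl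
    · exact ⟨0, rfl⟩
    · exact ⟨1, rfl⟩

lemma expand_le_expandAll (Z : AdmissibleSet s) {z : HigmanAlgebra s} (hz : z ∈ Z.carrier)
    (i : Fin s) : Z.expand hz i ≤ Z.expandAll i := by
  refine expand_le (Z.le_expandAll i) hz fun l => ?_
  rw [under_eq _ (mem_expandAll.2 ⟨z, hz, l, rfl⟩)]
  exact .refl _

/-! ### Contractions -/

lemma under_of_desc (V : AdmissibleSet s) {w : HigmanAlgebra s} {F : Set (HigmanAlgebra s)}
    (hF : Desc w F) (hFV : F ⊆ V.carrier) : under V.carrier w = F := by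
  ext x
  refine ⟨fun hx => ?_, fun hx => ⟨hFV hx, hF.im_subset x hx⟩⟩
  obtain ⟨p, hp⟩ := x.im_nonempty
  obtain ⟨y, hy, hpy⟩ := hF.exists_mem_im p (hx.2 hp)
  exact V.separated.eq hx.1 (hFV hy) hp hpy ▸ hy

/-- The elements of `F` are contracted to `w`. -/
def contract (V : AdmissibleSet s) {w : HigmanAlgebra s} {F : Set (HigmanAlgebra s)}
    (hF : Desc w F) (hw : w.Inj) (hFV : F ⊆ V.carrier) : AdmissibleSet s :=
  ⟨V.carrier \ F ∪ {w}, V.admissible.contract hF hw hFV⟩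

section Contract

variable {V : AdmissibleSet s} {w : HigmanAlgebra s} {F : Set (HigmanAlgebra s)} {hF : Desc w F}
  {hw : w.Inj} {hFV : F ⊆ V.carrier}

lemma mem_contract : w ∈ (V.contract hF hw hFV).carrier := .inr rfl

lemma mem_contract_of_mem {v : HigmanAlgebra s} (hv : v ∈ V.carrier) (hvF : v ∉ F) :
    v ∈ (V.contract hF hw hFV).carrier := .inl ⟨hv, hvF⟩

lemma contract_le (X : AdmissibleSet s) (hVX : V ≤ X) (h : Desc w (under X.carrier w)) :
    V.contract hF hw hFV ≤ X := by
  refine le_iff.2 ?_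
  rintro a (ha | rfl)
  · exact le_iff.1 hVX a ha.1
  · exact h

lemma contract_le_self : V.contract hF hw hFV ≤ V :=
  contract_le V le_rfl (by rwa [under_of_desc V hF hFV])

lemma disjoint_im_of_notMem {v : HigmanAlgebra s} (hFV : F ⊆ V.carrier) (hF : Desc w F)
    (hv : v ∈ V.carrier) (hvF : v ∉ F) : Disjoint v.im w.im := by
  rw [Set.disjoint_left]
  intro p hp hpw
  obtain ⟨y, hy, hpy⟩ := hF.exists_mem_im p hpw
  exact hvF (V.separated.eq hv (hFV hy) hp hpy ▸ hy)

lemma under_contract {a : HigmanAlgebra s} (ha : Disjoint a.im w.im) :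
    under (V.contract hF hw hFV).carrier a = under V.carrier a := by
  ext x
  constructor
  · rintro ⟨hx | rfl, hxa⟩
    · exact ⟨hx.1, hxa⟩
    · obtain ⟨p, hp⟩ := x.im_nonempty
      exact absurd hp (Set.disjoint_left.1 ha (hxa hp))
  · rintro ⟨hx, hxa⟩
    refine ⟨.inl ⟨hx, fun hxF => ?_⟩, hxa⟩
    obtain ⟨p, hp⟩ := x.im_nonempty
    exact Set.disjoint_left.1 ha (hxa hp) (hF.im_subset x hxF hp)

lemma contract_mono {V' : AdmissibleSet s} {hFV' : F ⊆ V'.carrier} (h : V ≤ V') :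
    V.contract hF hw hFV ≤ V'.contract hF hw hFV' := by
  refine le_iff.2 ?_
  rintro a (ha | rfl)
  · rw [under_contract (disjoint_im_of_notMem hFV hF ha.1 ha.2)]
    exact le_iff.1 h a ha.1
  · rw [under_eq _ mem_contract]
    exact .refl _

lemma le_contract {W : AdmissibleSet s} (h : W ≤ V) (hwW : w ∈ W.carrier) :
    W ≤ V.contract hF hw hFV := by
  refine le_iff.2 fun a ha => ?_
  by_cases haw : a = w
  · subst haw
    rw [under_eq _ mem_contract]
    exact .refl _
  · rw [under_contract]
    · exact le_iff.1 h a ha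
    · rw [Set.disjoint_left]
      exact fun p hp hp' => haw (W.separated.eq ha hwW hp hp')

end Contract

/-! ### Elementary expansions of sets on three colours -/

/-- The expansion of all elements in all three colours. -/
def full (Z : AdmissibleSet 3) : AdmissibleSet 3 := ((Z.expandAll 2).expandAll 1).expandAll 0

/-- The elements of the expansion of `z` in all three colours. -/
def corner (z : HigmanAlgebra 3) (p : Fin 2 × Fin 2 × Fin 2) : HigmanAlgebra 3 :=
  desc (0 : Fin 3) p.1 (desc (1 : Fin 3) p.2.1 (desc (2 : Fin 3) p.2.2 z))

lemma mem_full {Z : AdmissibleSet 3} {x : HigmanAlgebra 3} :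
    x ∈ Z.full.carrier ↔ ∃ z ∈ Z.carrier, ∃ p, x = corner z p := by
  constructor
  · intro hx
    obtain ⟨_, h, a, rfl⟩ := mem_expandAll.1 hx
    obtain ⟨_, h', b, rfl⟩ := mem_expandAll.1 h
    obtain ⟨z, hz, c, rfl⟩ := mem_expandAll.1 h'
    exact ⟨z, hz, (a, b, c), rfl⟩
  · rintro ⟨z, hz, p, rfl⟩
    exact mem_expandAll.2 ⟨_, mem_expandAll.2 ⟨_, mem_expandAll.2 ⟨z, hz, _, rfl⟩, _, rfl⟩, _, rfl⟩

lemma im_corner_subset (z : HigmanAlgebra 3) (p : Fin 2 × Fin 2 × Fin 2) :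
    (corner z p).im ⊆ z.im :=
  (im_desc_subset _ _ _).trans ((im_desc_subset _ _ _).trans (im_desc_subset _ _ _))

lemma full_mono {Z Z' : AdmissibleSet 3} (h : Z ≤ Z') : Z.full ≤ Z'.full :=
  expandAll_mono (expandAll_mono (expandAll_mono h 2) 1) 0

lemma le_full (Z : AdmissibleSet 3) : Z ≤ Z.full :=
  (Z.le_expandAll 2).trans ((le_expandAll _ 1).trans (le_expandAll _ 0))

/-- Monotonicity of `expandAll` replaces a reordering of the three colours. -/
lemma expand_le_full (Z : AdmissibleSet 3) {z : HigmanAlgebra 3} (hz : z ∈ Z.carrier)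
    (i : Fin 3) : Z.expand hz i ≤ Z.full := by
  refine (Z.expand_le_expandAll hz i).trans ?_
  have h2 := Z.le_expandAll 2
  have h1 := (Z.expandAll 2).le_expandAll 1
  fin_cases i
  · exact expandAll_mono (h2.trans h1) 0
  · exact (expandAll_mono h2 1).trans (le_expandAll _ 0)
  · exact h1.trans (le_expandAll _ 0)

lemma mem_full_of_im_subset {P : AdmissibleSet 3} {x p : HigmanAlgebra 3}
    (hx : x ∈ P.full.carrier) (hp : p ∈ P.carrier) (hxp : x.im ⊆ p.im) : ∃ q, x = corner p q := by
  obtain ⟨z, hz, q, rfl⟩ := mem_full.1 hx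
  rw [P.eq_of_im_subset hz hp (im_corner_subset z q) hxp]
  exact ⟨q, rfl⟩

/-- The part of a full expansion below `p` depends on `p` only; being elementary can therefore be
checked element by element. -/
lemma under_full_eq {P Q : AdmissibleSet 3} {y p : HigmanAlgebra 3} (hP : p ∈ P.carrier)
    (hQ : p ∈ Q.carrier) (hyp : y.im ⊆ p.im) :
    under P.full.carrier y = under Q.full.carrier y := by
  ext x
  constructor
  · rintro ⟨hx, hxy⟩
    obtain ⟨q, rfl⟩ := mem_full_of_im_subset hx hP (hxy.trans hyp)
    exact ⟨mem_full.2 ⟨p, hQ, q, rfl⟩, hxy⟩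
  · rintro ⟨hx, hxy⟩
    obtain ⟨q, rfl⟩ := mem_full_of_im_subset hx hQ (hxy.trans hyp)
    exact ⟨mem_full.2 ⟨p, hP, q, rfl⟩, hxy⟩

/-- Each element of `Y` below `w` contains one of the `2 ^ 3` corners of `w`, and different elements
contain different corners. -/
lemma ncard_under_le {W Y : AdmissibleSet 3} (hY : Y ≤ W.full) {w : HigmanAlgebra 3}
    (hw : w ∈ W.carrier) : (under Y.carrier w).ncard ≤ 8 := by
  have h1 : ∀ y ∈ under Y.carrier w, ∃ q, (corner w q).im ⊆ y.im := by
    intro y hy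
    obtain ⟨x, hx⟩ := (le_iff.1 hY y hy.1).nonempty
    obtain ⟨q, rfl⟩ := mem_full_of_im_subset hx.1 hw (hx.2.trans hy.2)
    exact ⟨q, hx.2⟩
  choose! q hq using h1
  have h2 := ncard_le_ncard_of_injOn (s := under Y.carrier w)
    (t := (univ : Set (Fin 2 × Fin 2 × Fin 2))) q (fun _ _ => mem_univ _) (by
      intro y hy y' hy' e
      have := hq y' hy'
      rw [← e] at this
      exact Y.eq_of_im_subset hy.1 hy'.1 (hq y hy) this) finite_univ
  rwa [ncard_univ, Nat.card_eq_fintype_card, Fintype.card_prod, Fintype.card_prod,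
    Fintype.card_fin] at h2

/-- The largest elementary expansion of `Z` below `V`. -/
lemma exists_core {Z V : AdmissibleSet 3} (h : Z ≤ V) :
    ∃ C, IsGreatest {U | Z ≤ U ∧ U ≤ V ∧ U ≤ Z.full} C := by
  obtain ⟨C, hC, hmax⟩ := exists_max_image {U | Z ≤ U ∧ U ≤ V ∧ U ≤ Z.full} card
    (V.finite_Iic.subset fun U hU => hU.2.1) ⟨Z, le_rfl, h, Z.le_full⟩
  refine ⟨C, hC, fun U hU => ?_⟩
  -- The join with a candidate of maximal cardinality is again a candidate, hence equal to it.
  obtain ⟨D, hD⟩ := exists_isLUB hC.1 hU.1 hC.2.1 hU.2.1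
  have hCD : C ≤ D := hD.1 (mem_insert _ _)
  have hUD : U ≤ D := hD.1 (mem_insert_of_mem _ rfl)
  have hDV : D ≤ V := hD.2 (by rintro _ (rfl | rfl); exacts [hC.2.1, hU.2.1])
  have hDF : D ≤ Z.full := hD.2 (by rintro _ (rfl | rfl); exacts [hC.2.2, hU.2.2])
  have h1 := hmax D ⟨hC.1.trans hCD, hDV, hDF⟩
  rcases hCD.eq_or_lt with rfl | hlt
  · exact hUD
  · have := card_lt_card hlt
    omega

noncomputable instance (Y : AdmissibleSet s) : Fintype Y.K :=
  have : Finite Y.K := (Y.finite_Iic.subset fun _ (hZ : _ < Y) => hZ.le).to_subtype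
  Fintype.ofFinite _

/-- The elements of `K_Y` from which `Y` is obtained by an elementary expansion. -/
def elementary (Y : AdmissibleSet 3) : Set Y.K := {W | Y ≤ W.1.full}

lemma elementary_of_le {Y : AdmissibleSet 3} {V W : Y.K} (hV : V ∈ Y.elementary) (h : V ≤ W) :
    W ∈ Y.elementary :=
  le_trans (α := AdmissibleSet 3) hV (full_mono h)

/-- The conical contraction `V ≥ core V ≤ core Y`. It stays strictly above `Z` because any `V > Z`
contains a simple expansion of `Z`, which is elementary; it stays strictly below `Y` because `core Y
= Y` would make `Z` elementary. -/
lemma nullIn_of_notMem_elementary {Y : AdmissibleSet 3} {Z : Y.K} (hZ : Z ∉ Y.elementary) :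
    NullIn (Geom {V | Z < V}) (Geom {V | Z < V}) := by
  have hcore : ∀ V : AdmissibleSet 3, Z.1 ≤ V → ∃ C,
      IsGreatest {U | Z.1 ≤ U ∧ U ≤ V ∧ U ≤ Z.1.full} C := fun V h => exists_core h
  choose! core hc using hcore
  have hlt : ∀ V, Z.1 < V → Z.1 < core V := by
    intro V hV
    obtain ⟨z, hz, i, h⟩ := exists_expand_le hV
    exact (Z.1.lt_expand hz i).trans_le
      ((hc V hV.le).2 ⟨Z.1.le_expand hz i, h, Z.1.expand_le_full hz i⟩)
  have hY : core Y < Y := by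
    refine lt_of_le_of_ne (hc Y Z.2.le).1.2.1 fun h => hZ ?_
    have := (hc Y Z.2.le).1.2.2
    rw [h] at this
    exact this
  have hmono : ∀ V V', Z.1 ≤ V → V ≤ V' → core V ≤ core V' := fun V V' h h' =>
    (hc V' (h.trans h')).2 ⟨(hc V h).1.1, (hc V h).1.2.1.trans h', (hc V h).1.2.2⟩
  classical
  let c : Y.K → Y.K := fun V => if h : Z < V then
    ⟨core V.1, lt_of_le_of_lt (hc V.1 h.le).1.2.1 V.2⟩ else V
  have hcdef : ∀ V, Z < V → (c V).1 = core V.1 := fun V h => by simp only [c, h, dif_pos]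
  refine nullIn_of_conical (h := c) (m := ⟨core Y, hY⟩) Subset.rfl ?_ ?_ ?_ (hlt Y Z.2) ?_
  · intro V hV V' hV' h
    change (c V).1 ≤ (c V').1
    rw [hcdef V hV, hcdef V' hV']
    exact hmono _ _ (le_of_lt (α := Y.K) hV) h
  · intro V hV
    change (c V).1 ≤ V.1
    rw [hcdef V hV]
    exact (hc V.1 (le_of_lt (α := Y.K) hV)).1.2.1
  · intro V hV
    change Z.1 < (c V).1
    rw [hcdef V hV]
    exact hlt _ hV
  · intro V hV
    change (c V).1 ≤ core Y
    rw [hcdef V hV]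
    exact hmono _ _ (le_of_lt (α := Y.K) hV) V.2.le

/-! ### Supports -/

open Classical in
/-- The elements of `Y` that are contracted in an element of `K_Y`. -/
noncomputable def supp {Y : AdmissibleSet s} (V : Y.K) : Finset (HigmanAlgebra s) :=
  Y.finite.toFinset.filter fun y => y ∉ V.1.carrier

lemma mem_supp {Y : AdmissibleSet s} {V : Y.K} {y : HigmanAlgebra s} :
    y ∈ supp V ↔ y ∈ Y.carrier ∧ y ∉ V.1.carrier := by
  simp [supp]

/-! ### Conical contractions by contracting elements of `Y` -/

section

variable {Y : AdmissibleSet 3} {w : HigmanAlgebra 3} {F : Set (HigmanAlgebra 3)} {hF : Desc w F}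
  {hw : w.Inj} {hFY : F ⊆ Y.carrier}

open Classical in
-- If `F` misses `T`, every `V` with support in `T` contains `F`, and contracting `F` to `w` is
-- monotone. This gives the cone `V ≥ V/F ≤ Y/F`; `w ∉ Y` makes its apex strictly smaller than `Y`.
lemma nullIn_of_contract {S : Set Y.K} {T : Finset (HigmanAlgebra 3)} (hwY : w ∉ Y.carrier)
    (hF : Desc w F) (hw : w.Inj) (hFY : F ⊆ Y.carrier) (hFT : ∀ y ∈ F, y ∉ T)
    (hS : ∀ V : Y.K, V ∈ S → supp V ⊆ T) {S' : Set Y.K} (hSS' : S ⊆ S')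
    (hmem : ∀ (V : Y.K) (hFV : F ⊆ V.1.carrier) (C : Y.K), C.1 = V.1.contract hF hw hFV → V ∈ S →
      C ∈ S') (hmemY : ∀ C : Y.K, C.1 = Y.contract hF hw hFY → C ∈ S') :
    NullIn (Geom S) (Geom S') := by
  have hFV : ∀ V ∈ S, F ⊆ V.1.carrier := by
    intro V hV y hy
    by_contra hyV
    exact hFT y hy (hS V hV (mem_supp.2 ⟨hFY hy, hyV⟩))
  have hlt : Y.contract hF hw hFY < Y := lt_of_le_of_ne contract_le_self fun h =>
    hwY (h ▸ mem_contract)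
  let m : Y.K := ⟨_, hlt⟩
  let c : Y.K → Y.K := fun V => if h : F ⊆ V.1.carrier then
    ⟨V.1.contract hF hw h, contract_le_self.trans_lt V.2⟩ else V
  have hc : ∀ V (hV : V ∈ S), (c V).1 = V.1.contract hF hw (hFV V hV) := fun V hV => by
    simp only [c, hFV V hV, dif_pos]
  refine nullIn_of_conical (h := c) (m := m) hSS' ?_ ?_ ?_ (hmemY m rfl) ?_
  · intro V hV V' hV' h
    change (c V).1 ≤ (c V').1
    rw [hc V hV, hc V' hV']
    exact contract_mono h
  · intro V hV
    change (c V).1 ≤ V.1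
    rw [hc V hV]
    exact contract_le_self
  · exact fun V hV => hmem V (hFV V hV) _ (hc V hV) hV
  · intro V hV
    change (c V).1 ≤ Y.contract hF hw hFY
    rw [hc V hV]
    exact contract_mono V.2.le

open Classical in
lemma supp_contract_subset {V C : Y.K} {hFV : F ⊆ V.1.carrier} (hFfin : F.Finite)
    (h : C.1 = V.1.contract hF hw hFV) : supp C ⊆ supp V ∪ hFfin.toFinset := by
  intro y hy
  obtain ⟨hyY, hyC⟩ := mem_supp.1 hy
  rw [Finset.mem_union, Set.Finite.mem_toFinset]
  by_contra! hcon
  have hyV : y ∈ V.1.carrier := by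
    by_contra hyV
    exact hcon.1 (mem_supp.2 ⟨hyY, hyV⟩)
  rw [h] at hyC
  exact hyC (mem_contract_of_mem hyV hcon.2)

lemma supp_contract_self_subset {C : Y.K} (hFfin : F.Finite)
    (h : C.1 = Y.contract hF hw hFY) : supp C ⊆ hFfin.toFinset := by
  intro y hy
  obtain ⟨hyY, hyC⟩ := mem_supp.1 hy
  rw [Set.Finite.mem_toFinset]
  by_contra hcon
  rw [h] at hyC
  exact hyC (mem_contract_of_mem hyY hcon)

end

/-- The cone must remain above `W`, so the only contractions used are those to elements of `W`;
`elementary_of_le` then keeps everything elementary. The bound `9|T| + 8` covers both cases, which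
need `|T| + 8` and `9|T|`. -/
theorem exists_nullIn_above {Y : AdmissibleSet 3} {W : Y.K} (hW : W ∈ Y.elementary)
    (T : Finset (HigmanAlgebra 3)) : ∃ T', T ⊆ T' ∧ T'.card ≤ 9 * T.card + 8 ∧
      NullIn (Geom {V | V ∈ Y.elementary ∧ supp V ⊆ T ∧ W ≤ V})
        (Geom {V | V ∈ Y.elementary ∧ supp V ⊆ T' ∧ W ≤ V}) := by
  classical
  have hWY : W.1 ≤ Y := W.2.le
  have hfin : ∀ w, (under Y.carrier w).Finite := fun w => Y.finite.subset fun _ h => h.1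
  have hcard : ∀ w ∈ W.1.carrier, (hfin w).toFinset.card ≤ 8 := fun w hw => by
    rw [← ncard_eq_toFinset_card _ (hfin w)]
    exact ncard_under_le hW hw
  by_cases hcase : ∃ w ∈ W.1.carrier, w ∉ Y.carrier ∧ ∀ y ∈ under Y.carrier w, y ∉ T
  · obtain ⟨w, hw, hwY, hdis⟩ := hcase
    have hF := le_iff.1 hWY w hw
    refine ⟨T ∪ (hfin w).toFinset, Finset.subset_union_left, ?_, ?_⟩
    · have := Finset.card_union_le T (hfin w).toFinset
      have := hcard w hw
      omega
    · refine nullIn_of_contract hwY hF (W.1.inj hw) (fun _ h => h.1) hdis (fun V hV => hV.2.1)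
        (fun V hV => ⟨hV.1, hV.2.1.trans Finset.subset_union_left, hV.2.2⟩) ?_ ?_
      · intro V hFV C hC hV
        have hWC : W ≤ C := by
          change W.1 ≤ C.1
          rw [hC]
          exact le_contract hV.2.2 hw
        refine ⟨elementary_of_le hW hWC, ?_, hWC⟩
        exact (supp_contract_subset (hfin w) hC).trans
          (Finset.union_subset_union hV.2.1 subset_rfl)
      · intro C hC
        have hWC : W ≤ C := by
          change W.1 ≤ C.1
          rw [hC]
          exact le_contract hWY hw
        exact ⟨elementary_of_le hW hWC,
          (supp_contract_self_subset (hfin w) hC).trans Finset.subset_union_right, hWC⟩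
  -- Now every element of `W` that is properly expanded in `Y` lies above some element of `T`, so
  -- `supp W` is covered by at most `|T|` blocks of size at most 8, and `W` is an admissible cone
  -- point.
  · push Not at hcase
    have : Nonempty (HigmanAlgebra 3) := ⟨theta 3 .base⟩
    have htop : ∀ y ∈ Y.carrier, ∃ w ∈ W.1.carrier, y.im ⊆ w.im := fun y hy =>
      exists_im_subset hWY hy
    choose! top htop1 htop2 using htop
    refine ⟨T ∪ supp W, Finset.subset_union_left, ?_, ?_⟩
    · have h1 : supp W ⊆ (T.filter (· ∈ Y.carrier)).biUnion fun t => (hfin (top t)).toFinset := by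
        intro y hy
        obtain ⟨hyY, hyW⟩ := mem_supp.1 hy
        have h2 : top y ∉ Y.carrier := fun h => by
          have := Y.eq_of_im_subset hyY h Subset.rfl (htop2 y hyY)
          exact hyW (this ▸ htop1 y hyY)
        obtain ⟨t, ht, htT⟩ := hcase _ (htop1 y hyY) h2
        refine Finset.mem_biUnion.2 ⟨t, Finset.mem_filter.2 ⟨htT, ht.1⟩, ?_⟩
        rw [Set.Finite.mem_toFinset,
          W.1.eq_of_im_subset (htop1 t ht.1) (htop1 y hyY) (htop2 t ht.1) ht.2]
        exact ⟨hyY, htop2 y hyY⟩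
      have h3 := (Finset.card_le_card h1).trans (Finset.card_biUnion_le_card_mul _ _ 8 fun t ht =>
        hcard _ (htop1 t (Finset.mem_filter.1 ht).2))
      have h4 := Finset.card_filter_le T (· ∈ Y.carrier)
      have h5 := Finset.card_union_le T (supp W)
      omega
    · exact nullIn_of_isLeast (m := W)
        (fun V hV => ⟨hV.1, hV.2.1.trans Finset.subset_union_left, hV.2.2⟩)
        ⟨hW, Finset.subset_union_right, le_rfl⟩ fun V hV => hV.2.2

/-- Two elements of `Y` outside `T` are contracted in colour 0; the choice of colour is immaterial.
Contracting them in an elementary `V` leaves it elementary, because no element of `Y` other than `a`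
and `b` is affected. -/
theorem exists_nullIn {Y : AdmissibleSet 3} (T : Finset (HigmanAlgebra 3))
    (hT : T.card + 2 ≤ Y.card) : ∃ T', T ⊆ T' ∧ T'.card ≤ 9 * T.card + 8 ∧
      NullIn (Geom {V : Y.K | V ∈ Y.elementary ∧ supp V ⊆ T})
        (Geom {V : Y.K | V ∈ Y.elementary ∧ supp V ⊆ T'}) := by
  classical
  have hY : Y.card = Y.finite.toFinset.card := ncard_eq_toFinset_card _ Y.finite
  obtain ⟨a, ha, b, hb, hab⟩ : ∃ a ∈ Y.finite.toFinset \ T, ∃ b ∈ Y.finite.toFinset \ T, a ≠ b := by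
    have : 1 < (Y.finite.toFinset \ T).card := by
      have := Finset.le_card_sdiff T Y.finite.toFinset
      omega
    exact Finset.one_lt_card.1 this
  rw [Finset.mem_sdiff, Set.Finite.mem_toFinset] at ha hb
  let w : HigmanAlgebra 3 := lam (0 : Fin 3) a b
  have hd0 : desc (0 : Fin 3) 0 w = a := desc_zero_lam _ _ _
  have hd1 : desc (0 : Fin 3) 1 w = b := desc_one_lam _ _ _
  have hF : Desc w {a, b} := by
    have := Desc.expansion (0 : Fin 3) w
    rwa [hd0, hd1] at this
  have hFY : {a, b} ⊆ Y.carrier := insert_subset ha.1 (singleton_subset_iff.2 hb.1)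
  have hw : w.Inj := by
    refine inj_of_separated (i := 0) ?_ ?_
    · rw [hd0, hd1]
      exact Y.separated.mono hFY
    · rwa [hd0, hd1]
  have hwY : w ∉ Y.carrier := by
    intro h
    have h1 := Y.eq_of_im_subset ha.1 h Subset.rfl (hF.im_subset a (.inl rfl))
    have h2 := Y.eq_of_im_subset hb.1 h Subset.rfl (hF.im_subset b (.inr rfl))
    exact hab (h1.trans h2.symm)
  have hfin : ({a, b} : Set (HigmanAlgebra 3)).Finite := toFinite _
  have hcard : hfin.toFinset.card ≤ 2 := by
    rw [← ncard_eq_toFinset_card _ hfin]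
    exact (ncard_insert_le a {b}).trans (by simp)
  -- `Y` is the simple expansion of the contraction at `w`, hence an elementary one.
  have hE : Y ≤ (Y.contract hF hw hFY).full := by
    have h1 := expand_le_full (Y.contract hF hw hFY) mem_contract 0
    have h2 : (Y.contract hF hw hFY).expand mem_contract 0 = Y := by
      apply AdmissibleSet.ext
      simp only [expand, contract, hd0, hd1]
      ext x
      by_cases hx : x = w
      · subst hx
        simp only [mem_union, mem_sdiff, mem_singleton_iff, hwY, mem_insert_iff]
        constructor
        · rintro (h | h | h)
          · tauto
          · exact absurd (h ▸ ha.1) hwY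
          · exact absurd (h ▸ hb.1) hwY
        · tauto
      · have h3 : x = a → x ∈ Y.carrier := fun h => h ▸ ha.1
        have h4 : x = b → x ∈ Y.carrier := fun h => h ▸ hb.1
        simp only [mem_union, mem_sdiff, mem_singleton_iff, mem_insert_iff]
        tauto
    rwa [h2] at h1
  refine ⟨T ∪ hfin.toFinset, Finset.subset_union_left, ?_, ?_⟩
  · have := Finset.card_union_le T hfin.toFinset
    omega
  · refine nullIn_of_contract hwY hF hw hFY ?_ (fun V hV => hV.2)
      (fun V hV => ⟨hV.1, hV.2.trans Finset.subset_union_left⟩) ?_ ?_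
    · rintro y (rfl | rfl)
      · exact ha.2
      · exact hb.2
    · intro V hFV C hC hV
      refine ⟨?_, (supp_contract_subset hfin hC).trans
        (Finset.union_subset_union hV.2 subset_rfl)⟩
      change Y ≤ C.1.full
      rw [hC]
      refine le_iff.2 fun y hy => ?_
      -- Below `w` the comparison is with the contraction of `Y` itself, elsewhere with the
      -- untouched element of `V` above `y`.
      by_cases hyF : y ∈ ({a, b} : Set (HigmanAlgebra 3))
      · rw [under_full_eq (Q := Y.contract hF hw hFY) mem_contract mem_contract
          (hF.im_subset y hyF)]
        exact le_iff.1 hE y hy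
      · obtain ⟨v, hv, hyv⟩ := exists_im_subset V.2.le hy
        have hvF : v ∉ ({a, b} : Set (HigmanAlgebra 3)) := fun hvF =>
          hyF (Y.eq_of_im_subset hy (hFY hvF) Subset.rfl hyv ▸ hvF)
        rw [under_full_eq (Q := V.1) (mem_contract_of_mem hv hvF) hv hyv]
        exact le_iff.1 hV.1 y hy
    · intro C hC
      refine ⟨?_, (supp_contract_self_subset hfin hC).trans Finset.subset_union_right⟩
      change Y ≤ C.1.full
      rw [hC]
      exact hE

theorem fill_geom_univ {Y : AdmissibleSet 3} {d : ℕ} (hd : fillBound d + 2 ≤ Y.card) :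
    Nonempty Y.K ∧ Fill d (Geom (univ : Set Y.K)) (Geom (univ : Set Y.K)) := by
  classical
  have hne : Nonempty Y.K := by
    obtain ⟨T', -, -, p, hp, -⟩ := exists_nullIn (Y := Y) ∅ (by
      rw [Finset.card_empty]
      omega)
    exact ⟨(Geom.exists_ne_zero hp).choose⟩
  refine ⟨hne, fill_univ_of_upper (fun Z hZ => nullIn_of_notMem_elementary hZ) ?_⟩
  exact fill_of_bounded_nullIn supp (N := fillBound d) le_rfl
    (fun W hW T => exists_nullIn_above hW T) fun T hT => exists_nullIn T (by omega)

end AdmissibleSet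

end Elementary
end Brin

namespace Brin
open Set Topology Metric

/-! ### The geometric realisation in barycentric coordinates -/

section Realization

variable {P : Type*} [PartialOrder P] [Fintype P]

namespace Realization

lemma coord_mem_Geom (x : Realization (orderComplex P)) :
    (fun v => x.1 v) ∈ Geom (univ : Set P) := by
  refine ⟨x.2.1, ?_, ?_, fun _ _ => mem_univ _⟩
  · exact (Finsupp.sum_fintype x.1 _ fun _ => rfl).symm.trans x.2.2.1
  · exact x.2.2.2.2.mono fun v hv => Finsupp.mem_support_iff.2 hv

lemma support_mem_faces {x : P → ℝ} (hx : x ∈ Geom (univ : Set P)) :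
    (Finsupp.equivFunOnFinite.symm x).support ∈ (orderComplex P).faces := by
  refine ⟨?_, ?_⟩
  · obtain ⟨v, hv⟩ := Geom.exists_ne_zero hx
    exact ⟨v, by simpa using hv⟩
  · exact hx.2.2.1.mono fun v hv => Finsupp.mem_support_iff.1 hv

/-- The point of the realisation with given barycentric coordinates. -/
noncomputable def ofGeom (x : Geom (univ : Set P)) : Realization (orderComplex P) :=
  ⟨Finsupp.equivFunOnFinite.symm x.1, x.2.1,
    (Finsupp.sum_fintype _ _ fun _ => rfl).trans x.2.2.1, support_mem_faces x.2⟩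

omit [Fintype P] in
lemma continuous_coord :
    Continuous fun (x : Realization (orderComplex P)) (v : P) => x.1 v := by
  refine continuous_iSup_dom.2 fun σ => continuous_coinduced_dom.2 ?_
  exact continuous_induced_dom

lemma continuous_of_mem_closedSimplex {A V : Type*} [TopologicalSpace A]
    {K : AbstractSimplicialComplex V} (σ : K.faces) {f : A → Realization K}
    (hσ : ∀ a, f a ∈ closedSimplex K σ.1) (hf : Continuous fun a (v : V) => (f a).1 v) :
    Continuous f := by
  refine continuous_def.2 fun U hU => ?_
  obtain ⟨W, hW, hWU⟩ := isOpen_induced_iff.1 (isOpen_coinduced.1 (isOpen_iSup_iff.1 hU σ))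
  convert hW.preimage hf using 1
  ext a
  exact (Set.ext_iff.1 hWU ⟨f a, hσ a⟩).symm

lemma continuousOn_ofGeom (σ : (orderComplex P).faces) :
    ContinuousOn (ofGeom : Geom (univ : Set P) → _) {x | ∀ v, x.1 v ≠ 0 → v ∈ σ.1} := by
  rw [continuousOn_iff_continuous_domRestrict]
  refine continuous_of_mem_closedSimplex σ (fun x v hv => x.2 v (Finsupp.mem_support_iff.1 hv)) ?_
  exact continuous_subtype_val.comp continuous_subtype_val

/-- `P` is finite, so the closed simplices form a finite closed cover and the weak topology agrees
with the coordinate topology. -/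
lemma continuous_ofGeom :
    Continuous (ofGeom : Geom (univ : Set P) → Realization (orderComplex P)) := by
  have : Finite (Finset P) := inferInstance
  refine (locallyFinite_of_finite _).continuous (f := fun σ : (orderComplex P).faces =>
    {x : Geom (univ : Set P) | ∀ v, x.1 v ≠ 0 → v ∈ σ.1}) ?_ ?_ continuousOn_ofGeom
  · refine eq_univ_of_forall fun x => mem_iUnion.2 ⟨⟨_, support_mem_faces x.2⟩, ?_⟩
    intro v hv
    simpa using hv
  · intro σ
    simp only [ofPred_forall]
    refine isClosed_iInter fun v => ?_
    by_cases hv : v ∈ σ.1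
    · simp [hv]
    · simp only [hv, imp_false, not_not]
      exact isClosed_eq ((continuous_apply v).comp continuous_subtype_val) continuous_const

/-- The realisation of the order complex of a finite poset, in barycentric coordinates. -/
noncomputable def homeo : Realization (orderComplex P) ≃ₜ Geom (univ : Set P) where
  toFun x := ⟨fun v => x.1 v, coord_mem_Geom x⟩
  invFun := ofGeom
  left_inv _ := Subtype.ext <| Finsupp.ext fun _ => rfl
  right_inv _ := rfl
  continuous_toFun := continuous_coord.subtype_mk _
  continuous_invFun := continuous_ofGeom

end Realization

end Realization

/-! ### From fillings of spheres to vanishing homotopy groups -/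

section Connected

variable {E X : Type*} [TopologicalSpace E] [TopologicalSpace X] {S : Set E} {k : ℕ}

lemma exists_norm_apply_eq_one {y : Fin k → ℝ} (hy : ‖y‖ = 1) : ∃ i, ‖y i‖ = 1 := by
  by_contra! h
  have : ‖y‖ < 1 := (pi_norm_lt_iff one_pos).2 fun i =>
    lt_of_le_of_ne (hy ▸ norm_le_pi_norm y i) (h i)
  exact this.ne hy

/-- The projection from `Fin (k + 1) → ℝ` onto the unit cube in the last `k` coordinates. -/
noncomputable def cubeProj (y : Fin (k + 1) → ℝ) : Fin k → unitInterval :=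
  fun j => projIcc 0 1 zero_le_one ((y j.succ + 1) / 2)

/-- The affine map from the cylinder over the unit cube onto the unit ball. -/
def cubeIncl (p : unitInterval × (Fin k → unitInterval)) : Fin (k + 1) → ℝ :=
  Fin.cons (2 * (p.1 : ℝ) - 1) fun j => 2 * (p.2 j : ℝ) - 1

lemma continuous_cubeProj : Continuous (cubeProj (k := k)) := by
  refine continuous_pi fun j => continuous_projIcc.comp ?_
  fun_prop

lemma continuous_cubeIncl : Continuous (cubeIncl (k := k)) := by
  refine continuous_pi fun j => ?_
  refine Fin.cases ?_ (fun j => ?_) j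
  · simp only [cubeIncl, Fin.cons_zero]
    fun_prop
  · simp only [cubeIncl, Fin.cons_succ]
    fun_prop

lemma cubeProj_cubeIncl (p : unitInterval × (Fin k → unitInterval)) :
    cubeProj (cubeIncl p) = p.2 := by
  ext j
  have : (cubeIncl p j.succ + 1) / 2 = p.2 j := by
    simp only [cubeIncl, Fin.cons_succ]
    ring
  simp [cubeProj, this]

lemma norm_two_mul_sub_one_le (a : unitInterval) : ‖2 * (a : ℝ) - 1‖ ≤ 1 := by
  rw [Real.norm_eq_abs, abs_le]
  constructor <;> linarith [a.2.1, a.2.2]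

lemma norm_cubeIncl_le (p : unitInterval × (Fin k → unitInterval)) : ‖cubeIncl p‖ ≤ 1 := by
  refine (pi_norm_le_iff_of_nonneg zero_le_one).2 fun i => ?_
  refine Fin.cases ?_ (fun j => ?_) i
  · exact norm_two_mul_sub_one_le _
  · exact norm_two_mul_sub_one_le _

lemma cubeIncl_mem_sphere {p : unitInterval × (Fin k → unitInterval)} {i : Fin (k + 1)}
    (h : ‖cubeIncl p i‖ = 1) : cubeIncl p ∈ sphere (0 : Fin (k + 1) → ℝ) 1 :=
  mem_sphere_zero_iff_norm.2 <| (norm_cubeIncl_le p).antisymm <| h ▸ norm_le_pi_norm _ i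

lemma cubeIncl_mem_sphere_of_mem_boundary {p : unitInterval × (Fin k → unitInterval)}
    (hp : p.2 ∈ Cube.boundary (Fin k)) : cubeIncl p ∈ sphere (0 : Fin (k + 1) → ℝ) 1 := by
  obtain ⟨j, hj⟩ := hp
  refine cubeIncl_mem_sphere (i := j.succ) ?_
  rcases hj with hj | hj <;> simp only [cubeIncl, Fin.cons_succ, hj] <;> norm_num

lemma cubeProj_mem_boundary {y : Fin (k + 1) → ℝ} (hy : y ∈ sphere (0 : Fin (k + 1) → ℝ) 1)
    (h0 : y 0 = 0) : cubeProj y ∈ Cube.boundary (Fin k) := by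
  obtain ⟨i, hi⟩ := exists_norm_apply_eq_one (mem_sphere_zero_iff_norm.1 hy)
  refine Fin.cases (fun hi => ?_) (fun j hi => ?_) i hi
  · simp [h0] at hi
  · rw [Real.norm_eq_abs] at hi
    rcases eq_or_eq_neg_of_abs_eq hi with h | h
    · exact ⟨j, .inr (by simp [cubeProj, h])⟩
    · exact ⟨j, .inl (by simp [cubeProj, h])⟩

/-- Place `f` on the half `y 0 ≤ 0` and `g` on the half `0 ≤ y 0` of the sup-norm sphere, each
composed with the projection to the cube. They agree on the equator, which projects to the boundary
of the cube. A filling, read on the cylinder, is the homotopy; it is constant in time on the sides.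
-/
lemma homotopicRel_boundary_of_fill (e : X ≃ₜ S) (hfill : Fill (k + 1) S S)
    (f g : C(Fin k → unitInterval, X)) (h : ∀ x ∈ Cube.boundary (Fin k), f x = g x) :
    f.HomotopicRel g (Cube.boundary (Fin k)) := by
  classical
  let U : Set (Fin (k + 1) → ℝ) := {y | y 0 ≤ 0}
  let V : Set (Fin (k + 1) → ℝ) := {y | 0 ≤ y 0}
  let φ : (Fin (k + 1) → ℝ) → E :=
    U.piecewise (fun y => e (f (cubeProj y))) fun y => e (g (cubeProj y))
  have hc : ∀ q : C(Fin k → unitInterval, X), Continuous fun y => (e (q (cubeProj y)) : E) :=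
    fun q => continuous_subtype_val.comp
      (e.continuous.comp (q.continuous.comp continuous_cubeProj))
  have hφ : ContinuousOn φ (sphere 0 1) := by
    refine continuousOn_piecewise_of_isClosed (V := V) (isClosed_le (by fun_prop) (by fun_prop))
      (isClosed_le (by fun_prop) (by fun_prop)) (fun y _ => le_total (y 0) 0)
      (hc f).continuousOn (hc g).continuousOn ?_
    rintro y ⟨⟨hy, h1⟩, h2⟩
    simp only
    rw [h _ (cubeProj_mem_boundary hy (le_antisymm h1 h2))]
  have hφS : MapsTo φ (sphere 0 1) S := by
    intro y _
    by_cases hy : y ∈ U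
    · simp only [φ, piecewise_eq_of_mem _ _ _ hy, Subtype.coe_prop]
    · simp only [φ, piecewise_eq_of_notMem _ _ _ hy, Subtype.coe_prop]
  obtain ⟨F, hF, hFS, hFφ⟩ := hfill φ hφ hφS
  have hball : ∀ p, cubeIncl (k := k) p ∈ closedBall (0 : Fin (k + 1) → ℝ) 1 := fun p =>
    mem_closedBall_zero_iff.2 (norm_cubeIncl_le p)
  have hcont : Continuous fun p => F (cubeIncl (k := k) p) :=
    hF.comp_continuous continuous_cubeIncl hball
  have h0 : ∀ p : unitInterval × (Fin k → unitInterval), cubeIncl p 0 = 2 * (p.1 : ℝ) - 1 :=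
    fun p => rfl
  have hfrom : ∀ p : unitInterval × (Fin k → unitInterval), cubeIncl p ∈ U →
      φ (cubeIncl p) = e (f p.2) := by
    intro p hp
    simp only [φ, piecewise_eq_of_mem _ _ _ hp, cubeProj_cubeIncl]
  have hto : ∀ p : unitInterval × (Fin k → unitInterval), cubeIncl p ∉ U →
      φ (cubeIncl p) = e (g p.2) := by
    intro p hp
    simp only [φ, piecewise_eq_of_notMem _ _ _ hp, cubeProj_cubeIncl]
  refine ⟨⟨⟨⟨fun p => e.symm ⟨F (cubeIncl p), hFS (hball p)⟩,
    e.symm.continuous.comp (hcont.subtype_mk _)⟩, fun x => ?_, fun x => ?_⟩, fun t x hx => ?_⟩⟩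
  · refine (e.symm_apply_eq).2 (Subtype.ext ?_)
    have : cubeIncl ((0 : unitInterval), x) 0 = -1 := by rw [h0]; norm_num
    refine (hFφ (cubeIncl_mem_sphere (i := 0) (by rw [this]; norm_num))).trans (hfrom _ ?_)
    change cubeIncl ((0 : unitInterval), x) 0 ≤ 0
    rw [this]
    norm_num
  · refine (e.symm_apply_eq).2 (Subtype.ext ?_)
    have : cubeIncl ((1 : unitInterval), x) 0 = 1 := by rw [h0]; norm_num
    refine (hFφ (cubeIncl_mem_sphere (i := 0) (by rw [this]; norm_num))).trans (hto _ ?_)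
    change ¬ cubeIncl ((1 : unitInterval), x) 0 ≤ 0
    rw [this]
    norm_num
  · refine (e.symm_apply_eq).2 (Subtype.ext ?_)
    refine (hFφ (cubeIncl_mem_sphere_of_mem_boundary (p := (t, x)) hx)).trans ?_
    by_cases hp : cubeIncl (t, x) ∈ U
    · exact hfrom _ hp
    · rw [hto _ hp]
      exact congrArg (fun z => (e z : E)) (h x hx).symm

lemma isTConnected_of_fill [Nonempty X] {t : ℕ} (e : X ≃ₜ S)
    (hfill : ∀ d ≤ t + 1, Fill d S S) : IsTConnected t X := by
  refine ⟨⟨inferInstance, fun x y => ?_⟩, fun k _ hkt x => ?_⟩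
  -- For `k = 0` the cube is a point with empty boundary, so the homotopy is a path from `x` to `y`.
  · obtain ⟨H⟩ := homotopicRel_boundary_of_fill (k := 0) e (hfill 1 (by omega))
      (ContinuousMap.const _ x) (ContinuousMap.const _ y) (by rintro _ ⟨i, _⟩; exact i.elim0)
    exact ⟨⟨⟨fun s => H (s, default), by fun_prop⟩, by simp, by simp⟩⟩
  · refine ⟨fun a b => ?_⟩
    induction a, b using Quotient.inductionOn₂ with
    | h a b =>
      refine Quotient.sound (homotopicRel_boundary_of_fill e (hfill (k + 1) (by omega)) a.1 b.1
        fun y hy => ?_)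
      exact (a.2 y hy).trans (b.2 y hy).symm

end Connected

/-! ### Contracting the skeleta -/

section Skeleton

variable {P : Type*} [PartialOrder P] [Fintype P]

open Classical in
/-- The cells of the unit cube away from the origin that correspond to chains with at most `n`
elements: radial projection identifies their union with a skeleton of the order complex. -/
def chainCells (P : Type*) [PartialOrder P] [Fintype P] (n : ℕ) : Set (Cell P) :=
  {c | (∀ v, 0 ≤ c.lo v ∧ c.hi v ≤ 1) ∧ (∃ v, c.lo v = 1) ∧ IsChain (· ≤ ·) {v | c.hi v = 1} ∧
    (Finset.univ.filter fun v => c.hi v = 1).card ≤ n}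

lemma chainCells_finite (n : ℕ) : (chainCells P n).Finite := by
  classical
  have hinj : Function.Injective fun c : Cell P => (c.lo, c.hi) := fun c d h =>
    Cell.ext (congrArg Prod.fst h) (congrArg Prod.snd h)
  refine (((finite_Icc (0 : P → ℤ) 1).prod (finite_Icc (0 : P → ℤ) 1)).preimage
    hinj.injOn).subset ?_
  intro c hc
  exact ⟨⟨fun v => (hc.1 v).1, fun v => (c.lo_le v).trans (hc.1 v).2⟩,
    ⟨fun v => (hc.1 v).1.trans (c.lo_le v), fun v => (hc.1 v).2⟩⟩

lemma mem_chainCells_of_le {n : ℕ} {c d : Cell P} (hc : c ∈ chainCells P n) (h : d ≤ c) :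
    d ∈ chainCells P n := by
  classical
  obtain ⟨h1, ⟨v, hv⟩, h3, h4⟩ := hc
  have hhi : ∀ w, d.hi w = 1 → c.hi w = 1 := fun w hw =>
    (h1 w).2.antisymm (hw ▸ (h w).2)
  refine ⟨fun w => ⟨(h1 w).1.trans (h w).1, (h w).2.trans (h1 w).2⟩, ⟨v, ?_⟩, h3.mono hhi,
    (Finset.card_le_card fun w => ?_).trans h4⟩
  · exact ((d.lo_le v).trans ((h v).2.trans (h1 v).2)).antisymm (hv ▸ (h v).1)
  · simpa using hhi w

/-- One of the at most `n` coordinates in the chain is fixed at 1. The strict inequality is what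
makes fillings up to `d = t + 1` enough for cylinders over the `t`-skeleton. -/
lemma dim_lt_of_mem_chainCells {n : ℕ} {c : Cell P} (hc : c ∈ chainCells P n) : c.dim < n := by
  classical
  obtain ⟨h1, ⟨v, hv⟩, -, h4⟩ := hc
  have hv' : c.hi v = 1 := (h1 v).2.antisymm (hv ▸ c.lo_le v)
  refine (Finset.card_lt_card (Finset.ssubset_iff_of_subset (fun w hw => ?_) |>.2
    ⟨v, by simpa using hv', by simp [hv, hv']⟩)).trans_le h4
  have hw' : c.lo w < c.hi w := by simpa using hw
  have := h1 w
  simp only [Finset.mem_filter, Finset.mem_univ, true_and]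
  omega

lemma one_le_sum_of_mem_body {n : ℕ} {c : Cell P} (hc : c ∈ chainCells P n) {z : P → ℝ}
    (hz : z ∈ c.body) : 1 ≤ ∑ v, z v := by
  obtain ⟨h1, ⟨v, hv⟩, -, -⟩ := hc
  have h0 : ∀ w, 0 ≤ z w := fun w => (Int.cast_nonneg (h1 w).1).trans (hz w).1
  have h2 : (1 : ℝ) ≤ z v := by simpa [hv] using (hz v).1
  exact h2.trans (Finset.single_le_sum (fun w _ => h0 w) (Finset.mem_univ v))

lemma inv_sum_smul_mem_Geom {n : ℕ} {c : Cell P} (hc : c ∈ chainCells P n) {z : P → ℝ}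
    (hz : z ∈ c.body) : (∑ v, z v)⁻¹ • z ∈ Geom (univ : Set P) := by
  have hs := one_le_sum_of_mem_body hc hz
  obtain ⟨h1, -, h3, -⟩ := hc
  have h0 : ∀ w, 0 ≤ z w := fun w => (Int.cast_nonneg (h1 w).1).trans (hz w).1
  refine ⟨fun w => mul_nonneg (by positivity) (h0 w), ?_, h3.mono fun w hw => ?_,
    fun _ _ => mem_univ _⟩
  · simp only [Pi.smul_apply, smul_eq_mul, ← Finset.mul_sum]
    exact inv_mul_cancel₀ (by positivity)
  · have hzw : 0 < z w := lt_of_le_of_ne (h0 w) fun h => hw (by simp [← h])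
    have : (0 : ℝ) < c.hi w := hzw.trans_le (hz w).2
    have : 0 < c.hi w := by exact_mod_cast this
    have := (h1 w).2
    change c.hi w = 1
    omega

/-- The scaled point has coordinate 1 where the maximum is attained and 0 outside the support, which
singles out the cell. -/
lemma inv_norm_smul_mem_bodies {x : P → ℝ} (hx : x ∈ Geom (univ : Set P)) {n : ℕ}
    (hn : (Function.support x).ncard ≤ n) : ‖x‖⁻¹ • x ∈ Cell.bodies (chainCells P n) := by
  classical
  obtain ⟨v, hv⟩ := Geom.exists_ne_zero hx
  have hx0 : 0 < ‖x‖ := norm_pos_iff.2 fun h => hv (by simp [h])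
  obtain ⟨m, hm⟩ : ∃ m, x m = ‖x‖ := by
    by_contra! h
    have : ‖x‖ < ‖x‖ := (pi_norm_lt_iff hx0).2 fun i => by
      have := norm_le_pi_norm x i
      rw [Real.norm_of_nonneg (hx.1 i)] at this ⊢
      exact lt_of_le_of_ne this (h i)
    exact this.false
  refine Cell.mem_bodies.2 ⟨⟨fun w => if x w = ‖x‖ then 1 else 0,
    fun w => if x w ≠ 0 then 1 else 0, fun w => ?_, fun w => ?_⟩, ⟨fun w => ?_, ⟨m, if_pos hm⟩, ?_,
    ?_⟩, fun w => ?_⟩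
  · split_ifs with h1 h2 <;> simp_all
  · split_ifs <;> simp
  · constructor <;> simp only <;> split_ifs <;> simp
  · refine hx.2.2.1.mono fun w hw => ?_
    by_contra h
    simp_all
  · refine le_trans (le_of_eq ?_) hn
    rw [ncard_eq_toFinset_card']
    congr 1
    ext w
    simp
  · have h1 : 0 ≤ x w := hx.1 w
    have h2 : x w ≤ ‖x‖ := (le_abs_self _).trans (norm_le_pi_norm x w)
    simp only [Pi.smul_apply, smul_eq_mul]
    constructor
    · split_ifs with h
      · rw [h, inv_mul_cancel₀ hx0.ne', Int.cast_one]
      · rw [Int.cast_zero]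
        positivity
    · split_ifs with h
      · rw [Int.cast_one, inv_mul_le_one₀ hx0]
        exact h2
      · simp only [not_not] at h
        simp [h]

/-- Rescaling between coordinate sum 1 and sup norm 1 turns the skeleton into a union of cubical
cells, over which `exists_htpyOn_of_fill` contracts the inclusion with top prescribed to be `p`. -/
lemma nullhomotopic_skeletonInclusion [Nonempty P] {t : ℕ}
    (hfill : ∀ d ≤ t + 1, Fill d (Geom (univ : Set P)) (Geom univ)) :
    (Realization.skeletonInclusion (orderComplex P) t).Nullhomotopic := by
  classical
  let p : P → ℝ := Pi.single (Classical.arbitrary P) 1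
  have hp : p ∈ Geom (univ : Set P) := single_mem_Geom (mem_univ _)
  let L := chainCells P (t + 1)
  let f : (P → ℝ) → P → ℝ := fun z => (∑ v, z v)⁻¹ • z
  have hf : ContinuousOn f (Cell.bodies L) := by
    have hsum : Continuous fun z : P → ℝ => ∑ v, z v := by fun_prop
    refine (hsum.continuousOn.inv₀ fun z hz => ?_).smul continuousOn_id
    obtain ⟨c, hc, hzc⟩ := Cell.mem_bodies.1 hz
    exact (zero_lt_one.trans_le (one_le_sum_of_mem_body hc hzc)).ne'
  obtain ⟨g, -, hg, H, hH, hH0, hH1, hHS⟩ := Cell.exists_htpyOn_of_fill (chainCells_finite (t + 1))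
    (fun c hc d hd => mem_chainCells_of_le hc hd) (fun _ => Geom univ) (fun _ => {p})
    (fun _ => Geom univ) (fun _ => {p}) (fun _ => Geom univ) (S := Geom univ)
    (fun _ _ _ _ => subset_rfl) (fun _ _ _ _ => subset_rfl) (fun _ _ _ _ => subset_rfl)
    (fun _ _ _ _ => singleton_subset_iff.2 hp)
    (fun c hc φ _ hφ => ⟨fun _ => p, continuousOn_const, fun _ _ => rfl, fun x hx => (hφ hx).symm⟩)
    (fun c hc => hfill _ (dim_lt_of_mem_chainCells hc)) (fun _ _ => subset_rfl) hf
    (fun c hc z hz => inv_sum_smul_mem_Geom hc hz)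
  let e := Realization.homeo (P := P)
  let r : Realization.skeleton (orderComplex P) t → P → ℝ := fun x => ‖(e x.1).1‖⁻¹ • (e x.1).1
  have hr : ∀ x, r x ∈ Cell.bodies L := by
    intro x
    refine inv_norm_smul_mem_bodies (e x.1).2 (le_trans (le_of_eq ?_) x.2)
    rw [← ncard_coe_finset, ← Finsupp.fun_support_eq]
    rfl
  have hnorm : ∀ x : Geom (univ : Set P), ‖x.1‖ ≠ 0 := by
    intro x h
    obtain ⟨v, hv⟩ := Geom.exists_ne_zero x.2
    exact hv (by simp [norm_eq_zero.1 h])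
  have hrc : Continuous r := by
    have h1 : Continuous fun x : Realization.skeleton (orderComplex P) t => (e x.1).1 :=
      continuous_subtype_val.comp (e.continuous.comp continuous_subtype_val)
    exact (h1.norm.inv₀ fun x => hnorm _).smul h1
  have hfr : ∀ x, f (r x) = (e x.1).1 := by
    intro x
    have h1 : ∑ v, r x v = ‖(e x.1).1‖⁻¹ := by
      simp only [r, Pi.smul_apply, smul_eq_mul, ← Finset.mul_sum, (e x.1).2.2.1, mul_one]
    simp only [f, h1, inv_inv]
    exact smul_inv_smul₀ (hnorm _) _
  have hm : ∀ q : unitInterval × Realization.skeleton (orderComplex P) t,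
      ((q.1 : ℝ), r q.2) ∈ Icc (0 : ℝ) 1 ×ˢ Cell.bodies L := fun q => ⟨q.1.2, hr q.2⟩
  refine ⟨e.symm ⟨p, hp⟩, ⟨⟨⟨fun q => e.symm ⟨H (q.1, r q.2), hHS (hm q)⟩,
    e.symm.continuous.comp (Continuous.subtype_mk (hH.comp_continuous (by fun_prop) hm) _)⟩,
    fun x => ?_, fun x => ?_⟩⟩⟩
  · exact (e.symm_apply_eq).2 (Subtype.ext ((hH0 _ (hr x)).trans (hfr x)))
  · refine congrArg e.symm (Subtype.ext ((hH1 _ (hr x)).trans ?_))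
    obtain ⟨c, hc, hxc⟩ := Cell.mem_bodies.1 (hr x)
    exact hg c hc hxc

end Skeleton

end Brin

theorem mainTheorem7 :
    ∃ α : ℕ → ℕ, ∀ (t : ℕ) (Y : Brin.AdmissibleSet 3), α t ≤ Y.card →
      (Brin.Realization.skeletonInclusion (Brin.orderComplex Y.K) t).Nullhomotopic ∧
      Brin.IsTConnected t (Brin.Realization (Brin.orderComplex Y.K)) := by
  -- The sum dominates `fillBound d` for every `d ≤ t + 1`; the summand 2 provides two elements of
  -- `Y` outside any label of size at most `fillBound d`.
  refine ⟨fun t => ∑ d ∈ Finset.range (t + 2), Brin.fillBound d + 2, fun t Y hY => ?_⟩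
  have h : ∀ d ≤ t + 1, Brin.fillBound d + 2 ≤ Y.card := fun d hd =>
    (Nat.add_le_add_right (Finset.single_le_sum (fun _ _ => Nat.zero_le _)
      (Finset.mem_range.2 (by omega))) 2).trans hY
  have : Nonempty Y.K := (Brin.AdmissibleSet.fill_geom_univ (h 0 (by omega))).1
  have hfill := fun d hd => (Brin.AdmissibleSet.fill_geom_univ (h d hd)).2
  have : Nonempty (Brin.Realization (Brin.orderComplex Y.K)) :=
    this.map fun v => Brin.Realization.homeo.symm
      ⟨_, by classical exact Brin.single_mem_Geom (Set.mem_univ v)⟩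
  exact ⟨Brin.nullhomotopic_skeletonInclusion hfill,
    Brin.isTConnected_of_fill Brin.Realization.homeo hfill⟩
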